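/- **Setting.** Fix integers $K,M$, a set $D\subseteq\mathbb R$ and measurable basis functions $\phi_1,\phi_2,\dots:\mathbb R\to\mathbb R$. Outcomes follow the semiparametric factor model $$y_{it}=\alpha(z_{it})+\beta(z_{it})'f_t+\varepsilon_{it},\qquad i\le N,\ t\le T,$$ with covariates $z_{it}\in\mathbb R^M$ taking values a.s. in $D^M$, nonrandom factors $f_t\in\mathbb R^K$, and separable functions $\alpha(z)=\sum_{m\le M}\alpha_m(z_m)$, $\beta_k(z)=\sum_{m\le M}\beta_{km}(z_m)$. For a sieve size $J$ let $\bar\phi(x)=(\phi_1(x),\dots,\phi_J(x))'$, $\phi(z)=(\bar\phi(z_1)',\dots,\bar\phi(z_M)')'\in\mathbb R^{JM}$, and let $a\in\mathbb R^{JM}$, $B\in\mathbb R^{JM\times K}$ collect sieve coefficients $a_{m,j}$, $b_{km,j}$, with approximation errors $r_{m,J}=\alpha_m-\sum_{j\le J}a_{m,j}\phi_j$ and $\delta_{km,J}=\beta_{km}-\sum_{j\le J}b_{km,j}\phi_j$. Suprema are over $D$ (univariate functions) or $D^M$ (functions of $z$). Put $\xi_J=\sup_{x}\|\bar\phi(x)\|$,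 $F=(f_1,\dots,f_T)'$, $M_T=I_T-1_T1_T'/T$, $\varepsilon_t=(\varepsilon_{it})_{i\le N}$, $Z_t=(z_{it})_{i\le N}$, $\Phi_t=(\phi(z_{1t}),\dots,\phi(z_{Nt}))'$, $Y_t=(y_{1t},\dots,y_{Nt})'$, $\hat Q_t=\Phi_t'\Phi_t/N$ and $Q_{it}=E[\phi(z_{it})\phi(z_{it})']$. **Estimators (regressed-PCA).** Let $\tilde Y_t=(\Phi_t'\Phi_t)^{-1}\Phi_t'Y_t$, $\tilde Y=(\tilde Y_1,\dots,\tilde Y_T)$, $\bar{\tilde Y}=\frac1T\sum_t\tilde Y_t$. The columns of $\hat B$ are orthonormal eigenvectors (any choice) of $\tilde YM_T\tilde Y'/T$ for its $K$ largest eigenvalues, in descending order; $\hat a=(I-\hat B\hat B')\bar{\tilde Y}$, $\hat F=\tilde Y'\hat B$, $\hat\alpha(z)=\hat a'\phi(z)$, $\hat\beta(z)=\hat B'\phi(z)$. Let $H=(F'M_T\hat F)(\hat F'M_T\hat F)^{-1}$. **Asymptotics.** Consider a sequence of such panels with sizes $(N,T,J)=(N_n,T_n,J_n)$; the law of $(z_{it},\varepsilon_{it})$,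 the $f_t$, $a$ and $B$ may depend on $n$, while $\phi_j,\alpha,\beta,K,M,D$ do not. All constants below are positive and do not depend on $n$, and bounds on $\max_{i\le N,t\le T}$ etc. hold uniformly in $n$. **Assumptions.** 1. With probability tending to one, $c_{\min}<\min_{t}\lambda_{\min}(\hat Q_t)\le\max_{t}\lambda_{\max}(\hat Q_t)<c_{\max}$; and $\max_{m,j\le J,i,t}E[\phi_j(z_{it,m})^2]\le C$. 2. (i) $d_{\min}<\lambda_{\min}(B'B)\le\lambda_{\max}(B'B)<d_{\max}$; (ii) $\max_t\|f_t\|<d_{\max}$; (iii) $\lambda_{\min}(F'M_TF/T)>d_{\min}$; (iv) $\max_{k,m}\sup_x|\delta_{km,J}(x)|=O(J^{-\kappa})$ and $\max_m\sup_x|r_{m,J}(x)|=O(J^{-\kappa})$ for some constant $\kappa>1/2$. 3. (i) $\{\varepsilon_t\}_{t\le T}$ is independent of $\{Z_t\}_{t\le T}$; (ii) the $\varepsilon_{it}$ are square integrable with $E[\varepsilon_{it}]=0$; (iii) $\max_{i,t}\sum_{j}|E[\varepsilon_{it}\varepsilon_{jt}]|<C_1$ and $\frac1{NT}\sum_{i,j}\sum_{t,s}|E[\varepsilon_{it}\varepsilon_{js}]|<C_1$.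 4. $a'B=0$ and $\|a\|<C_0$. 5. (i) $\max_{m,j\le J,i,t}E[\phi_j(z_{it,m})^4]\le C$; (ii) all eigenvalues of all $Q_{it}$ lie in $(q_{\min},q_{\max})$ with $q_{\min}>0$; (iii) the families $(z_{it})_{t\le T}$, $i\le N$, are independent across $i$; (iv) the $\varepsilon_{it}$ have finite fourth moments, $\max_t\frac1{N^2}\sum_{i,j,k,\ell}|E[\varepsilon_{it}\varepsilon_{jt}\varepsilon_{kt}\varepsilon_{\ell t}]|<C_2$ and $\frac1{N^2T}\sum_t\big(\sum_s\sum_{i,j}|E[\varepsilon_{it}\varepsilon_{js}]|\big)^2<C_2$. **Theorem.** Suppose Assumptions 1–5 hold, $N\to\infty$, either $T\to\infty$ or $T\ge K+1$ is fixed, and $J\to\infty$ with $J^2\xi_J^2\log J=o(N)$. Then $$\|\hat a-a\|^2=O_p\Big(\frac1{J^{2\kappa}}+\frac J{N^2}+\frac J{NT}\Big),\qquad \|\hat B-BH\|_F^2=O_p\Big(\frac1{J^{2\kappa}}+\frac J{N^2}+\frac J{NT}\Big),$$ $$\frac1T\|\hat F-F(H')^{-1}\|_F^2=O_p\Big(\frac1{J^{2\kappa}}+\frac1N\Big),$$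 $$\sup_z|\hat\alpha(z)-\alpha(z)|^2=O_p\Big(\frac1{J^{2\kappa-1}}+\frac{J^2}{N^2}+\frac{J^2}{NT}\Big)\max_{j\le J}\sup_x|\phi_j(x)|^2,$$ $$\sup_z\|\hat\beta(z)-H'\beta(z)\|^2=O_p\Big(\frac1{J^{2\kappa-1}}+\frac{J^2}{N^2}+\frac{J^2}{NT}\Big)\max_{j\le J}\sup_x|\phi_j(x)|^2.$$ Here $X_n=O_p(r_n)$ means that for each $\epsilon>0$ there is $C$ with $P(X_n>Cr_n)\le\epsilon$ for all large $n$, and inverses of singular matrices (which occur with probability tending to zero) are set to $0$. -/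

import Mathlib

open MeasureTheory ProbabilityTheory Filter Topology Matrix
open scoped ENNReal

namespace RegressedPCA

noncomputable section

/-! ### Norms, eigenvalue bounds, stochastic order -/

/-- Euclidean norm of a vector. -/
def vnorm {ι : Type*} [Fintype ι] (x : ι → ℝ) : ℝ := ‖WithLp.toLp 2 x‖

open scoped Matrix.Norms.Frobenius in
/-- Frobenius norm of a matrix. -/
def frobNorm {ι κ : Type*} [Fintype ι] [Fintype κ] (A : Matrix ι κ ℝ) : ℝ := ‖A‖

/-- `c < λ_min(A)`, for a symmetric matrix `A`: all eigenvalues of `A` exceed `c`. -/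
def LtEigMin {ι : Type*} [Fintype ι] [DecidableEq ι] (c : ℝ) (A : Matrix ι ι ℝ) : Prop :=
  ∀ x ∈ spectrum ℝ A, c < x

/-- `λ_max(A) < c`, for a symmetric matrix `A`: all eigenvalues of `A` are below `c`. -/
def EigMaxLt {ι : Type*} [Fintype ι] [DecidableEq ι] (A : Matrix ι ι ℝ) (c : ℝ) : Prop :=
  ∀ x ∈ spectrum ℝ A, x < c

/-- `X_n = O_p(r_n)` for nonnegative (possibly infinite) `X_n` and deterministic `r_n`: for every
`ε > 0` there is `C` with `P(X_n > C r_n) ≤ ε` for all large `n`. (For sets that are not measurable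
`μ` is the outer measure, so that no measurability of `X_n` is needed.) -/
def IsBigOp {Ω : Type*} [MeasurableSpace Ω] (μ : Measure Ω)
    (X : ℕ → Ω → ℝ≥0∞) (r : ℕ → ℝ≥0∞) : Prop :=
  ∀ ε : ℝ, 0 < ε → ∃ C : ℝ, 0 < C ∧
    ∀ᶠ n in atTop, μ {ω | ENNReal.ofReal C * r n < X n ω} ≤ ENNReal.ofReal ε

/-! ### The model -/

/-- The functions of the model: the domain `D` on which the univariate functions are considered
(each covariate takes its values there, and all suprema over `z` are over `D`, respectively `D^M`),
the sieve basis `φ 0, φ 1, …`, and the components `α_m` and `β_{km}` of the separable intercept and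
loading functions. -/
structure Model (K M : ℕ) where
  D : Set ℝ
  φ : ℕ → ℝ → ℝ
  φ_meas : ∀ j, Measurable (φ j)
  αc : Fin M → ℝ → ℝ
  βc : Fin K → Fin M → ℝ → ℝ

/-- A panel with `N` units and `T` periods, together with sieve coefficients of size `J`: covariates
`z_{it}` (random vectors in `ℝ^M`), errors `ε_{it}`, nonrandom factors `f_t`, and coefficients
`a = (a_{m,j})` and `B = (b_{km,j})`. -/
structure Panel (Ω : Type*) [MeasurableSpace Ω] (K M N T J : ℕ) where
  z : Fin N → Fin T → Ω → Fin M → ℝ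
  z_meas : ∀ i t, Measurable (z i t)
  ε : Fin N → Fin T → Ω → ℝ
  ε_meas : ∀ i t, Measurable (ε i t)
  f : Fin T → Fin K → ℝ
  a : Fin M × Fin J → ℝ
  B : Matrix (Fin M × Fin J) (Fin K) ℝ

namespace Model

variable {K M : ℕ} (S : Model K M)

/-- `D^M`. -/
def dom : Set (Fin M → ℝ) := {z | ∀ m, z m ∈ S.D}

/-- `α(z) = ∑_m α_m(z_m)`. -/
def α (z : Fin M → ℝ) : ℝ := ∑ m, S.αc m (z m)

/-- `β(z) = (∑_m β_{km}(z_m))_k`. -/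
def β (z : Fin M → ℝ) : Fin K → ℝ := fun k => ∑ m, S.βc k m (z m)

/-- The vector `φ(z)` of length `JM`, indexed by pairs `(m, j)`. -/
def phi (J : ℕ) (z : Fin M → ℝ) : Fin M × Fin J → ℝ := fun p => S.φ p.2 (z p.1)

/-- `ξ_J = sup_{z ∈ D} ‖(φ_1(z), …, φ_J(z))‖`. -/
def xi (J : ℕ) : ℝ≥0∞ := ⨆ z ∈ S.D, ENNReal.ofReal (vnorm fun j : Fin J => S.φ j z)

/-- `max_{j ≤ J} sup_{z ∈ D} |φ_j(z)|²`. -/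
def maxSupSq (J : ℕ) : ℝ≥0∞ := ⨆ j : Fin J, ⨆ z ∈ S.D, ENNReal.ofReal (|S.φ j z| ^ 2)

end Model

/-- `M_T = I_T - 1_T 1_T' / T`. -/
def MT (T : ℕ) : Matrix (Fin T) (Fin T) ℝ := 1 - (1 / (T : ℝ)) • Matrix.of fun _ _ => 1

/-- The columns of `B` are orthonormal eigenvectors of the symmetric matrix `A` corresponding to its
`K` largest eigenvalues (counted with multiplicity), in descending order.
Mathlib's `eigenvalues₀` lists the eigenvalues of `A` in descending order. -/
def IsLeadingEigenvectors {ι : Type*} [Fintype ι] [DecidableEq ι] {K : ℕ}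
    (A : Matrix ι ι ℝ) (B : Matrix ι (Fin K) ℝ) : Prop :=
  Bᵀ * B = 1 ∧ ∃ hA : A.IsHermitian, ∀ k : Fin K, ∃ hk : (k : ℕ) < Fintype.card ι,
    A *ᵥ (fun p => B p k) = hA.eigenvalues₀ ⟨k, hk⟩ • fun p => B p k

namespace Panel

variable {Ω : Type*} [MeasurableSpace Ω] {K M N T J : ℕ}
  (P : Panel Ω K M N T J) (S : Model K M)

/-- The approximation error `r_{m,J}(x) = α_m(x) - ∑_j a_{m,j} φ_j(x)`. -/
def r (m : Fin M) (x : ℝ) : ℝ := S.αc m x - ∑ j : Fin J, P.a (m, j) * S.φ j x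

/-- The approximation error `δ_{km,J}(x) = β_{km}(x) - ∑_j b_{km,j} φ_j(x)`. -/
def δ (k : Fin K) (m : Fin M) (x : ℝ) : ℝ :=
  S.βc k m x - ∑ j : Fin J, P.B (m, j) k * S.φ j x

/-- The observed outcome `y_{it} = α(z_{it}) + β(z_{it})' f_t + ε_{it}`. -/
def y (i : Fin N) (t : Fin T) (ω : Ω) : ℝ :=
  S.α (P.z i t ω) + S.β (P.z i t ω) ⬝ᵥ P.f t + P.ε i t ω

/-- `F = (f_1, …, f_T)'`. -/
def F : Matrix (Fin T) (Fin K) ℝ := Matrix.of P.f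

/-- `Φ(Z_t)`, the `N × JM` matrix with rows `φ(z_{it})'`. -/
def Phi (t : Fin T) (ω : Ω) : Matrix (Fin N) (Fin M × Fin J) ℝ :=
  Matrix.of fun i => S.phi J (P.z i t ω)

/-- `Q̂_t = Φ(Z_t)' Φ(Z_t) / N`. -/
def Qhat (t : Fin T) (ω : Ω) : Matrix (Fin M × Fin J) (Fin M × Fin J) ℝ :=
  (1 / (N : ℝ)) • ((P.Phi S t ω)ᵀ * P.Phi S t ω)

/-- `Q_{it} = E[φ(z_{it}) φ(z_{it})']`. -/
def Q (μ : Measure Ω) (i : Fin N) (t : Fin T) : Matrix (Fin M × Fin J) (Fin M × Fin J) ℝ :=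
  Matrix.of fun p q => ∫ ω, S.phi J (P.z i t ω) p * S.phi J (P.z i t ω) q ∂μ

/-- `Ỹ`, the `JM × T` matrix with columns `Ỹ_t = (Φ(Z_t)' Φ(Z_t))⁻¹ Φ(Z_t)' Y_t`, the coefficients
of the cross-sectional regressions. -/
def Ytilde (ω : Ω) : Matrix (Fin M × Fin J) (Fin T) ℝ :=
  Matrix.of fun p t =>
    (((P.Phi S t ω)ᵀ * P.Phi S t ω)⁻¹ *ᵥ ((P.Phi S t ω)ᵀ *ᵥ fun i => P.y S i t ω)) p

/-- `∑_t Ỹ_t / T`. -/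
def Ybar (ω : Ω) : Fin M × Fin J → ℝ := fun p => (∑ t, P.Ytilde S ω p t) / T

/-- `Ỹ M_T Ỹ' / T`, whose leading eigenvectors form the estimator `B̂`. -/
def pcaMatrix (ω : Ω) : Matrix (Fin M × Fin J) (Fin M × Fin J) ℝ :=
  (1 / (T : ℝ)) • (P.Ytilde S ω * MT T * (P.Ytilde S ω)ᵀ)

/-! The other estimators, as functions of `B̂`. -/

/-- `â = (I - B̂ B̂') Ȳ`, with `Ȳ` the mean of the `Ỹ_t`. -/
def ahat (Bhat : Matrix (Fin M × Fin J) (Fin K) ℝ) (ω : Ω) : Fin M × Fin J → ℝ :=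
  (1 - Bhat * Bhatᵀ) *ᵥ P.Ybar S ω

/-- `F̂ = Ỹ' B̂`. -/
def Fhat (Bhat : Matrix (Fin M × Fin J) (Fin K) ℝ) (ω : Ω) : Matrix (Fin T) (Fin K) ℝ :=
  (P.Ytilde S ω)ᵀ * Bhat

/-- `α̂(z) = â' φ(z)`. -/
def αhat (Bhat : Matrix (Fin M × Fin J) (Fin K) ℝ) (ω : Ω) (z : Fin M → ℝ) : ℝ :=
  P.ahat S Bhat ω ⬝ᵥ S.phi J z

/-- `H = (F' M_T F̂) (F̂' M_T F̂)⁻¹`. -/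
def H (Bhat : Matrix (Fin M × Fin J) (Fin K) ℝ) (ω : Ω) : Matrix (Fin K) (Fin K) ℝ :=
  (P.Fᵀ * MT T * P.Fhat S Bhat ω) * ((P.Fhat S Bhat ω)ᵀ * MT T * P.Fhat S Bhat ω)⁻¹

/-- `sup_z |α̂(z) - α(z)|²`. -/
def supErrα (Bhat : Matrix (Fin M × Fin J) (Fin K) ℝ) (ω : Ω) : ℝ≥0∞ :=
  ⨆ z ∈ S.dom, ENNReal.ofReal (|P.αhat S Bhat ω z - S.α z| ^ 2)

/-- `sup_z ‖β̂(z) - H' β(z)‖²`, where `β̂(z) = B̂' φ(z)`. -/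
def supErrβ (Bhat : Matrix (Fin M × Fin J) (Fin K) ℝ) (ω : Ω) : ℝ≥0∞ :=
  ⨆ z ∈ S.dom, ENNReal.ofReal
    (vnorm (Bhatᵀ *ᵥ S.phi J z - (P.H S Bhat ω)ᵀ *ᵥ S.β z) ^ 2)

end Panel

/-! ### Assumptions, on a sequence of panels of sizes `(N n, T n, J n)` -/

section Assumptions

variable {Ω : Type*} [MeasurableSpace Ω] (μ : Measure Ω) {K M : ℕ} (S : Model K M)
  {N T J : ℕ → ℕ} (P : ∀ n, Panel Ω K M (N n) (T n) (J n))

/-- Basis functions. -/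
structure BasisAssumption : Prop where
  gram : ∃ cmin cmax : ℝ, 0 < cmin ∧ 0 < cmax ∧
    Tendsto (fun n => μ {ω | ∀ t, LtEigMin cmin ((P n).Qhat S t ω) ∧
      EigMaxLt ((P n).Qhat S t ω) cmax}) atTop (𝓝 1)
  moment2 : ∃ C : ℝ, ∀ n i t m (j : Fin (J n)),
    Integrable (fun ω => S.φ j ((P n).z i t ω m) ^ 2) μ ∧
      ∫ ω, S.φ j ((P n).z i t ω m) ^ 2 ∂μ ≤ C

/-- Factor loading functions and factors. -/
structure LoadingsFactorsAssumption (κ : ℝ) : Prop where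
  bounds : ∃ dmin dmax : ℝ, 0 < dmin ∧ 0 < dmax ∧
    (∀ n, LtEigMin dmin ((P n).Bᵀ * (P n).B) ∧ EigMaxLt ((P n).Bᵀ * (P n).B) dmax) ∧
    (∀ n t, vnorm ((P n).f t) < dmax) ∧
    (∀ n, LtEigMin dmin ((1 / (T n : ℝ)) • ((P n).Fᵀ * MT (T n) * (P n).F)))
  kappa : 1 / 2 < κ
  approx : ∃ C : ℝ, ∀ᶠ n in atTop, ∀ m, ∀ x ∈ S.D,
    (∀ k, |(P n).δ S k m x| ≤ C * (J n : ℝ) ^ (-κ)) ∧ |(P n).r S m x| ≤ C * (J n : ℝ) ^ (-κ)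

/-- Data generating process. -/
structure DGPAssumption : Prop where
  indep : ∀ n, IndepFun (fun ω i t => (P n).ε i t ω) (fun ω i t => (P n).z i t ω) μ
  memLp : ∀ n i t, MemLp ((P n).ε i t) 2 μ
  mean : ∀ n i t, ∫ ω, (P n).ε i t ω ∂μ = 0
  weak : ∃ C₁ : ℝ, 0 < C₁ ∧
    (∀ n i t, ∑ j, |∫ ω, (P n).ε i t ω * (P n).ε j t ω ∂μ| < C₁) ∧
    (∀ n, (1 / ((N n : ℝ) * T n)) *
      ∑ i, ∑ j, ∑ t, ∑ s, |∫ ω, (P n).ε i t ω * (P n).ε j s ω ∂μ| < C₁)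

/-- Intercept function. -/
structure InterceptAssumption : Prop where
  orth : ∀ n, (P n).a ᵥ* (P n).B = 0
  bound : ∃ C₀ : ℝ, 0 < C₀ ∧ ∀ n, vnorm (P n).a < C₀

/-- Rate of convergence. -/
structure RateAssumption : Prop where
  moment4 : ∃ C : ℝ, ∀ n i t m (j : Fin (J n)),
    Integrable (fun ω => S.φ j ((P n).z i t ω m) ^ 4) μ ∧
      ∫ ω, S.φ j ((P n).z i t ω m) ^ 4 ∂μ ≤ C
  eig : ∃ qmin qmax : ℝ, 0 < qmin ∧ ∀ n i t,
    LtEigMin qmin ((P n).Q S μ i t) ∧ EigMaxLt ((P n).Q S μ i t) qmax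
  indep : ∀ n, iIndepFun (fun i ω t => (P n).z i t ω) μ
  memLp : ∀ n i t, MemLp ((P n).ε i t) 4 μ
  weak : ∃ C₂ : ℝ, 0 < C₂ ∧
    (∀ n t, (1 / (N n : ℝ) ^ 2) * ∑ i, ∑ j, ∑ k, ∑ l,
      |∫ ω, (P n).ε i t ω * (P n).ε j t ω * (P n).ε k t ω * (P n).ε l t ω ∂μ| < C₂) ∧
    (∀ n, (1 / ((N n : ℝ) ^ 2 * T n)) *
      ∑ t, (∑ s, ∑ i, ∑ j, |∫ ω, (P n).ε i t ω * (P n).ε j s ω ∂μ|) ^ 2 < C₂)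

end Assumptions

end

end RegressedPCA

open RegressedPCA

open RegressedPCA

namespace RegressedPCA

/-! ### Quadratic forms of symmetric matrices -/

section QuadraticForms

variable {ι : Type*} [Fintype ι] [DecidableEq ι] {A : Matrix ι ι ℝ}

/-! Where the Gram matrices are invertible, the cross-sectional regressions turn the model into a
factor model for coefficients: `Ỹ = a 1ᵀ + B Fᵀ + bias + noise`. Scaled by `T^{-1/2}` it reads `Y =
a uᵀ + B Fᵀ + D + E` with a unit vector `u`, and the demeaning `M = 1 - u uᵀ` removes the intercept.

The PCA step is an exact algebraic identity followed by norm bounds (`regressedPCA_perturbation`).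
If `V` is the diagonal matrix of leading eigenvalues, the eigenvector equation gives `C = Y (M F̂)
V⁻¹`, hence `C - B H = (D + E) (M F̂) V⁻¹`. No eigengap is needed, only a lower bound for `V`, which
a Courant–Fischer argument on the range of `B` supplies (`le_eigenvalues₀_of_le_on_range`). Bounding
`E` by its norm would give only the squared rate `J/N`. Expanding `M F̂ = M F BᵀC + M DᵀC + M EᵀC`
does better: `E M F` averages over time and has squared order `J/(NT)`; in `E M Eᵀ B H` the factor
`EᵀB` projects the noise on `K` fixed directions and has squared order `1/N`, so that the product
has `J/N²`; and `E M Eᵀ (C - B H)` is absorbed into the left side because `E` is small. The bounds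
for `â` and `F̂` follow from the same identities, from `aᵀB = 0` and from the invertibility of `H`.

The orders of the noise terms are second moment computations. Least squares weights are functions of
the covariates, hence independent of the errors, so expectations factor. A whole coefficient vector
costs a factor `MJ` (`integral_sum_sq_noise_le`), a fixed projection does not
(`integral_sq_dotProduct_noise_le`). Markov's inequality then yields events of probability close to
one on which all bounds are deterministic.

For the uniform rates, Cauchy–Schwarz brings in `‖φ(z)‖²`, at most `MJ` times the largest squared
basis function. That maximum is at least the lower eigenvalue bound of `Q_{it}`, so the sieve errors
are absorbed; the same fact reduces the rate condition to `J² = o(N)`. -/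

theorem vnorm_sq_eq_dotProduct {ι : Type*} [Fintype ι] (x : ι → ℝ) : vnorm x ^ 2 = x ⬝ᵥ x := by
  rw [vnorm, EuclideanSpace.real_norm_sq_eq]
  simp [dotProduct, sq]

theorem vnorm_nonneg {ι : Type*} [Fintype ι] (x : ι → ℝ) : 0 ≤ vnorm x := norm_nonneg _

theorem dotProduct_self_eq_sum_eigenvectorBasis (hA : A.IsHermitian) (x : ι → ℝ) :
    x ⬝ᵥ x = ∑ i, ((hA.eigenvectorBasis i : ι → ℝ) ⬝ᵥ x) ^ 2 := by
  have h := hA.eigenvectorBasis.sum_inner_mul_inner (WithLp.toLp 2 x) (WithLp.toLp 2 x)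
  simp only [EuclideanSpace.inner_eq_star_dotProduct, star_trivial] at h
  rw [← h]
  exact Finset.sum_congr rfl fun i _ => by
    rw [sq, dotProduct_comm x]

theorem dotProduct_mulVec_eq_sum_eigenvalues (hA : A.IsHermitian) (x : ι → ℝ) :
    x ⬝ᵥ A *ᵥ x =
      ∑ i, hA.eigenvalues i * ((hA.eigenvectorBasis i : ι → ℝ) ⬝ᵥ x) ^ 2 := by
  have h := hA.eigenvectorBasis.sum_inner_mul_inner (WithLp.toLp 2 x) (WithLp.toLp 2 (A *ᵥ x))
  simp only [EuclideanSpace.inner_eq_star_dotProduct, star_trivial] at h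
  rw [dotProduct_comm, ← h]
  refine Finset.sum_congr rfl fun i _ => ?_
  have hsymm : Aᵀ = A := by simpa using hA.eq
  have : (A *ᵥ x) ⬝ᵥ (hA.eigenvectorBasis i : ι → ℝ) =
      hA.eigenvalues i * ((hA.eigenvectorBasis i : ι → ℝ) ⬝ᵥ x) := by
    rw [dotProduct_comm, dotProduct_mulVec, ← mulVec_transpose, hsymm,
      hA.mulVec_eigenvectorBasis, smul_dotProduct, smul_eq_mul]
  rw [this]; ring

theorem LtEigMin.le_dotProduct_mulVec {c : ℝ} (h : LtEigMin c A) (hA : A.IsHermitian)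
    (x : ι → ℝ) : c * (x ⬝ᵥ x) ≤ x ⬝ᵥ A *ᵥ x := by
  rw [dotProduct_self_eq_sum_eigenvectorBasis hA, dotProduct_mulVec_eq_sum_eigenvalues hA,
    Finset.mul_sum]
  exact Finset.sum_le_sum fun i _ =>
    mul_le_mul_of_nonneg_right (h _ (hA.eigenvalues_mem_spectrum_real i)).le (sq_nonneg _)

theorem EigMaxLt.dotProduct_mulVec_le {c : ℝ} (h : EigMaxLt A c) (hA : A.IsHermitian)
    (x : ι → ℝ) : x ⬝ᵥ A *ᵥ x ≤ c * (x ⬝ᵥ x) := by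
  rw [dotProduct_self_eq_sum_eigenvectorBasis hA, dotProduct_mulVec_eq_sum_eigenvalues hA,
    Finset.mul_sum]
  exact Finset.sum_le_sum fun i _ =>
    mul_le_mul_of_nonneg_right (h _ (hA.eigenvalues_mem_spectrum_real i)).le (sq_nonneg _)

/-- If a symmetric matrix `A` is bounded below by `c` on the `K`-dimensional range of `B`, then its
`K` largest eigenvalues are at least `c`. -/
theorem le_eigenvalues₀_of_le_on_range {K : ℕ} (hA : A.IsHermitian) (B : Matrix ι (Fin K) ℝ)
    (hB : ∀ v, v ≠ 0 → 0 < (B *ᵥ v) ⬝ᵥ (B *ᵥ v)) {c : ℝ}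
    (hc : ∀ v, c * ((B *ᵥ v) ⬝ᵥ (B *ᵥ v)) ≤ (B *ᵥ v) ⬝ᵥ A *ᵥ (B *ᵥ v))
    (k : Fin K) (hk : (k : ℕ) < Fintype.card ι) : c ≤ hA.eigenvalues₀ ⟨k, hk⟩ := by
  -- This is the reindexing that links `eigenvalues` to the ordered list `eigenvalues₀`.
  let e : Fin (Fintype.card ι) ≃ ι := Fintype.equivOfCardEq (Fintype.card_fin _)
  let L : Matrix (Fin k) (Fin K) ℝ := Matrix.of fun l j =>
    ∑ p, (hA.eigenvectorBasis (e ⟨l, l.2.trans hk⟩) : ι → ℝ) p * B p j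
  -- Orthogonality of `B v` to the `k` leading eigenvectors is a system of `k < K` linear conditions
  -- on `v` (`k` counts from zero), so it has a nonzero solution.
  obtain ⟨v, hv, hv0⟩ : ∃ v, v ∈ LinearMap.ker L.mulVecLin ∧ v ≠ 0 := by
    refine (Submodule.ne_bot_iff _).mp (LinearMap.ker_ne_bot_of_finrank_lt ?_)
    simp
  set x := B *ᵥ v with hx
  have hperp : ∀ l (hl : l < (k : ℕ)),
      (hA.eigenvectorBasis (e ⟨l, hl.trans hk⟩) : ι → ℝ) ⬝ᵥ x = 0 := by
    intro l hl
    have h := congrFun (LinearMap.mem_ker.mp hv) ⟨l, hl⟩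
    simp only [Matrix.mulVecLin_apply, Pi.zero_apply] at h
    rw [hx, dotProduct_mulVec, ← h]
    rfl
  have hle : x ⬝ᵥ A *ᵥ x ≤ hA.eigenvalues₀ ⟨k, hk⟩ * (x ⬝ᵥ x) := by
    rw [dotProduct_self_eq_sum_eigenvectorBasis hA, dotProduct_mulVec_eq_sum_eigenvalues hA,
      Finset.mul_sum]
    refine Finset.sum_le_sum fun i _ => ?_
    by_cases hi : ((e.symm i : Fin _) : ℕ) < k
    · have := hperp _ hi
      simp only [Fin.eta, Equiv.apply_symm_apply] at this
      rw [this]; simp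
    · exact mul_le_mul_of_nonneg_right
        (hA.eigenvalues₀_antitone (Fin.mk_le_of_le_val (not_lt.mp hi))) (sq_nonneg _)
  exact le_of_mul_le_mul_right ((hc v).trans hle) (hB v hv0)

/-- Gathers the eigenvector equations into one matrix equation and keeps only the lower bound on the
eigenvalues; their order and gaps play no role in the perturbation argument. -/
theorem IsLeadingEigenvectors.exists_diagonal {K : ℕ} {C : Matrix ι (Fin K) ℝ}
    (h : IsLeadingEigenvectors A C) (B : Matrix ι (Fin K) ℝ)
    (hB : ∀ v, v ≠ 0 → 0 < (B *ᵥ v) ⬝ᵥ (B *ᵥ v)) {c : ℝ}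
    (hc : ∀ v, c * ((B *ᵥ v) ⬝ᵥ (B *ᵥ v)) ≤ (B *ᵥ v) ⬝ᵥ A *ᵥ (B *ᵥ v)) :
    ∃ d : Fin K → ℝ, (∀ k, c ≤ d k) ∧ A * C = C * Matrix.diagonal d := by
  obtain ⟨-, hA, hC⟩ := h
  choose hk hC using hC
  refine ⟨fun k => hA.eigenvalues₀ ⟨k, hk k⟩,
    fun k => le_eigenvalues₀_of_le_on_range hA B hB hc k (hk k), ?_⟩
  ext p k
  have := congrFun (hC k) p
  rw [Matrix.mul_diagonal, mul_comm]
  exact this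

end QuadraticForms

/-! ### Perturbation of regressed principal components -/

section Perturbation

open scoped Matrix.Norms.Frobenius

variable {ι τ : Type} [Fintype ι] [Fintype τ] [DecidableEq τ]

theorem norm_mul_le_of_le {l m n : Type*} [Fintype l] [Fintype m] [Fintype n]
    {A : Matrix l m ℝ} {B : Matrix m n ℝ} {x y : ℝ} (hA : ‖A‖ ≤ x) (hB : ‖B‖ ≤ y) :
    ‖A * B‖ ≤ x * y :=
  (Matrix.frobenius_norm_mul A B).trans
    (mul_le_mul hA hB (norm_nonneg _) ((norm_nonneg _).trans hA))

theorem norm_transpose_le {l m : Type*} [Fintype l] [Fintype m]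
    {A : Matrix l m ℝ} {x : ℝ} (hA : ‖A‖ ≤ x) : ‖Aᵀ‖ ≤ x := by
  rwa [Matrix.frobenius_norm_transpose]

theorem vnorm_mulVec_le {l m : Type*} [Fintype l] [Fintype m] (A : Matrix l m ℝ) (x : m → ℝ) :
    vnorm (A *ᵥ x) ≤ ‖A‖ * vnorm x := by
  have h := Matrix.frobenius_norm_mul A (replicateCol Unit x)
  rwa [← replicateCol_mulVec, Matrix.frobenius_norm_replicateCol,
    Matrix.frobenius_norm_replicateCol] at h

/-- The centering matrix itself has Frobenius norm of order `√T`, so its norm must not be split off;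
expanding the product costs only the factor 2. -/
theorem norm_centering_mul_le {n : Type*} [Fintype n] {u : Matrix τ Unit ℝ} (hu : ‖u‖ ≤ 1)
    (X : Matrix τ n ℝ) : ‖(1 - u * uᵀ) * X‖ ≤ 2 * ‖X‖ := by
  rw [Matrix.sub_mul, Matrix.one_mul]
  have h := norm_mul_le_of_le (norm_mul_le_of_le hu (norm_transpose_le hu)) (le_refl ‖X‖)
  linarith [norm_sub_le X (u * uᵀ * X)]

/-- On the range of `B`, the matrix `Y (1 - u uᵀ) Yᵀ` with `Y = a uᵀ + B Fᵀ + Δ` is bounded below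
if the noise `Δ` is small. -/
theorem le_quadForm_of_small_noise {K : ℕ} {a : Matrix ι Unit ℝ} {B : Matrix ι (Fin K) ℝ}
    {F : Matrix τ (Fin K) ℝ} {Δ Y : Matrix ι τ ℝ} {u : Matrix τ Unit ℝ} {c : ℝ} (hc : 0 < c)
    (huu : uᵀ * u = 1) (hu : ‖u‖ ≤ 1)
    (hB : ∀ v, c * (v ⬝ᵥ v) ≤ v ⬝ᵥ (Bᵀ * B) *ᵥ v)
    (hF : ∀ v, c * (v ⬝ᵥ v) ≤ v ⬝ᵥ (Fᵀ * (1 - u * uᵀ) * F) *ᵥ v)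
    (hY : Y = a * uᵀ + B * Fᵀ + Δ) (hΔ : ‖Δ‖ ≤ c / 4) (v : Fin K → ℝ) :
    c ^ 2 / 4 * ((B *ᵥ v) ⬝ᵥ (B *ᵥ v)) ≤
      (B *ᵥ v) ⬝ᵥ (Y * (1 - u * uᵀ) * Yᵀ) *ᵥ (B *ᵥ v) := by
  set M : Matrix τ τ ℝ := 1 - u * uᵀ with hM
  have hMt : Mᵀ = M := by simp [hM]
  have hMu : M * u = 0 := by rw [hM, Matrix.sub_mul, Matrix.mul_assoc, huu]; simp
  have hMM : M * M = M := by
    conv_lhs => rhs; rw [hM]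
    rw [Matrix.mul_sub, ← Matrix.mul_assoc, hMu]; simp
  have quad : ∀ {p : Type} [Fintype p] (X : Matrix τ p ℝ) (w : p → ℝ),
      w ⬝ᵥ (Xᵀ * M * X) *ᵥ w = vnorm ((M * X) *ᵥ w) ^ 2 := by
    intro p _ X w
    have : Xᵀ * M * X = (M * X)ᵀ * (M * X) := by
      rw [Matrix.transpose_mul, hMt, Matrix.mul_assoc, Matrix.mul_assoc, ← Matrix.mul_assoc M M,
        hMM]
    rw [this, ← mulVec_mulVec, dotProduct_mulVec, vecMul_transpose, vnorm_sq_eq_dotProduct]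
  set x := B *ᵥ v with hx
  have hxv : v ⬝ᵥ (Bᵀ * B) *ᵥ v = vnorm x ^ 2 := by
    rw [← mulVec_mulVec, dotProduct_mulVec, vecMul_transpose, vnorm_sq_eq_dotProduct]
  have h1 : c * vnorm v ^ 2 ≤ vnorm x ^ 2 := by
    rw [← hxv, vnorm_sq_eq_dotProduct]; exact hB v
  have hcs : vnorm x ^ 2 ≤ vnorm v * vnorm (Bᵀ *ᵥ x) := by
    rw [← hxv, ← mulVec_mulVec]
    have := real_inner_le_norm (WithLp.toLp 2 (Bᵀ *ᵥ x)) (WithLp.toLp 2 v)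
    rw [EuclideanSpace.inner_eq_star_dotProduct, star_trivial, mul_comm] at this
    exact this
  -- For `x = B v`, the bounds `‖x‖² ≤ ‖v‖ ‖Bᵀx‖` and `c ‖v‖² ≤ ‖x‖²` combine, after cancelling
  -- `‖x‖²`.
  have h2 : c * vnorm x ^ 2 ≤ vnorm (Bᵀ *ᵥ x) ^ 2 := by
    rcases (vnorm_nonneg x).eq_or_lt with h0 | h0
    · rw [← h0]; nlinarith [sq_nonneg (vnorm (Bᵀ *ᵥ x))]
    · have h3 : c * (vnorm x ^ 2) ^ 2 ≤ vnorm x ^ 2 * vnorm (Bᵀ *ᵥ x) ^ 2 := by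
        calc c * (vnorm x ^ 2) ^ 2 ≤ c * (vnorm v * vnorm (Bᵀ *ᵥ x)) ^ 2 := by gcongr
          _ = (c * vnorm v ^ 2) * vnorm (Bᵀ *ᵥ x) ^ 2 := by ring
          _ ≤ _ := by gcongr
      have h4 : 0 < vnorm x ^ 2 := by positivity
      exact le_of_mul_le_mul_left (by linarith) h4
  -- The signal contributes one factor `√c` from the factors and one from the loadings. The noise
  -- takes away at most half of it, which leaves `(c/2)²` for the quadratic form.
  have h5 : c * vnorm x ≤ vnorm ((M * F) *ᵥ (Bᵀ *ᵥ x)) := by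
    have := hF (Bᵀ *ᵥ x)
    rw [quad, ← vnorm_sq_eq_dotProduct] at this
    refine le_of_sq_le_sq ?_ (vnorm_nonneg _)
    calc (c * vnorm x) ^ 2 = c * (c * vnorm x ^ 2) := by ring
      _ ≤ c * vnorm (Bᵀ *ᵥ x) ^ 2 := by gcongr
      _ ≤ _ := this
  have h6 : vnorm ((M * Δᵀ) *ᵥ x) ≤ c / 2 * vnorm x := by
    refine (vnorm_mulVec_le _ _).trans (mul_le_mul_of_nonneg_right ?_ (vnorm_nonneg _))
    have := norm_centering_mul_le hu Δᵀ
    rw [Matrix.frobenius_norm_transpose] at this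
    linarith
  clear_value x
  have h7 : (M * Yᵀ) *ᵥ x = (M * F) *ᵥ (Bᵀ *ᵥ x) + (M * Δᵀ) *ᵥ x := by
    rw [mulVec_mulVec, ← add_mulVec, hY]
    congr 1
    simp only [Matrix.transpose_add, Matrix.transpose_mul, Matrix.transpose_transpose,
      Matrix.mul_add, ← Matrix.mul_assoc, hMu, Matrix.zero_mul, zero_add]
  have h8 : vnorm ((M * F) *ᵥ (Bᵀ *ᵥ x)) ≤ vnorm ((M * Yᵀ) *ᵥ x) + vnorm ((M * Δᵀ) *ᵥ x) := by
    have : (M * F) *ᵥ (Bᵀ *ᵥ x) = (M * Yᵀ) *ᵥ x - (M * Δᵀ) *ᵥ x := by rw [h7]; simp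
    rw [this, vnorm, vnorm, vnorm, WithLp.toLp_sub]
    exact norm_sub_le _ _
  have h9 : c / 2 * vnorm x ≤ vnorm ((M * Yᵀ) *ᵥ x) := by linarith
  have h10 := quad Yᵀ x
  rw [Matrix.transpose_transpose] at h10
  rw [h10, ← vnorm_sq_eq_dotProduct]
  calc c ^ 2 / 4 * vnorm x ^ 2 = (c / 2 * vnorm x) ^ 2 := by ring
    _ ≤ _ := pow_le_pow_left₀ (mul_nonneg (by positivity) (vnorm_nonneg _)) h9 2

variable [DecidableEq ι]

/-- The factor `√K` is the Frobenius norm of the identity. -/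
theorem norm_diagonal_inv_le {K : ℕ} {d : Fin K → ℝ} {c : ℝ} (hc : 0 < c) (hd : ∀ k, c ≤ d k) :
    ‖(Matrix.diagonal d)⁻¹‖ ≤ Real.sqrt K / c ∧ IsUnit (Matrix.diagonal d).det := by
  have hu : IsUnit (Matrix.diagonal d).det := by
    rw [Matrix.det_diagonal, isUnit_iff_ne_zero, Finset.prod_ne_zero_iff]
    exact fun k _ => (hc.trans_le (hd k)).ne'
  have hinv : (Matrix.diagonal d)⁻¹ = Matrix.diagonal fun k => (d k)⁻¹ := by
    refine Matrix.inv_eq_right_inv ?_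
    rw [Matrix.diagonal_mul_diagonal, ← Matrix.diagonal_one]
    congr 1
    funext k
    exact mul_inv_cancel₀ (hc.trans_le (hd k)).ne'
  refine ⟨?_, hu⟩
  rw [hinv, Matrix.frobenius_norm_diagonal, EuclideanSpace.norm_eq, div_eq_mul_inv,
    Real.sqrt_le_left (by positivity), mul_pow, Real.sq_sqrt (by positivity)]
  calc ∑ k, ‖(d k)⁻¹‖ ^ 2 ≤ ∑ _k : Fin K, c⁻¹ ^ 2 := by
        refine Finset.sum_le_sum fun k _ => ?_
        rw [Real.norm_of_nonneg (inv_nonneg.mpr (hc.le.trans (hd k)))]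
        exact pow_le_pow_left₀ (inv_nonneg.mpr (hc.le.trans (hd k))) (inv_anti₀ hc (hd k)) 2
    _ = _ := by simp

theorem le_four_mul_pow_mul {b ν : ℝ} (hb : 1 ≤ b) (hν : 0 ≤ ν) : b ≤ 4 * b ^ 4 * (ν + 1) := by
  have h1 : b ≤ b ^ 4 := le_self_pow₀ hb (by norm_num)
  have h2 : b ^ 4 * 1 ≤ b ^ 4 * (ν + 1) := by gcongr; linarith
  linarith

set_option maxHeartbeats 1600000 in
/-- Error bounds for regressed PCA applied to `Y = a uᵀ + B Fᵀ + D + E`. -/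
theorem regressedPCA_perturbation {K : ℕ} {b ν c d e g e₁ h h₁ : ℝ}
    {a : Matrix ι Unit ℝ} {B C : Matrix ι (Fin K) ℝ} {F Fh : Matrix τ (Fin K) ℝ}
    {D E Y : Matrix ι τ ℝ} {u : Matrix τ Unit ℝ} {M : Matrix τ τ ℝ} {H : Matrix (Fin K) (Fin K) ℝ}
    (hb : 1 ≤ b) (hc : 0 < c) (hν : Real.sqrt K / (c ^ 2 / 4) ≤ ν)
    (huu : uᵀ * u = 1) (hu : ‖u‖ ≤ 1)
    (hMdef : M = 1 - u * uᵀ)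
    (hB : ∀ v, c * (v ⬝ᵥ v) ≤ v ⬝ᵥ (Bᵀ * B) *ᵥ v)
    (hF : ∀ v, c * (v ⬝ᵥ v) ≤ v ⬝ᵥ (Fᵀ * M * F) *ᵥ v)
    (hY : Y = a * uᵀ + B * Fᵀ + D + E) (haB : aᵀ * B = 0)
    (hab : ‖a‖ ≤ b) (hBb : ‖B‖ ≤ b) (hFb : ‖F‖ ≤ b) (hCb : ‖C‖ ≤ b)
    (hlead : IsLeadingEigenvectors (Y * M * Yᵀ) C)
    (hFh : Fh = Yᵀ * C) (hH : H = (Fᵀ * M * Fh) * (Fhᵀ * M * Fh)⁻¹)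
    (hd : ‖D‖ ≤ d) (he : ‖E‖ ≤ e) (hg : ‖E * M * F‖ ≤ g) (he₁ : ‖E * u‖ ≤ e₁)
    (hh : ‖Eᵀ * B‖ ≤ h) (hh₁ : ‖Eᵀ * a‖ ≤ h₁)
    (hs1 : d + e ≤ c / 4) (hs2 : d + e ≤ 1) (hs3 : 4 * ν * (d + e) ≤ 1)
    (hs4 : 8 * b ^ 4 * ν * (d + e) ≤ 1) :
    ‖C - B * H‖ ≤ 20 * b ^ 4 * (ν + 1) ^ 2 * (d + g + e * h) ∧
    ‖H‖ ≤ 4 * b ^ 4 * ν ∧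
    ‖(1 - C * Cᵀ) * (Y * u) - a‖ ≤ 5 * b ^ 5 * (‖C - B * H‖ + d + e₁) ∧
    ‖Fh - F * Hᵀ⁻¹‖ ≤ 100 * b ^ 10 * (ν + 1) ^ 2 * (d + h + h₁ + e * ‖C - B * H‖) := by
  have hd0 : 0 ≤ d := (norm_nonneg _).trans hd
  have he0 : 0 ≤ e := (norm_nonneg _).trans he
  have hh0 : 0 ≤ h := (norm_nonneg _).trans hh
  have hg0 : 0 ≤ g := (norm_nonneg _).trans hg
  have hν0 : 0 ≤ ν := le_trans (by positivity) hν
  have hb0 : 0 ≤ b := by linarith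
  have hCC : Cᵀ * C = 1 := hlead.1
  have hMt : Mᵀ = M := by simp [hMdef]
  have huM : uᵀ * M = 0 := by rw [hMdef, Matrix.mul_sub, ← Matrix.mul_assoc, huu]; simp
  obtain ⟨V, hν, hVu, hAV⟩ : ∃ V : Matrix (Fin K) (Fin K) ℝ, ‖V⁻¹‖ ≤ ν ∧ IsUnit V.det ∧
      (Y * M * Yᵀ) * C = C * V := by
    have hpos : ∀ v : Fin K → ℝ, v ≠ 0 → 0 < (B *ᵥ v) ⬝ᵥ (B *ᵥ v) := by
      intro v hv
      have h1 : 0 < v ⬝ᵥ v := by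
        have := Matrix.dotProduct_star_self_pos_iff.mpr hv
        simpa using this
      have h2 := hB v
      rw [← mulVec_mulVec, dotProduct_mulVec, vecMul_transpose] at h2
      exact (mul_pos hc h1).trans_le h2
    obtain ⟨dd, hdd, hAC⟩ := hlead.exists_diagonal B hpos (c := c ^ 2 / 4) (by
      rw [hMdef]
      rw [hMdef] at hF
      exact le_quadForm_of_small_noise hc huu hu hB hF (by rw [hY, add_assoc])
        ((norm_add_le_of_le hd he).trans hs1))
    obtain ⟨h1, h2⟩ := norm_diagonal_inv_le (by positivity) hdd
    exact ⟨_, h1.trans hν, h2, hAC⟩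
  -- The normalising matrix inside `H` is exactly the eigenvalue matrix, because the columns of `C`
  -- are orthonormal.
  have hFMF : Fhᵀ * M * Fh = V := by
    have : Fhᵀ * M * Fh = Cᵀ * ((Y * M * Yᵀ) * C) := by
      rw [hFh]; simp only [Matrix.transpose_mul, Matrix.transpose_transpose, Matrix.mul_assoc]
    rw [this, hAV, ← Matrix.mul_assoc, hCC, Matrix.one_mul]
  set G := M * Fh with hG
  have hMb : ∀ {p : Type} [Fintype p] {X : Matrix τ p ℝ} {x : ℝ}, ‖X‖ ≤ x → ‖M * X‖ ≤ 2 * x := by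
    intro p _ X x hX
    rw [hMdef]
    exact (norm_centering_mul_le hu X).trans (by linarith)
  have hFheq : M * Fh = M * F * (Bᵀ * C) + M * Dᵀ * C + M * (Eᵀ * C) := by
    rw [hFh, hY]
    have : M * u = 0 := by rw [← hMt, ← Matrix.transpose_transpose u, ← Matrix.transpose_mul, huM]; simp
    simp only [Matrix.transpose_add, Matrix.transpose_mul, Matrix.transpose_transpose,
      Matrix.add_mul, Matrix.mul_add, ← Matrix.mul_assoc, this, Matrix.zero_mul, zero_add]
  have hGb : ‖G‖ ≤ 4 * b ^ 3 := by
    have h1 := norm_mul_le_of_le (hMb hFb) (norm_mul_le_of_le (norm_transpose_le hBb) hCb)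
    have h2 := norm_mul_le_of_le (hMb (norm_transpose_le hd)) hCb
    have h3 := hMb (norm_mul_le_of_le (norm_transpose_le he) hCb)
    rw [hG, hFheq]
    refine (norm_add₃_le.trans (add_le_add (add_le_add h1 h2) h3)).trans ?_
    have : b ≤ b ^ 3 := le_self_pow₀ hb (by norm_num)
    have := mul_le_mul_of_nonneg_right hs2 hb0
    linarith
  have hHeq : H = Fᵀ * G * V⁻¹ := by rw [hH, hFMF, hG, Matrix.mul_assoc Fᵀ]
  have hHb : ‖H‖ ≤ 4 * b ^ 4 * ν := by
    rw [hHeq]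
    exact (norm_mul_le_of_le (norm_mul_le_of_le (norm_transpose_le hFb) hGb) hν).trans
      (le_of_eq (by ring))
  set W := C - B * H with hW
  have hCW : C = B * H + W := by rw [hW]; abel
  -- The choice of `H` makes the term `B Fᵀ G V⁻¹` of `C = Y G V⁻¹` equal to `B H`, and `uᵀ M = 0`
  -- removes the intercept, so only bias and noise remain.
  have hWeq : W = (D + E) * G * V⁻¹ := by
    have h1 : C = Y * G * V⁻¹ := by
      rw [hG, hFh, ← Matrix.mul_assoc Y, ← Matrix.mul_assoc, hAV,
        Matrix.mul_nonsing_inv_cancel_right _ _ hVu]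
    have h2 : Y * G = B * Fᵀ * G + (D + E) * G := by
      rw [hY, hG]
      simp only [Matrix.add_mul, Matrix.mul_assoc]
      rw [← Matrix.mul_assoc uᵀ, huM]
      simp [add_assoc]
    rw [hW]
    nth_rewrite 1 [h1]
    rw [h2, hHeq, Matrix.add_mul]
    simp only [Matrix.mul_assoc]
    abel
  have hEC : ‖Eᵀ * C‖ ≤ h * ‖H‖ + e * ‖W‖ := by
    nth_rewrite 1 [hCW]
    rw [Matrix.mul_add, ← Matrix.mul_assoc]
    exact norm_add_le_of_le (norm_mul_le_of_le hh le_rfl)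
      (norm_mul_le_of_le (norm_transpose_le he) le_rfl)
  have hw0 : 0 ≤ ‖W‖ := norm_nonneg _
  have hWb : ‖W‖ ≤ 20 * b ^ 4 * (ν + 1) ^ 2 * (d + g + e * h) := by
    -- The factor `G` is expanded only where it multiplies `E`: this replaces `‖E‖` by the smaller
    -- `‖E M F‖` and by products of two small terms.
    have hsplit : W = D * G * V⁻¹ + (E * M * F) * (Bᵀ * C) * V⁻¹ + E * (M * Dᵀ * C) * V⁻¹ +
        E * (M * (Eᵀ * C)) * V⁻¹ := by
      rw [hWeq, Matrix.add_mul]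
      nth_rewrite 2 [hG]
      rw [hFheq]
      simp only [Matrix.add_mul, Matrix.mul_add, Matrix.mul_assoc, add_assoc]
    have h1 := norm_mul_le_of_le (norm_mul_le_of_le hd hGb) hν
    have h2 := norm_mul_le_of_le (norm_mul_le_of_le hg
      (norm_mul_le_of_le (norm_transpose_le hBb) hCb)) hν
    have h3 := norm_mul_le_of_le (norm_mul_le_of_le he
      (norm_mul_le_of_le (hMb (norm_transpose_le hd)) hCb)) hν
    have h4 := norm_mul_le_of_le (norm_mul_le_of_le he (hMb hEC)) hν
    have h5 : ‖W‖ ≤ d * (4 * b ^ 3) * ν + g * (b * b) * ν + e * (2 * d * b) * ν +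
        e * (2 * (h * ‖H‖ + e * ‖W‖)) * ν := by
      nth_rewrite 1 [hsplit]
      exact (norm_add₄_le).trans (add_le_add (add_le_add (add_le_add h1 h2) h3) h4)
    -- This is the self-referential part of the bound. Smallness of `ν e`, together with `e ≤ 1`,
    -- lets half of `‖W‖` absorb it.
    have h6 : e * (2 * (e * ‖W‖)) * ν ≤ ‖W‖ / 2 := by
      have : 4 * (e * e * ν) ≤ 1 := by
        have : e * e * ν ≤ e * ν := by
          rw [mul_assoc]; exact mul_le_of_le_one_left (by positivity) (by linarith)
        have h61 := mul_nonneg hν0 hd0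
        linarith
      calc e * (2 * (e * ‖W‖)) * ν = 4 * (e * e * ν) * ‖W‖ / 2 := by ring
        _ ≤ 1 * ‖W‖ / 2 := by gcongr
        _ = _ := by ring
    have h7 : e * (2 * (h * ‖H‖)) * ν ≤ 8 * b ^ 4 * ν ^ 2 * (e * h) := by
      calc e * (2 * (h * ‖H‖)) * ν ≤ e * (2 * (h * (4 * b ^ 4 * ν))) * ν := by gcongr
        _ = _ := by ring
    have h8 : e * (2 * d * b) * ν ≤ 2 * b ^ 4 * ν * d := by
      have h81 : b ≤ b ^ 4 := le_self_pow₀ hb (by norm_num)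
      have h82 : e ≤ 1 := by linarith
      calc e * (2 * d * b) * ν ≤ 1 * (2 * d * b ^ 4) * ν := by gcongr
        _ = _ := by ring
    have h9 : d * (4 * b ^ 3) * ν ≤ 4 * b ^ 4 * ν * d := by
      have h81 : b ^ 3 ≤ b ^ 4 := pow_le_pow_right₀ hb (by norm_num)
      calc d * (4 * b ^ 3) * ν ≤ d * (4 * b ^ 4) * ν := by gcongr
        _ = _ := by ring
    have h10 : g * (b * b) * ν ≤ b ^ 4 * ν * g := by
      have h81 : b ^ 2 ≤ b ^ 4 := pow_le_pow_right₀ hb (by norm_num)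
      calc g * (b * b) * ν = g * b ^ 2 * ν := by ring
        _ ≤ g * b ^ 4 * ν := by gcongr
        _ = _ := by ring
    have h11 : ‖W‖ ≤ 2 * (6 * b ^ 4 * ν * d + b ^ 4 * ν * g + 8 * b ^ 4 * ν ^ 2 * (e * h)) := by
      have : e * (2 * (h * ‖H‖ + e * ‖W‖)) * ν =
        e * (2 * (h * ‖H‖)) * ν + e * (2 * (e * ‖W‖)) * ν := by ring
      linarith
    refine h11.trans ?_
    have p1 : ν ≤ (ν + 1) ^ 2 := by linarith [sq_nonneg ν]
    have p2 : ν ^ 2 ≤ (ν + 1) ^ 2 := by linarith [sq_nonneg ν]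
    calc 2 * (6 * b ^ 4 * ν * d + b ^ 4 * ν * g + 8 * b ^ 4 * ν ^ 2 * (e * h))
        ≤ 2 * (6 * b ^ 4 * (ν + 1) ^ 2 * d + 6 * b ^ 4 * (ν + 1) ^ 2 * g +
          8 * b ^ 4 * (ν + 1) ^ 2 * (e * h)) := by
          gcongr
          linarith [pow_nonneg hb0 4]
      _ ≤ 20 * b ^ 4 * (ν + 1) ^ 2 * (d + g + e * h) := by
          have : 0 ≤ b ^ 4 * (ν + 1) ^ 2 := by positivity
          linarith [mul_nonneg this hd0, mul_nonneg this hg0,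
            mul_nonneg this (mul_nonneg he0 hh0)]
  refine ⟨hWb, hHb, ?_⟩
  have hWsmall : ‖Cᵀ * W‖ ≤ 1 / 2 := by
    have h1 : ‖W‖ ≤ (d + e) * (4 * b ^ 3) * ν := by
      rw [hWeq]
      exact norm_mul_le_of_le (norm_mul_le_of_le (norm_add_le_of_le hd he) hGb) hν
    refine (norm_mul_le_of_le (norm_transpose_le hCb) h1).trans ?_
    linarith
  -- Since `CᵀW` has norm at most one half, this product is invertible by a Neumann series, which
  -- forces `H` to be invertible.
  have hCBH : Cᵀ * B * H = 1 - Cᵀ * W := by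
    rw [hW, Matrix.mul_sub, hCC, Matrix.mul_assoc]; abel
  have hHu : IsUnit H.det := by
    have h1 : IsUnit (1 - Cᵀ * W) := by
      let := Matrix.frobeniusNormedRing (m := Fin K) (α := ℝ)
      exact isUnit_one_sub_of_norm_lt_one (lt_of_le_of_lt hWsmall (by norm_num))
    rw [← hCBH, Matrix.isUnit_iff_isUnit_det, Matrix.det_mul] at h1
    exact isUnit_of_mul_isUnit_right h1
  have hHinv : Cᵀ * B = H⁻¹ - Cᵀ * W * H⁻¹ := by
    rw [← Matrix.mul_nonsing_inv_cancel_right H (Cᵀ * B) hHu, hCBH, Matrix.sub_mul, Matrix.one_mul]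
  -- Another absorption: `H⁻¹ = CᵀB + CᵀW H⁻¹`, and the last term is at most half of the left side.
  have hHinvb : ‖H⁻¹‖ ≤ 2 * b ^ 2 := by
    have h1 : H⁻¹ = Cᵀ * B + Cᵀ * W * H⁻¹ := by rw [hHinv]; abel
    have h2 : ‖H⁻¹‖ ≤ b * b + 1 / 2 * ‖H⁻¹‖ := by
      nth_rewrite 1 [h1]
      exact norm_add_le_of_le (norm_mul_le_of_le (norm_transpose_le hCb) hBb)
        (norm_mul_le_of_le hWsmall le_rfl)
    linarith
  have haC : aᵀ * C = aᵀ * W := by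
    rw [hCW, Matrix.mul_add, ← Matrix.mul_assoc, haB, Matrix.zero_mul, zero_add]
  constructor
  · have hYu : Y * u = a + B * (Fᵀ * u) + (D * u + E * u) := by
      rw [hY]
      simp only [Matrix.add_mul, Matrix.mul_assoc, huu, Matrix.mul_one, add_assoc]
    -- The projection kills `C`, and `B = (C - W) H⁻¹`; hence the factor part of the mean enters `â`
    -- only through `W`.
    have hPB : (1 - C * Cᵀ) * B = -((1 - C * Cᵀ) * (W * H⁻¹)) := by
      have h1 : (1 - C * Cᵀ) * C = 0 := by
        rw [Matrix.sub_mul, Matrix.mul_assoc, hCC]; simp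
      have h2 : B = (C - W) * H⁻¹ := by
        rw [hW, sub_sub_cancel, Matrix.mul_nonsing_inv_cancel_right _ _ hHu]
      nth_rewrite 1 [h2]
      rw [Matrix.sub_mul C, Matrix.mul_sub, ← Matrix.mul_assoc, h1]
      simp
    have heq : (1 - C * Cᵀ) * (Y * u) - a = -(C * (Wᵀ * a)) +
        -((1 - C * Cᵀ) * (W * H⁻¹ * (Fᵀ * u))) + (1 - C * Cᵀ) * (D * u + E * u) := by
      have h1 : Cᵀ * a = Wᵀ * a := by
        have := congrArg Matrix.transpose haC
        simpa [Matrix.transpose_mul] using this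
      rw [hYu, Matrix.mul_add, Matrix.mul_add, ← Matrix.mul_assoc (1 - C * Cᵀ) B, hPB, ← h1,
        Matrix.neg_mul]
      nth_rewrite 1 [Matrix.sub_mul]
      simp only [Matrix.mul_assoc, Matrix.one_mul]
      abel
    have hP : ∀ {X : Matrix ι Unit ℝ} {x : ℝ}, ‖X‖ ≤ x → ‖(1 - C * Cᵀ) * X‖ ≤ 2 * b ^ 2 * x := by
      intro X x hX
      rw [Matrix.sub_mul, Matrix.one_mul]
      have h1 := norm_mul_le_of_le (norm_mul_le_of_le hCb (norm_transpose_le hCb)) hX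
      have h2 := norm_sub_le_of_le hX h1
      have h3 : 0 ≤ x := (norm_nonneg _).trans hX
      have h4 := mul_le_mul_of_nonneg_right (one_le_pow₀ hb : 1 ≤ b ^ 2) h3
      linarith
    have h1 := norm_mul_le_of_le hCb (norm_mul_le_of_le (norm_transpose_le (le_refl ‖W‖)) hab)
    have h2 := hP (norm_mul_le_of_le (norm_mul_le_of_le (le_refl ‖W‖) hHinvb)
      (norm_mul_le_of_le (norm_transpose_le hFb) hu))
    have h3 := hP (norm_add_le_of_le (norm_mul_le_of_le hd hu) he₁)
    rw [heq]
    rw [← norm_neg] at h1 h2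
    refine (norm_add₃_le.trans (add_le_add (add_le_add h1 h2) h3)).trans ?_
    have he₁0 : 0 ≤ e₁ := (norm_nonneg _).trans he₁
    have p1 : b ^ 2 ≤ b ^ 5 := pow_le_pow_right₀ hb (by norm_num)
    linarith [mul_le_mul_of_nonneg_right p1 hw0, mul_le_mul_of_nonneg_right p1 hd0,
      mul_le_mul_of_nonneg_right p1 he₁0, mul_nonneg (pow_nonneg hb0 5) hw0,
      mul_nonneg (pow_nonneg hb0 5) hd0, mul_nonneg (pow_nonneg hb0 5) he₁0]
  · set q := h * ‖H‖ + e * ‖W‖ with hq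
    have hq0 : 0 ≤ q := by positivity
    have hh₁0 : 0 ≤ h₁ := (norm_nonneg _).trans hh₁
    have hBC : Bᵀ * C = Hᵀ⁻¹ - Hᵀ⁻¹ * (Wᵀ * C) := by
      have h1 := congrArg Matrix.transpose hHinv
      rw [Matrix.transpose_mul, Matrix.transpose_transpose, Matrix.transpose_sub,
        Matrix.transpose_mul, Matrix.transpose_mul, Matrix.transpose_transpose,
        Matrix.transpose_nonsing_inv] at h1
      exact h1
    have heq : Fh - F * Hᵀ⁻¹ = u * (aᵀ * W) - F * Hᵀ⁻¹ * (Wᵀ * C) + Dᵀ * C + Eᵀ * C := by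
      rw [hFh, hY]
      simp only [Matrix.transpose_add, Matrix.transpose_mul, Matrix.transpose_transpose,
        Matrix.add_mul, Matrix.mul_assoc, hBC, haC, Matrix.mul_sub]
      abel
    -- The bound `‖a‖ ‖W‖` would let the `g` part of `‖W‖` into the rate for the factors. Inserting
    -- the formula for `W` leaves `aᵀE`, of order `h₁`; `WᵀC` is handled in the same way through
    -- `EᵀC`.
    have haW : ‖aᵀ * W‖ ≤ (b * d + h₁) * (4 * b ^ 3) * ν := by
      rw [hWeq, ← Matrix.mul_assoc, ← Matrix.mul_assoc, Matrix.mul_add]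
      refine norm_mul_le_of_le (norm_mul_le_of_le (norm_add_le_of_le
        (norm_mul_le_of_le (norm_transpose_le hab) hd) ?_) hGb) hν
      rw [← Matrix.frobenius_norm_transpose]
      simpa [Matrix.transpose_mul] using hh₁
    have hWC : ‖Wᵀ * C‖ ≤ (b * d + q) * (4 * b ^ 3) * ν := by
      rw [← Matrix.frobenius_norm_transpose, Matrix.transpose_mul, Matrix.transpose_transpose]
      nth_rewrite 1 [hWeq]
      rw [← Matrix.mul_assoc, ← Matrix.mul_assoc, Matrix.mul_add]
      refine norm_mul_le_of_le (norm_mul_le_of_le (norm_add_le_of_le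
        (norm_mul_le_of_le (norm_transpose_le hCb) hd) ?_) hGb) hν
      rw [← Matrix.frobenius_norm_transpose]
      simpa [Matrix.transpose_mul] using hEC
    have hHt : ‖Hᵀ⁻¹‖ ≤ 2 * b ^ 2 := by
      rw [← Matrix.transpose_nonsing_inv]; exact norm_transpose_le hHinvb
    have h1 := norm_mul_le_of_le hu haW
    have h2 := norm_mul_le_of_le (norm_mul_le_of_le hFb hHt) hWC
    have h3 := norm_mul_le_of_le (norm_transpose_le hd) hCb
    rw [heq]
    refine (norm_add₃_le.trans (add_le_add (add_le_add (norm_sub_le_of_le h1 h2) h3) hEC)).trans ?_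
    have hqb : q ≤ 4 * b ^ 4 * (ν + 1) * (h + e * ‖W‖) := by
      have p1 : 1 ≤ 4 * b ^ 4 * (ν + 1) := hb.trans (le_four_mul_pow_mul hb hν0)
      have p2 : ‖H‖ ≤ 4 * b ^ 4 * (ν + 1) := by linarith [pow_nonneg hb0 4]
      have p3 : 0 ≤ e * ‖W‖ := by positivity
      linarith [mul_le_mul_of_nonneg_left p2 hh0, mul_le_mul_of_nonneg_right p1 p3]
    set s := e * ‖W‖ with hs
    have hs0 : 0 ≤ s := by positivity
    have e1 : 1 * ((b * d + h₁) * (4 * b ^ 3) * ν) ≤ 4 * b ^ 10 * (ν + 1) ^ 2 * (d + h₁) := by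
      have p1 : b ^ 4 ≤ b ^ 10 := pow_le_pow_right₀ hb (by norm_num)
      have p2 : ν ≤ (ν + 1) ^ 2 := by linarith [sq_nonneg ν]
      calc 1 * ((b * d + h₁) * (4 * b ^ 3) * ν)
          ≤ 1 * ((b * d + b * h₁) * (4 * b ^ 3) * ν) := by
            gcongr; exact le_mul_of_one_le_left hh₁0 hb
        _ = 4 * b ^ 4 * ν * (d + h₁) := by ring
        _ ≤ _ := by gcongr
    have e2 : b * (2 * b ^ 2) * ((b * d + q) * (4 * b ^ 3) * ν) ≤
        32 * b ^ 10 * (ν + 1) ^ 2 * (d + h + s) := by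
      have p2 : b * d ≤ 4 * b ^ 4 * (ν + 1) * d := by
        have := le_four_mul_pow_mul hb hν0
        gcongr
      have p3 : ν ≤ ν + 1 := by linarith
      calc b * (2 * b ^ 2) * ((b * d + q) * (4 * b ^ 3) * ν)
          ≤ b * (2 * b ^ 2) * ((4 * b ^ 4 * (ν + 1) * d + 4 * b ^ 4 * (ν + 1) * (h + s)) *
            (4 * b ^ 3) * (ν + 1)) := by gcongr
        _ = _ := by ring
    have e3 : d * b ≤ b ^ 10 * (ν + 1) ^ 2 * d := by
      have p1 : b ≤ b ^ 10 := le_self_pow₀ hb (by norm_num)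
      have p2 : 1 ≤ (ν + 1) ^ 2 := one_le_pow₀ (by linarith)
      calc d * b ≤ d * (b ^ 10 * (ν + 1) ^ 2) := by
            gcongr; exact p1.trans (le_mul_of_one_le_right (by positivity) p2)
        _ = _ := by ring
    have e4 : q ≤ 4 * b ^ 10 * (ν + 1) ^ 2 * (h + s) := by
      refine hqb.trans ?_
      have p1 : b ^ 4 ≤ b ^ 10 := pow_le_pow_right₀ hb (by norm_num)
      have p2 : ν + 1 ≤ (ν + 1) ^ 2 := by linarith [sq_nonneg ν]
      gcongr
    have hX : 0 ≤ b ^ 10 * (ν + 1) ^ 2 := by positivity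
    linarith [mul_nonneg hX hd0, mul_nonneg hX hh0, mul_nonneg hX hh₁0, mul_nonneg hX hs0]

end Perturbation

/-! ### Least squares coefficients -/

section LeastSquares

variable {n p : Type*} [Fintype n] [Fintype p]

theorem dotProduct_le_vnorm_mul_vnorm {ι : Type*} [Fintype ι] (x y : ι → ℝ) :
    x ⬝ᵥ y ≤ vnorm x * vnorm y := by
  have := real_inner_le_norm (WithLp.toLp 2 y) (WithLp.toLp 2 x)
  rwa [EuclideanSpace.inner_eq_star_dotProduct, star_trivial, mul_comm] at this

theorem dotProduct_gram_mulVec (X : Matrix n p ℝ) (x : p → ℝ) :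
    x ⬝ᵥ (Xᵀ * X) *ᵥ x = vnorm (X *ᵥ x) ^ 2 := by
  rw [← mulVec_mulVec, dotProduct_mulVec, vecMul_transpose, vnorm_sq_eq_dotProduct]

variable [DecidableEq p]

/-- The linear map taking an outcome vector to its least squares coefficients on the columns of
`X`. -/
noncomputable def olsMatrix (X : Matrix n p ℝ) : Matrix p n ℝ := (Xᵀ * X)⁻¹ * Xᵀ

variable {X : Matrix n p ℝ} {c : ℝ}

theorem isUnit_det_gram (hc : 0 < c) (hX : ∀ x, c * (x ⬝ᵥ x) ≤ x ⬝ᵥ (Xᵀ * X) *ᵥ x) :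
    IsUnit (Xᵀ * X).det := by
  rw [isUnit_iff_ne_zero]
  intro h
  obtain ⟨v, hv, hv0⟩ := Matrix.exists_mulVec_eq_zero_iff.mpr h
  have h1 := hX v
  rw [hv0, dotProduct_zero] at h1
  have h2 : 0 < v ⬝ᵥ v := by simpa using Matrix.dotProduct_star_self_pos_iff.mpr hv
  exact absurd h1 (not_le.mpr (mul_pos hc h2))

theorem vnorm_gram_inv_mulVec_le (hc : 0 < c) (hX : ∀ x, c * (x ⬝ᵥ x) ≤ x ⬝ᵥ (Xᵀ * X) *ᵥ x)
    (y : p → ℝ) : vnorm ((Xᵀ * X)⁻¹ *ᵥ y) ≤ vnorm y / c ∧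
      vnorm (X *ᵥ ((Xᵀ * X)⁻¹ *ᵥ y)) ^ 2 ≤ vnorm y ^ 2 / c := by
  set x := (Xᵀ * X)⁻¹ *ᵥ y with hx
  have hxy : (Xᵀ * X) *ᵥ x = y := by
    rw [hx, mulVec_mulVec, Matrix.mul_nonsing_inv _ (isUnit_det_gram hc hX), one_mulVec]
  have h1 : c * vnorm x ^ 2 ≤ vnorm x * vnorm y := by
    have := hX x
    rw [hxy, ← vnorm_sq_eq_dotProduct] at this
    exact this.trans (dotProduct_le_vnorm_mul_vnorm _ _)
  have h2 : vnorm x ≤ vnorm y / c := by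
    rw [le_div_iff₀ hc]
    rcases (vnorm_nonneg x).eq_or_lt with h0 | h0
    · rw [← h0, zero_mul]; exact vnorm_nonneg _
    · exact le_of_mul_le_mul_left (by linarith) h0
  refine ⟨h2, ?_⟩
  rw [← dotProduct_gram_mulVec, hxy]
  refine (dotProduct_le_vnorm_mul_vnorm _ _).trans ?_
  calc vnorm x * vnorm y ≤ vnorm y / c * vnorm y :=
        mul_le_mul_of_nonneg_right h2 (vnorm_nonneg _)
    _ = _ := by ring

/-- The fitted values are the orthogonal projection of `r`, so they are no longer than `r`; the
lower bound on the Gram matrix passes this to the coefficients. -/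
theorem vnorm_olsMatrix_mulVec_sq_le (hc : 0 < c)
    (hX : ∀ x, c * (x ⬝ᵥ x) ≤ x ⬝ᵥ (Xᵀ * X) *ᵥ x) (r : n → ℝ) :
    vnorm (olsMatrix X *ᵥ r) ^ 2 ≤ vnorm r ^ 2 / c := by
  set x := olsMatrix X *ᵥ r with hx
  have hxy : (Xᵀ * X) *ᵥ x = Xᵀ *ᵥ r := by
    rw [hx, mulVec_mulVec, olsMatrix, ← Matrix.mul_assoc,
      Matrix.mul_nonsing_inv _ (isUnit_det_gram hc hX), Matrix.one_mul]
  have h1 : vnorm (X *ᵥ x) ^ 2 ≤ vnorm (X *ᵥ x) * vnorm r := by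
    rw [← dotProduct_gram_mulVec, hxy, dotProduct_mulVec, vecMul_transpose]
    exact dotProduct_le_vnorm_mul_vnorm _ _
  have h2 : vnorm (X *ᵥ x) ≤ vnorm r := by
    rcases (vnorm_nonneg (X *ᵥ x)).eq_or_lt with h0 | h0
    · rw [← h0]; exact vnorm_nonneg _
    · exact le_of_mul_le_mul_left (by linarith) h0
  have h3 := hX x
  rw [dotProduct_gram_mulVec, ← vnorm_sq_eq_dotProduct] at h3
  rw [le_div_iff₀ hc]
  have := pow_le_pow_left₀ (vnorm_nonneg _) h2 2
  linarith

theorem sum_olsMatrix_sq_le (hc : 0 < c) (hX : ∀ x, c * (x ⬝ᵥ x) ≤ x ⬝ᵥ (Xᵀ * X) *ᵥ x) (i : n) :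
    ∑ q, olsMatrix X q i ^ 2 ≤ (∑ q, X i q ^ 2) / c ^ 2 := by
  have h1 : (fun q => olsMatrix X q i) = (Xᵀ * X)⁻¹ *ᵥ X i := by
    funext q; simp [olsMatrix, Matrix.mul_apply, mulVec, dotProduct]
  have h2 := (vnorm_gram_inv_mulVec_le hc hX (X i)).1
  rw [← h1] at h2
  have h3 := pow_le_pow_left₀ (vnorm_nonneg _) h2 2
  rw [div_pow, vnorm_sq_eq_dotProduct, vnorm_sq_eq_dotProduct] at h3
  simpa [dotProduct, sq] using h3

/-- The sum equals `bᵀ (XᵀX)⁻¹ b`: one Gram matrix cancels. The bound is free of the number of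
regressors, and this is why fixed projections of the noise are smaller than the noise by a factor of
order `√J`. -/
theorem sum_vecMul_olsMatrix_sq_le (hc : 0 < c)
    (hX : ∀ x, c * (x ⬝ᵥ x) ≤ x ⬝ᵥ (Xᵀ * X) *ᵥ x) (b : p → ℝ) :
    ∑ i, (∑ q, b q * olsMatrix X q i) ^ 2 ≤ vnorm b ^ 2 / c := by
  have h1 : (fun i => ∑ q, b q * olsMatrix X q i) = X *ᵥ ((Xᵀ * X)⁻¹ *ᵥ b) := by
    have : (fun i => ∑ q, b q * olsMatrix X q i) = b ᵥ* olsMatrix X := rfl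
    rw [this, ← mulVec_transpose, olsMatrix, Matrix.transpose_mul, Matrix.transpose_transpose,
      Matrix.transpose_nonsing_inv, Matrix.transpose_mul, Matrix.transpose_transpose,
      mulVec_mulVec]
  have h2 := (vnorm_gram_inv_mulVec_le hc hX b).2
  rw [← h1, vnorm_sq_eq_dotProduct] at h2
  simpa [dotProduct, sq] using h2

end LeastSquares

/-! ### Measurability of least squares weights -/

section Measurability

variable {𝓩 : Type*} [MeasurableSpace 𝓩] {n p : Type*} [Fintype n] [Fintype p]

/-- The condition runs over uncountably many `x`, but it cuts out a closed set of Gram matrices,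
whose preimage is measurable. -/
theorem measurableSet_gram_ge {X : 𝓩 → Matrix n p ℝ} (hX : ∀ i j, Measurable fun z => X z i j)
    (c : ℝ) : MeasurableSet {z | ∀ x, c * (x ⬝ᵥ x) ≤ x ⬝ᵥ ((X z)ᵀ * X z) *ᵥ x} := by
  have h1 : IsClosed {A : p → p → ℝ | ∀ x : p → ℝ, c * (x ⬝ᵥ x) ≤ x ⬝ᵥ (Matrix.of A) *ᵥ x} := by
    simp only [Set.ofPred_forall]
    refine isClosed_iInter fun x => isClosed_le continuous_const ?_
    simp only [dotProduct, mulVec, Matrix.of_apply]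
    fun_prop
  have h2 : Measurable fun z => (fun i j => ((X z)ᵀ * X z) i j : p → p → ℝ) := by
    refine measurable_pi_lambda _ fun i => measurable_pi_lambda _ fun j => ?_
    simp only [Matrix.mul_apply, Matrix.transpose_apply]
    fun_prop
  exact h2 h1.measurableSet

variable [DecidableEq p]

theorem measurable_det {A : 𝓩 → Matrix p p ℝ} (hA : ∀ i j, Measurable fun z => A z i j) :
    Measurable fun z => (A z).det := by
  simp only [Matrix.det_apply']
  fun_prop

/-- Cramer's formula, adjugate times inverted determinant, holds at singular matrices as well, with
value zero. -/
theorem measurable_matrix_inv {A : 𝓩 → Matrix p p ℝ} (hA : ∀ i j, Measurable fun z => A z i j)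
    (i j : p) : Measurable fun z => (A z)⁻¹ i j := by
  simp only [Matrix.inv_def, Ring.inverse_eq_inv', Matrix.smul_apply, Matrix.adjugate_apply,
    smul_eq_mul]
  refine (measurable_det hA).inv.mul (measurable_det fun k l => ?_)
  by_cases h : k = j
  · subst h; simp
  · simpa [Matrix.updateRow_ne h] using hA k l

theorem measurable_olsMatrix {X : 𝓩 → Matrix n p ℝ} (hX : ∀ i j, Measurable fun z => X z i j)
    (q : p) (i : n) : Measurable fun z => olsMatrix (X z) q i := by
  simp only [olsMatrix, Matrix.mul_apply, Matrix.transpose_apply]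
  refine Finset.measurable_sum _ fun k _ => (measurable_matrix_inv (fun k l => ?_) _ _).mul (hX _ _)
  simp only [Matrix.mul_apply, Matrix.transpose_apply]
  fun_prop

end Measurability

/-! ### Second moments of linear combinations with independent random weights -/

section SecondMoments

variable {Ω 𝓩 : Type*} [MeasurableSpace Ω] [MeasurableSpace 𝓩] {μ : Measure Ω}
  {k p : Type*} [Fintype k] [Fintype p] {ε : k → Ω → ℝ} {Z : Ω → 𝓩}

theorem integrable_mul_of_sq {f g : Ω → ℝ} (hf : AEStronglyMeasurable f μ)
    (hg : AEStronglyMeasurable g μ) (hf2 : Integrable (fun ω => f ω ^ 2) μ)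
    (hg2 : Integrable (fun ω => g ω ^ 2) μ) : Integrable (fun ω => f ω * g ω) μ :=
  ((memLp_two_iff_integrable_sq hf).mpr hf2).integrable_mul
    ((memLp_two_iff_integrable_sq hg).mpr hg2)

theorem abs_integral_mul_le {f g : Ω → ℝ}
    (hf2 : Integrable (fun ω => f ω ^ 2) μ) (hg2 : Integrable (fun ω => g ω ^ 2) μ) :
    |∫ ω, f ω * g ω ∂μ| ≤ (∫ ω, f ω ^ 2 ∂μ + ∫ ω, g ω ^ 2 ∂μ) / 2 := by
  rw [← integral_add hf2 hg2, ← integral_div]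
  rw [← Real.norm_eq_abs]
  refine norm_integral_le_of_norm_le ((hf2.add hg2).div_const 2) (ae_of_all _ fun ω => ?_)
  rw [Real.norm_eq_abs, abs_mul]
  have := sq_nonneg (|f ω| - |g ω|)
  nlinarith [sq_abs (f ω), sq_abs (g ω)]

/-- A second moment involves only products of two errors, so independence of such products from `Z`
suffices to factor every term. -/
theorem integral_sq_sum_mul (hε2 : ∀ i, MemLp (ε i) 2 μ)
    (hZ : Measurable Z) (hind : ∀ i j, IndepFun (fun ω => ε i ω * ε j ω) Z μ)
    {c : k → 𝓩 → ℝ} (hc : ∀ i, Measurable (c i))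
    (hc2 : ∀ i, Integrable (fun ω => c i (Z ω) ^ 2) μ) :
    Integrable (fun ω => (∑ i, c i (Z ω) * ε i ω) ^ 2) μ ∧
    ∫ ω, (∑ i, c i (Z ω) * ε i ω) ^ 2 ∂μ =
      ∑ i, ∑ j, (∫ ω, ε i ω * ε j ω ∂μ) * ∫ ω, c i (Z ω) * c j (Z ω) ∂μ := by
  have hcm : ∀ i, Measurable fun ω => c i (Z ω) := fun i => (hc i).comp hZ
  have hexp : ∀ ω, (∑ i, c i (Z ω) * ε i ω) ^ 2 =
      ∑ i, ∑ j, (ε i ω * ε j ω) * (c i (Z ω) * c j (Z ω)) := by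
    intro ω
    rw [sq, Finset.sum_mul_sum]
    exact Finset.sum_congr rfl fun i _ => Finset.sum_congr rfl fun j _ => by ring
  have hind' : ∀ i j, IndepFun (fun ω => ε i ω * ε j ω) (fun ω => c i (Z ω) * c j (Z ω)) μ :=
    fun i j => (hind i j).comp measurable_id ((hc i).mul (hc j))
  have hε1 : ∀ i j, Integrable (fun ω => ε i ω * ε j ω) μ := fun i j =>
    (hε2 i).integrable_mul (hε2 j)
  have hc1 : ∀ i j, Integrable (fun ω => c i (Z ω) * c j (Z ω)) μ := fun i j =>
    integrable_mul_of_sq (hcm i).aestronglyMeasurable (hcm j).aestronglyMeasurable (hc2 i) (hc2 j)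
  have hint : ∀ i j, Integrable (fun ω => (ε i ω * ε j ω) * (c i (Z ω) * c j (Z ω))) μ :=
    fun i j => (hind' i j).integrable_mul (hε1 i j) (hc1 i j)
  simp only [hexp]
  refine ⟨integrable_finsetSum _ fun i _ => integrable_finsetSum _ fun j _ => hint i j, ?_⟩
  rw [integral_finsetSum _ fun i _ => integrable_finsetSum _ fun j _ => hint i j]
  refine Finset.sum_congr rfl fun i _ => ?_
  rw [integral_finsetSum _ fun j _ => hint i j]
  exact Finset.sum_congr rfl fun j _ => (hind' i j).integral_fun_mul_eq_mul_integral
    (hε1 i j).aestronglyMeasurable (hc1 i j).aestronglyMeasurable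

/-- Bound for the second moment of a weighted sum of random vectors `c i (Z) ε i`. -/
theorem integral_sum_sq_sum_mul_le (hε2 : ∀ i, MemLp (ε i) 2 μ)
    (hZ : Measurable Z) (hind : ∀ i j, IndepFun (fun ω => ε i ω * ε j ω) Z μ)
    {c : k → p → 𝓩 → ℝ} (hc : ∀ i q, Measurable (c i q))
    (hc2 : ∀ i q, Integrable (fun ω => c i q (Z ω) ^ 2) μ) {R : ℝ}
    (hR : ∀ i, ∑ q, ∫ ω, c i q (Z ω) ^ 2 ∂μ ≤ R) (w : k → ℝ) :
    Integrable (fun ω => ∑ q, (∑ i, w i * c i q (Z ω) * ε i ω) ^ 2) μ ∧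
    ∫ ω, ∑ q, (∑ i, w i * c i q (Z ω) * ε i ω) ^ 2 ∂μ ≤
      R * ∑ i, ∑ j, |w i| * |w j| * |∫ ω, ε i ω * ε j ω ∂μ| := by
  have key := fun q => integral_sq_sum_mul (μ := μ) (c := fun i z => w i * c i q z) hε2 hZ hind
    (fun i => (hc i q).const_mul _) (fun i => by
      simp only [mul_pow]; exact (hc2 i q).const_mul _)
  refine ⟨integrable_finsetSum _ fun q _ => (key q).1, ?_⟩
  rw [integral_finsetSum _ fun q _ => (key q).1]
  simp only [(key _).2]
  rw [Finset.sum_comm, Finset.mul_sum]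
  refine Finset.sum_le_sum fun i _ => ?_
  rw [Finset.sum_comm, Finset.mul_sum]
  refine Finset.sum_le_sum fun j _ => ?_
  -- The arithmetic–geometric mean inequality controls cross moments of weights by their second
  -- moments, without assumptions on the dependence between units or periods.
  have h1 : ∑ q, |∫ ω, c i q (Z ω) * c j q (Z ω) ∂μ| ≤ R := by
    calc ∑ q, |∫ ω, c i q (Z ω) * c j q (Z ω) ∂μ|
        ≤ ∑ q, (∫ ω, c i q (Z ω) ^ 2 ∂μ + ∫ ω, c j q (Z ω) ^ 2 ∂μ) / 2 :=
          Finset.sum_le_sum fun q _ => abs_integral_mul_le (hc2 i q) (hc2 j q)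
      _ = (∑ q, ∫ ω, c i q (Z ω) ^ 2 ∂μ + ∑ q, ∫ ω, c j q (Z ω) ^ 2 ∂μ) / 2 := by
          rw [← Finset.sum_div, Finset.sum_add_distrib]
      _ ≤ R := by linarith [hR i, hR j]
  have h2 : ∀ q, ∫ ω, w i * c i q (Z ω) * (w j * c j q (Z ω)) ∂μ =
      w i * w j * ∫ ω, c i q (Z ω) * c j q (Z ω) ∂μ := by
    intro q
    rw [← integral_const_mul]
    congr 1
    funext ω; ring
  simp only [h2]
  refine (le_abs_self _).trans ((Finset.abs_sum_le_sum_abs _ _).trans ?_)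
  simp only [abs_mul]
  rw [← Finset.mul_sum, ← Finset.mul_sum]
  calc |∫ ω, ε i ω * ε j ω ∂μ| * (|w i| * |w j| * ∑ q, |∫ ω, c i q (Z ω) * c j q (Z ω) ∂μ|)
      ≤ |∫ ω, ε i ω * ε j ω ∂μ| * (|w i| * |w j| * R) := by gcongr
    _ = _ := by ring

/-- Bound for the second moment of a sum of `c i (Z) ε i` with weakly correlated `ε i`. -/
theorem integral_sq_sum_mul_le (hε2 : ∀ i, MemLp (ε i) 2 μ)
    (hZ : Measurable Z) (hind : ∀ i j, IndepFun (fun ω => ε i ω * ε j ω) Z μ)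
    {c : k → 𝓩 → ℝ} (hc : ∀ i, Measurable (c i))
    (hc2 : ∀ i, Integrable (fun ω => c i (Z ω) ^ 2) μ) {C : ℝ}
    (hC : ∀ i, ∑ j, |∫ ω, ε i ω * ε j ω ∂μ| ≤ C) :
    Integrable (fun ω => (∑ i, c i (Z ω) * ε i ω) ^ 2) μ ∧
    ∫ ω, (∑ i, c i (Z ω) * ε i ω) ^ 2 ∂μ ≤ C * ∫ ω, ∑ i, c i (Z ω) ^ 2 ∂μ := by
  obtain ⟨h1, h2⟩ := integral_sq_sum_mul hε2 hZ hind hc hc2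
  refine ⟨h1, h2.trans_le ?_⟩
  set m : k → ℝ := fun i => ∫ ω, c i (Z ω) ^ 2 ∂μ with hm
  have hm0 : ∀ i, 0 ≤ m i := fun i => integral_nonneg fun ω => sq_nonneg _
  set σ : k → k → ℝ := fun i j => |∫ ω, ε i ω * ε j ω ∂μ| with hσ
  have hσs : ∀ i j, σ i j = σ j i := fun i j => by simp only [hσ, mul_comm]
  -- Schur's test for the symmetric matrix of absolute error covariances: bounded row sums bound its
  -- quadratic form.
  calc ∑ i, ∑ j, (∫ ω, ε i ω * ε j ω ∂μ) * ∫ ω, c i (Z ω) * c j (Z ω) ∂μ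
      ≤ ∑ i, ∑ j, σ i j * ((m i + m j) / 2) := by
        refine Finset.sum_le_sum fun i _ => Finset.sum_le_sum fun j _ => ?_
        refine (le_abs_self _).trans ?_
        rw [abs_mul]
        exact mul_le_mul_of_nonneg_left (abs_integral_mul_le (hc2 i) (hc2 j)) (abs_nonneg _)
    _ = (∑ i, ∑ j, σ i j * m i) / 2 + (∑ i, ∑ j, σ i j * m j) / 2 := by
        rw [← add_div, ← Finset.sum_add_distrib, Finset.sum_div]
        refine Finset.sum_congr rfl fun i _ => ?_
        rw [← Finset.sum_add_distrib, Finset.sum_div]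
        exact Finset.sum_congr rfl fun j _ => by ring
    _ = ∑ i, ∑ j, σ i j * m i := by
        have : ∑ i, ∑ j, σ i j * m j = ∑ i, ∑ j, σ i j * m i := by
          rw [Finset.sum_comm]
          exact Finset.sum_congr rfl fun i _ => Finset.sum_congr rfl fun j _ => by rw [hσs]
        rw [this]; ring
    _ ≤ ∑ i, C * m i := by
        refine Finset.sum_le_sum fun i _ => ?_
        rw [← Finset.sum_mul]
        exact mul_le_mul_of_nonneg_right (hC i) (hm0 i)
    _ = _ := by rw [← Finset.mul_sum, integral_finsetSum _ fun i _ => hc2 i]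

theorem measure_lt_le_of_integral_le {X : Ω → ℝ} (hX : 0 ≤ X) (hXi : Integrable X μ) {c r L : ℝ}
    (hr : 0 ≤ r) (hL : 0 < L) (h : ∫ ω, X ω ∂μ ≤ c * r) :
    μ {ω | L * r < X ω} ≤ ENNReal.ofReal (c / L) := by
  -- When `r = 0`, which happens for `M = 0`, Markov's inequality cannot be divided through; there
  -- `X` vanishes almost everywhere.
  rcases hr.eq_or_lt with h0 | h0
  · have h1 : ∫ ω, X ω ∂μ = 0 :=
      le_antisymm (by simpa [← h0] using h) (integral_nonneg hX)
    have h2 := (integral_eq_zero_iff_of_nonneg hX hXi).mp h1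
    refine le_of_eq_of_le ?_ zero_le
    refine measure_mono_null (fun ω hω => ?_) (ae_iff.mp h2)
    simp only [← h0, mul_zero, Set.mem_ofPred_eq] at hω
    exact hω.ne'
  · have h1 : μ {ω | L * r < X ω} ≤ μ {ω | ENNReal.ofReal (L * r) ≤ ENNReal.ofReal (X ω)} :=
      measure_mono fun ω hω => ENNReal.ofReal_le_ofReal (le_of_lt hω)
    refine h1.trans ((meas_ge_le_lintegral_div hXi.aemeasurable.ennreal_ofReal
      (by simpa using mul_pos hL h0) ENNReal.ofReal_ne_top).trans ?_)
    rw [← ofReal_integral_eq_lintegral_ofReal hXi (ae_of_all _ hX),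
      ← ENNReal.ofReal_div_of_pos (mul_pos hL h0)]
    refine ENNReal.ofReal_le_ofReal ?_
    rw [div_le_div_iff₀ (mul_pos hL h0) hL]
    nlinarith

end SecondMoments

/-! ### Least squares weights as truncated functions of the covariates -/

namespace Panel

variable {Ω : Type*} [MeasurableSpace Ω] {K M N T J : ℕ}
  (P : Panel Ω K M N T J) (S : Model K M)

/-- The covariates of the panel, as a random element. -/
def covariates (ω : Ω) : Fin N → Fin T → Fin M → ℝ := fun i t => P.z i t ω

theorem measurable_covariates : Measurable P.covariates :=
  measurable_pi_lambda _ fun i => measurable_pi_lambda _ fun t => P.z_meas i t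

end Panel

namespace Model

variable {K M : ℕ} (S : Model K M) (N T J : ℕ)

/-- The regressors in period `t`, as a function of all covariates. -/
def design (t : Fin T) (z : Fin N → Fin T → Fin M → ℝ) : Matrix (Fin N) (Fin M × Fin J) ℝ :=
  Matrix.of fun i => S.phi J (z i t)

theorem measurable_design (t : Fin T) (i : Fin N) (q : Fin M × Fin J) :
    Measurable fun z => S.design N T J t z i q := by
  have := S.φ_meas q.2
  simp only [design, Matrix.of_apply, phi]
  exact this.comp (by fun_prop)

/-- The covariates for which all eigenvalues of all Gram matrices are at least `c`. -/
def gramSet (c : ℝ) : Set (Fin N → Fin T → Fin M → ℝ) :=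
  {z | ∀ t x, c * (x ⬝ᵥ x) ≤ x ⬝ᵥ ((S.design N T J t z)ᵀ * S.design N T J t z) *ᵥ x}

theorem measurableSet_gramSet (c : ℝ) : MeasurableSet (S.gramSet N T J c) := by
  have : S.gramSet N T J c = ⋂ t, {z | ∀ x, c * (x ⬝ᵥ x) ≤
      x ⬝ᵥ ((S.design N T J t z)ᵀ * S.design N T J t z) *ᵥ x} := by
    ext; simp [gramSet]
  rw [this]
  exact MeasurableSet.iInter fun t => measurableSet_gram_ge (S.measurable_design N T J t) c

variable {N T}

/-- Least squares weights, set to zero outside `gramSet`. -/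
noncomputable def olsWeight (c : ℝ) (t : Fin T) (i : Fin N) (q : Fin M × Fin J)
    (z : Fin N → Fin T → Fin M → ℝ) : ℝ :=
  (S.gramSet N T J c).indicator (fun z => olsMatrix (S.design N T J t z) q i) z

theorem measurable_olsWeight (c : ℝ) (t : Fin T) (i : Fin N) (q : Fin M × Fin J) :
    Measurable (S.olsWeight J c t i q) :=
  (measurable_olsMatrix (S.measurable_design N T J t) q i).indicator
    (S.measurableSet_gramSet N T J c)

/-- Thanks to the truncation the bound holds at every covariate value, so the weights inherit square
integrability from the basis functions. -/
theorem sum_olsWeight_sq_le {c : ℝ} (hc : 0 < c) (t : Fin T) (i : Fin N)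
    (z : Fin N → Fin T → Fin M → ℝ) :
    ∑ q, S.olsWeight J c t i q z ^ 2 ≤ (∑ q, S.phi J (z i t) q ^ 2) / c ^ 2 := by
  by_cases hz : z ∈ S.gramSet N T J c
  · simp only [olsWeight, Set.indicator_of_mem hz]
    exact sum_olsMatrix_sq_le hc (hz t) i
  · simp only [olsWeight, Set.indicator_of_notMem hz]
    simp only [ne_eq, OfNat.ofNat_ne_zero, not_false_eq_true, zero_pow, Finset.sum_const_zero]
    positivity

theorem sum_weighted_olsWeight_sq_le {c : ℝ} (hc : 0 < c) (t : Fin T)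
    (z : Fin N → Fin T → Fin M → ℝ) (b : Fin M × Fin J → ℝ) :
    ∑ i, (∑ q, b q * S.olsWeight J c t i q z) ^ 2 ≤ vnorm b ^ 2 / c := by
  by_cases hz : z ∈ S.gramSet N T J c
  · simp only [olsWeight, Set.indicator_of_mem hz]
    exact sum_vecMul_olsMatrix_sq_le hc (hz t) b
  · simp only [olsWeight, Set.indicator_of_notMem hz]
    simp only [mul_zero, ne_eq, OfNat.ofNat_ne_zero, not_false_eq_true, zero_pow,
      Finset.sum_const_zero]
    positivity

end Model

/-! ### Decomposition of the regression coefficients and moments of the noise -/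

namespace Panel

variable {Ω : Type*} [MeasurableSpace Ω] {K M N T J : ℕ}
  (P : Panel Ω K M N T J) (S : Model K M)

/-- The event that all eigenvalues of all Gram matrices are at least `c`. -/
def gramEvent (c : ℝ) : Set Ω := P.covariates ⁻¹' S.gramSet N T J c

theorem measurableSet_gramEvent (c : ℝ) : MeasurableSet (P.gramEvent S c) :=
  P.measurable_covariates (S.measurableSet_gramSet N T J c)

/-- The contribution of the errors to `Ỹ`. -/
noncomputable def noise (ω : Ω) : Matrix (Fin M × Fin J) (Fin T) ℝ :=
  Matrix.of fun q t => ∑ i, olsMatrix (P.Phi S t ω) q i * P.ε i t ω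

/-- The sieve approximation error of the outcome `y_{it}`. -/
noncomputable def sieveError (i : Fin N) (t : Fin T) (ω : Ω) : ℝ :=
  ∑ m, P.r S m (P.z i t ω m) + ∑ k, (∑ m, P.δ S k m (P.z i t ω m)) * P.f t k

/-- The contribution of the sieve approximation error to `Ỹ`. -/
noncomputable def bias (ω : Ω) : Matrix (Fin M × Fin J) (Fin T) ℝ :=
  Matrix.of fun q t => ∑ i, olsMatrix (P.Phi S t ω) q i * P.sieveError S i t ω

theorem α_eq_dotProduct_add (z : Fin M → ℝ) :
    S.α z = P.a ⬝ᵥ S.phi J z + ∑ m, P.r S m (z m) := by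
  simp only [Model.α, r, Model.phi, dotProduct, Fintype.sum_prod_type]
  rw [← Finset.sum_add_distrib]
  exact Finset.sum_congr rfl fun m _ => by ring

theorem β_eq_mulVec_add (z : Fin M → ℝ) :
    S.β z = P.Bᵀ *ᵥ S.phi J z + fun k => ∑ m, P.δ S k m (z m) := by
  funext k
  simp only [Model.β, δ, Model.phi, mulVec, dotProduct, Fintype.sum_prod_type, Pi.add_apply,
    Matrix.transpose_apply]
  rw [← Finset.sum_add_distrib]
  exact Finset.sum_congr rfl fun m _ => by ring

theorem y_eq (i : Fin N) (t : Fin T) (ω : Ω) :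
    P.y S i t ω = (P.Phi S t ω *ᵥ (P.a + P.B *ᵥ P.f t)) i + P.sieveError S i t ω + P.ε i t ω := by
  rw [y, P.α_eq_dotProduct_add, P.β_eq_mulVec_add, add_dotProduct, mulVec_transpose,
    ← dotProduct_mulVec]
  have h1 : (P.Phi S t ω *ᵥ (P.a + P.B *ᵥ P.f t)) i =
      P.a ⬝ᵥ S.phi J (P.z i t ω) + S.phi J (P.z i t ω) ⬝ᵥ P.B *ᵥ P.f t := by
    rw [mulVec_add, dotProduct_comm P.a]; rfl
  rw [h1, sieveError]
  simp only [dotProduct]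
  ring

/-- On this event the Gram matrices are invertible, so least squares reproduces the sieve part of
the outcome exactly; the rest splits by linearity. -/
theorem Ytilde_eq {c : ℝ} (hc : 0 < c) {ω : Ω} (hω : ω ∈ P.gramEvent S c) :
    P.Ytilde S ω = Matrix.of (fun q t => P.a q + (P.B *ᵥ P.f t) q) + P.bias S ω + P.noise S ω := by
  ext q t
  have h1 : (fun i => P.y S i t ω) = P.Phi S t ω *ᵥ (P.a + P.B *ᵥ P.f t) +
      (fun i => P.sieveError S i t ω) + fun i => P.ε i t ω := by
    funext i; exact P.y_eq S i t ω
  have h2 : IsUnit ((P.Phi S t ω)ᵀ * P.Phi S t ω).det := isUnit_det_gram hc (hω t)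
  have h3 : ((P.Phi S t ω)ᵀ * P.Phi S t ω)⁻¹ *ᵥ ((P.Phi S t ω)ᵀ *ᵥ fun i => P.y S i t ω) =
      (P.a + P.B *ᵥ P.f t) + olsMatrix (P.Phi S t ω) *ᵥ (fun i => P.sieveError S i t ω) +
      olsMatrix (P.Phi S t ω) *ᵥ fun i => P.ε i t ω := by
    rw [h1, mulVec_mulVec, ← olsMatrix, mulVec_add, mulVec_add, mulVec_mulVec, olsMatrix,
      Matrix.mul_assoc, Matrix.nonsing_inv_mul _ h2, one_mulVec]
  exact congrFun h3 q

theorem sum_bias_sq_le {c : ℝ} (hc : 0 < c) {ω : Ω} (hω : ω ∈ P.gramEvent S c) (t : Fin T) :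
    ∑ q, P.bias S ω q t ^ 2 ≤ (∑ i, P.sieveError S i t ω ^ 2) / c := by
  have h := vnorm_olsMatrix_mulVec_sq_le hc (hω t) fun i => P.sieveError S i t ω
  rw [vnorm_sq_eq_dotProduct, vnorm_sq_eq_dotProduct] at h
  simp only [dotProduct, ← sq] at h
  exact h

variable {μ : Measure Ω}

theorem olsWeight_of_mem (c : ℝ) (ω : Ω) (i : Fin N) (t : Fin T) (q : Fin M × Fin J)
    (hω : ω ∈ P.gramEvent S c) :
    S.olsWeight J c t i q (P.covariates ω) = olsMatrix (P.Phi S t ω) q i :=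
  Set.indicator_of_mem (s := S.gramSet N T J c) hω _

theorem olsWeight_of_notMem (c : ℝ) (ω : Ω) (i : Fin N) (t : Fin T) (q : Fin M × Fin J)
    (hω : ω ∉ P.gramEvent S c) : S.olsWeight J c t i q (P.covariates ω) = 0 :=
  Set.indicator_of_notMem (s := S.gramSet N T J c) hω _

theorem indepFun_mul_covariates
    (hind : IndepFun (fun ω i t => P.ε i t ω) (fun ω i t => P.z i t ω) μ)
    (i j : Fin N) (t s : Fin T) :
    IndepFun (fun ω => P.ε i t ω * P.ε j s ω) P.covariates μ :=
  hind.comp (φ := fun e : Fin N → Fin T → ℝ => e i t * e j s) (ψ := id) (by fun_prop)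
    measurable_id

/-- Treating `(i, t)` as a single index, the weight vector of each unit and period has expected
squared length at most `MJC/c²`. With `c` proportional to `N` and summable error covariances this is
the order `MJ/N` in one period, and `MJT/N` for a sum over all periods with bounded `w`. -/
theorem integral_sum_sq_noise_le
    (hind : IndepFun (fun ω i t => P.ε i t ω) (fun ω i t => P.z i t ω) μ)
    (hε : ∀ i t, MemLp (P.ε i t) 2 μ) {C c : ℝ} (hc : 0 < c)
    (hφ : ∀ i t m (j : Fin J), Integrable (fun ω => S.φ j (P.z i t ω m) ^ 2) μ ∧
      ∫ ω, S.φ j (P.z i t ω m) ^ 2 ∂μ ≤ C) (w : Fin T → ℝ) :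
    Integrable ((P.gramEvent S c).indicator fun ω => ∑ q, (∑ t, P.noise S ω q t * w t) ^ 2) μ ∧
    ∫ ω, (P.gramEvent S c).indicator (fun ω => ∑ q, (∑ t, P.noise S ω q t * w t) ^ 2) ω ∂μ ≤
      (M * J * C / c ^ 2) * ∑ i, ∑ j, ∑ t, ∑ s,
        |w t| * |w s| * |∫ ω, P.ε i t ω * P.ε j s ω ∂μ| := by
  have hφi : ∀ i t, Integrable (fun ω => (∑ q, S.phi J (P.z i t ω) q ^ 2) / c ^ 2) μ :=
    fun i t => (integrable_finsetSum _ fun q _ => (hφ i t q.1 q.2).1).div_const _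
  have hm : ∀ (k : Fin N × Fin T) (q : Fin M × Fin J),
      Measurable fun ω => S.olsWeight J c k.2 k.1 q (P.covariates ω) := fun k q =>
    (S.measurable_olsWeight J c k.2 k.1 q).comp P.measurable_covariates
  have hle : ∀ (k : Fin N × Fin T) (ω : Ω),
      ∑ q, S.olsWeight J c k.2 k.1 q (P.covariates ω) ^ 2 ≤
        (∑ q, S.phi J (P.z k.1 k.2 ω) q ^ 2) / c ^ 2 :=
    fun k ω => S.sum_olsWeight_sq_le J hc k.2 k.1 (P.covariates ω)
  have hint : ∀ (k : Fin N × Fin T) (q : Fin M × Fin J),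
      Integrable (fun ω => S.olsWeight J c k.2 k.1 q (P.covariates ω) ^ 2) μ := by
    intro k q
    refine (hφi k.1 k.2).mono' ((hm k q).pow_const 2).aestronglyMeasurable
      (ae_of_all _ fun ω => ?_)
    rw [Real.norm_of_nonneg (sq_nonneg _)]
    exact (Finset.single_le_sum
      (f := fun q => S.olsWeight J c k.2 k.1 q (P.covariates ω) ^ 2)
      (fun q _ => sq_nonneg _) (Finset.mem_univ q)).trans (hle k ω)
  have hR : ∀ k : Fin N × Fin T,
      ∑ q, ∫ ω, S.olsWeight J c k.2 k.1 q (P.covariates ω) ^ 2 ∂μ ≤ M * J * C / c ^ 2 := by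
    intro k
    rw [← integral_finsetSum _ fun q _ => hint k q]
    refine (integral_mono (integrable_finsetSum _ fun q _ => hint k q) (hφi k.1 k.2)
      (hle k)).trans ?_
    rw [integral_div, integral_finsetSum _ fun q _ => (hφ k.1 k.2 q.1 q.2).1]
    have : ∑ q : Fin M × Fin J, ∫ ω, S.φ q.2 (P.z k.1 k.2 ω q.1) ^ 2 ∂μ ≤ M * J * C := by
      refine (Finset.sum_le_sum fun q _ => (hφ k.1 k.2 q.1 q.2).2).trans ?_
      simp
    gcongr
    exact this
  obtain ⟨h1, h2⟩ := integral_sum_sq_sum_mul_le (μ := μ) (k := Fin N × Fin T)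
    (ε := fun k => P.ε k.1 k.2) (Z := P.covariates) (c := fun k => S.olsWeight J c k.2 k.1)
    (fun k => hε k.1 k.2) P.measurable_covariates
    (fun k l => P.indepFun_mul_covariates hind k.1 l.1 k.2 l.2)
    (fun k q => S.measurable_olsWeight J c k.2 k.1 q) hint hR (fun k => w k.2)
  have heq : (fun ω => ∑ q, (∑ k : Fin N × Fin T,
      w k.2 * S.olsWeight J c k.2 k.1 q (P.covariates ω) * P.ε k.1 k.2 ω) ^ 2) =
      (P.gramEvent S c).indicator fun ω => ∑ q, (∑ t, P.noise S ω q t * w t) ^ 2 := by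
    funext ω
    by_cases hω : ω ∈ P.gramEvent S c
    · rw [Set.indicator_of_mem hω]
      refine Finset.sum_congr rfl fun q _ => ?_
      rw [Fintype.sum_prod_type_right]
      congr 1
      refine Finset.sum_congr rfl fun t _ => ?_
      simp only [noise, Matrix.of_apply, Finset.sum_mul]
      refine Finset.sum_congr rfl fun i _ => ?_
      rw [P.olsWeight_of_mem S c ω i t q hω]; ring
    · rw [Set.indicator_of_notMem hω]
      refine Finset.sum_eq_zero fun q _ => ?_
      rw [sq_eq_zero_iff]
      exact Finset.sum_eq_zero fun k _ => by
        rw [P.olsWeight_of_notMem S c ω k.1 k.2 q hω]; ring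
  rw [← heq]
  refine ⟨h1, h2.trans_eq ?_⟩
  congr 1
  simp only [Fintype.sum_prod_type]
  refine Finset.sum_congr rfl fun i _ => ?_
  rw [Finset.sum_comm]

/-- The weights of a fixed projection have squared sum at most `‖b‖²/c` for every realisation of the
covariates. With `c` proportional to `N` this gives order `1/N`, free of `J`. -/
theorem integral_sq_dotProduct_noise_le [IsProbabilityMeasure μ]
    (hind : IndepFun (fun ω i t => P.ε i t ω) (fun ω i t => P.z i t ω) μ)
    (hε : ∀ i t, MemLp (P.ε i t) 2 μ) {C c : ℝ} (hc : 0 < c) (t : Fin T) (hC0 : 0 ≤ C)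
    (hC : ∀ i, ∑ j, |∫ ω, P.ε i t ω * P.ε j t ω ∂μ| ≤ C) (b : Fin M × Fin J → ℝ) :
    Integrable ((P.gramEvent S c).indicator fun ω => (∑ q, P.noise S ω q t * b q) ^ 2) μ ∧
    ∫ ω, (P.gramEvent S c).indicator (fun ω => (∑ q, P.noise S ω q t * b q) ^ 2) ω ∂μ ≤
      C * (vnorm b ^ 2 / c) := by
  have hm : ∀ i : Fin N, Measurable fun z => ∑ q, b q * S.olsWeight J c t i q z := fun i =>
    Finset.measurable_sum _ fun q _ => (S.measurable_olsWeight J c t i q).const_mul _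
  have hle : ∀ ω, ∑ i, (∑ q, b q * S.olsWeight J c t i q (P.covariates ω)) ^ 2 ≤
      vnorm b ^ 2 / c := fun ω => S.sum_weighted_olsWeight_sq_le J hc t (P.covariates ω) b
  have hint : ∀ i, Integrable
      (fun ω => (∑ q, b q * S.olsWeight J c t i q (P.covariates ω)) ^ 2) μ := by
    intro i
    refine (integrable_const (vnorm b ^ 2 / c)).mono'
      (((hm i).comp P.measurable_covariates).pow_const 2).aestronglyMeasurable
      (ae_of_all _ fun ω => ?_)
    rw [Real.norm_of_nonneg (sq_nonneg _)]
    exact (Finset.single_le_sum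
      (f := fun i => (∑ q, b q * S.olsWeight J c t i q (P.covariates ω)) ^ 2)
      (fun q _ => sq_nonneg _) (Finset.mem_univ i)).trans (hle ω)
  obtain ⟨h1, h2⟩ := integral_sq_sum_mul_le (μ := μ) (ε := fun i => P.ε i t) (Z := P.covariates)
    (c := fun i z => ∑ q, b q * S.olsWeight J c t i q z)
    (fun i => hε i t) P.measurable_covariates
    (fun i j => P.indepFun_mul_covariates hind i j t t) hm hint hC
  have heq : (fun ω => (∑ i, (∑ q, b q * S.olsWeight J c t i q (P.covariates ω)) *
      P.ε i t ω) ^ 2) =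
      (P.gramEvent S c).indicator fun ω => (∑ q, P.noise S ω q t * b q) ^ 2 := by
    funext ω
    by_cases hω : ω ∈ P.gramEvent S c
    · rw [Set.indicator_of_mem hω]
      congr 1
      simp only [noise, Matrix.of_apply, Finset.sum_mul]
      rw [Finset.sum_comm]
      refine Finset.sum_congr rfl fun q _ => Finset.sum_congr rfl fun i _ => ?_
      rw [P.olsWeight_of_mem S c ω i t q hω]; ring
    · rw [Set.indicator_of_notMem hω, sq_eq_zero_iff]
      refine Finset.sum_eq_zero fun i _ => ?_
      rw [Finset.sum_eq_zero fun q _ => ?_, zero_mul]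
      rw [P.olsWeight_of_notMem S c ω i t q hω, mul_zero]
  rw [← heq]
  refine ⟨h1, h2.trans (mul_le_mul_of_nonneg_left ?_ hC0)⟩
  refine (integral_mono (integrable_finsetSum _ fun i _ => hint i) (integrable_const _) hle).trans ?_
  simp

/-- The orders of magnitude of the noise and of its projections, up to the factor `L`. -/
structure NoiseBound (L : ℝ) (ω : Ω) : Prop where
  total : ∑ t, ∑ q, P.noise S ω q t ^ 2 ≤ L * (T * (M * J / N))
  factors : ∑ k, ∑ q, (∑ t, P.noise S ω q t * (MT T * P.F) t k) ^ 2 ≤ L * (M * J * T / N)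
  mean : ∑ q, (∑ t, P.noise S ω q t * 1) ^ 2 ≤ L * (M * J * T / N)
  loadings : ∑ k, ∑ t, (∑ q, P.noise S ω q t * P.B q k) ^ 2 ≤ L * (T / N)
  intercept : ∑ t, (∑ q, P.noise S ω q t * P.a q) ^ 2 ≤ L * (T / N)

theorem measure_indicator_lt_le {G : Set Ω} {X : Ω → ℝ} (hX : 0 ≤ X)
    (hXi : Integrable (G.indicator X) μ) {c r L : ℝ} (hr : 0 ≤ r) (hL : 0 < L)
    (h : ∫ ω, G.indicator X ω ∂μ ≤ c * r) :
    μ {ω | ω ∈ G ∧ ¬ X ω ≤ L * r} ≤ ENNReal.ofReal (c / L) := by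
  refine (measure_mono fun ω hω => ?_).trans (measure_lt_le_of_integral_le
    (Set.indicator_nonneg fun ω _ => hX ω) hXi hr hL h)
  rw [Set.mem_ofPred_eq] at hω ⊢
  rw [Set.indicator_of_mem hω.1]
  exact not_le.mp hω.2

theorem integrable_integral_indicator_sum_le {ι : Type*} [Fintype ι] {G : Set Ω}
    {X : ι → Ω → ℝ} {R : ℝ} (h : ∀ i, Integrable (G.indicator (X i)) μ ∧
      ∫ ω, G.indicator (X i) ω ∂μ ≤ R) :
    Integrable (G.indicator fun ω => ∑ i, X i ω) μ ∧
      ∫ ω, G.indicator (fun ω => ∑ i, X i ω) ω ∂μ ≤ Fintype.card ι * R := by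
  have heq : (G.indicator fun ω => ∑ i, X i ω) = fun ω => ∑ i, G.indicator (X i) ω := by
    funext ω
    by_cases hω : ω ∈ G <;> simp [hω]
  rw [heq]
  refine ⟨integrable_finsetSum _ fun i _ => (h i).1, ?_⟩
  rw [integral_finsetSum _ fun i _ => (h i).1]
  refine (Finset.sum_le_sum fun i _ => (h i).2).trans ?_
  simp

/-- Five applications of Markov's inequality and a union bound. In the constant, 2 counts the total
and the time sum, and `K + 1` counts the `K` columns of `B` together with `a`. -/
theorem measure_not_noiseBound_le [IsProbabilityMeasure μ]
    (hind : IndepFun (fun ω i t => P.ε i t ω) (fun ω i t => P.z i t ω) μ)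
    (hε : ∀ i t, MemLp (P.ε i t) 2 μ) {C c C₁ w b L : ℝ} (hc : 0 < c) (hC0 : 0 ≤ C)
    (hC₁0 : 0 ≤ C₁) (hb : 0 ≤ b) (hL : 0 < L) (hN : 0 < N) (hT : 0 < T)
    (hφ : ∀ i t m (j : Fin J), Integrable (fun ω => S.φ j (P.z i t ω m) ^ 2) μ ∧
      ∫ ω, S.φ j (P.z i t ω m) ^ 2 ∂μ ≤ C)
    (hC₁ : ∀ i t, ∑ j, |∫ ω, P.ε i t ω * P.ε j t ω ∂μ| ≤ C₁)
    (hC₁' : (1 / ((N : ℝ) * T)) *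
      ∑ i, ∑ j, ∑ t, ∑ s, |∫ ω, P.ε i t ω * P.ε j s ω ∂μ| ≤ C₁)
    (hw : ∀ t k, |(MT T * P.F) t k| ≤ w)
    (hB : ∀ k, vnorm (fun q => P.B q k) ^ 2 ≤ b) (ha : vnorm P.a ^ 2 ≤ b) :
    μ {ω | ω ∈ P.gramEvent S (N * c) ∧ ¬ P.NoiseBound S L ω} ≤
      ENNReal.ofReal ((C * C₁ / c ^ 2 * (2 + K * w ^ 2) + C₁ * b / c * (K + 1)) / L) := by
  have hN' : (0 : ℝ) < N := Nat.cast_pos.mpr hN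
  have hT' : (0 : ℝ) < T := Nat.cast_pos.mpr hT
  have hNc : 0 < N * c := by positivity
  set G := P.gramEvent S (N * c) with hG
  have hsum : ∑ i, ∑ j, ∑ t, ∑ s, |∫ ω, P.ε i t ω * P.ε j s ω ∂μ| ≤ N * T * C₁ := by
    rw [one_div, inv_mul_le_iff₀ (by positivity)] at hC₁'
    exact hC₁'
  have hweighted : ∀ (v : Fin T → ℝ) (x : ℝ), (∀ t, |v t| ≤ x) →
      Integrable (G.indicator fun ω => ∑ q, (∑ t, P.noise S ω q t * v t) ^ 2) μ ∧
      ∫ ω, G.indicator (fun ω => ∑ q, (∑ t, P.noise S ω q t * v t) ^ 2) ω ∂μ ≤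
        x ^ 2 * (C * C₁ / c ^ 2) * (M * J * T / N) := by
    intro v x hv
    obtain ⟨h1, h2⟩ := P.integral_sum_sq_noise_le S hind hε hNc hφ v
    refine ⟨h1, h2.trans ?_⟩
    have h3 : ∑ i, ∑ j, ∑ t, ∑ s, |v t| * |v s| * |∫ ω, P.ε i t ω * P.ε j s ω ∂μ| ≤
        x ^ 2 * (N * T * C₁) := by
      refine le_trans ?_ (mul_le_mul_of_nonneg_left hsum (sq_nonneg x))
      simp only [Finset.mul_sum]
      refine Finset.sum_le_sum fun i _ => Finset.sum_le_sum fun j _ =>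
        Finset.sum_le_sum fun t _ => Finset.sum_le_sum fun s _ => ?_
      refine mul_le_mul_of_nonneg_right ?_ (abs_nonneg _)
      rw [sq]
      exact mul_le_mul (hv t) (hv s) (abs_nonneg _) ((abs_nonneg _).trans (hv t))
    calc M * J * C / (N * c) ^ 2 * ∑ i, ∑ j, ∑ t, ∑ s,
          |v t| * |v s| * |∫ ω, P.ε i t ω * P.ε j s ω ∂μ|
        ≤ M * J * C / (N * c) ^ 2 * (x ^ 2 * (N * T * C₁)) := by gcongr
      _ = _ := by field_simp
  have hsingle : ∀ t, Integrable (G.indicator fun ω => ∑ q, P.noise S ω q t ^ 2) μ ∧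
      ∫ ω, G.indicator (fun ω => ∑ q, P.noise S ω q t ^ 2) ω ∂μ ≤
        C * C₁ / c ^ 2 * (M * J / N) := by
    intro t
    -- Unit weight on period `t` isolates one column of the noise, and only covariances within that
    -- period survive; their row sums are at most `C₁`.
    obtain ⟨h1, h2⟩ := P.integral_sum_sq_noise_le S hind hε hNc hφ (Pi.single t 1)
    have heq : ∀ ω q, ∑ s, P.noise S ω q s * (Pi.single t 1 : Fin T → ℝ) s =
        P.noise S ω q t := by
      intro ω q; simp [Pi.single_apply]
    simp only [heq] at h1 h2
    refine ⟨h1, h2.trans ?_⟩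
    have h3 : ∑ i, ∑ j, ∑ t', ∑ s, |(Pi.single t 1 : Fin T → ℝ) t'| *
        |(Pi.single t 1 : Fin T → ℝ) s| * |∫ ω, P.ε i t' ω * P.ε j s ω ∂μ| ≤ N * C₁ := by
      have : ∀ i j, ∑ t', ∑ s, |(Pi.single t 1 : Fin T → ℝ) t'| *
          |(Pi.single t 1 : Fin T → ℝ) s| * |∫ ω, P.ε i t' ω * P.ε j s ω ∂μ| =
          |∫ ω, P.ε i t ω * P.ε j t ω ∂μ| := by
        intro i j
        rw [Finset.sum_eq_single t, Finset.sum_eq_single t]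
        · simp
        · intro s _ hs; simp [hs]
        · simp
        · intro s _ hs; simp [hs]
        · simp
      simp only [this]
      refine (Finset.sum_le_sum fun i _ => hC₁ i t).trans ?_
      simp
    calc M * J * C / (N * c) ^ 2 * _ ≤ M * J * C / (N * c) ^ 2 * (N * C₁) := by gcongr
      _ = _ := by field_simp
  have hdot : ∀ (t : Fin T) (v : Fin M × Fin J → ℝ), vnorm v ^ 2 ≤ b →
      Integrable (G.indicator fun ω => (∑ q, P.noise S ω q t * v q) ^ 2) μ ∧
      ∫ ω, G.indicator (fun ω => (∑ q, P.noise S ω q t * v q) ^ 2) ω ∂μ ≤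
        C₁ * b / c * (1 / N) := by
    intro t v hv
    obtain ⟨h1, h2⟩ := P.integral_sq_dotProduct_noise_le S hind hε hNc t hC₁0
      (fun i => hC₁ i t) v
    refine ⟨h1, h2.trans ?_⟩
    calc C₁ * (vnorm v ^ 2 / (N * c)) ≤ C₁ * (b / (N * c)) := by gcongr
      _ = _ := by field_simp
  have hr : (0 : ℝ) ≤ M * J * T / N := by positivity
  have hr' : (0 : ℝ) ≤ T / N := by positivity
  have m1 := integrable_integral_indicator_sum_le hsingle
  have m2 := integrable_integral_indicator_sum_le fun k : Fin K =>
    hweighted (fun t => (MT T * P.F) t k) w fun t => hw t k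
  have m3 := hweighted (fun _ => 1) 1 fun t => by simp
  have m4 := integrable_integral_indicator_sum_le fun k : Fin K =>
    integrable_integral_indicator_sum_le fun t : Fin T => hdot t (fun q => P.B q k) (hB k)
  have m5 := integrable_integral_indicator_sum_le fun t : Fin T => hdot t P.a ha
  simp only [Fintype.card_fin] at m1 m2 m4 m5
  have k1 := measure_indicator_lt_le (fun ω => by positivity) m1.1
    (c := C * C₁ / c ^ 2) (r := T * (M * J / N)) (by positivity) hL (m1.2.trans_eq (by ring))
  have k2 := measure_indicator_lt_le (fun ω => by positivity) m2.1
    (c := K * w ^ 2 * (C * C₁ / c ^ 2)) hr hL (m2.2.trans_eq (by ring))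
  have k3 := measure_indicator_lt_le (fun ω => by positivity) m3.1
    (c := C * C₁ / c ^ 2) hr hL (m3.2.trans_eq (by ring))
  have k4 := measure_indicator_lt_le (fun ω => by positivity) m4.1
    (c := C₁ * b / c * K) hr' hL (m4.2.trans_eq (by ring))
  have k5 := measure_indicator_lt_le (fun ω => by positivity) m5.1
    (c := C₁ * b / c) hr' hL (m5.2.trans_eq (by ring))
  have hsub : {ω | ω ∈ G ∧ ¬ P.NoiseBound S L ω} ⊆
      {ω | ω ∈ G ∧ ¬ ∑ t, ∑ q, P.noise S ω q t ^ 2 ≤ L * (T * (M * J / N))} ∪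
      {ω | ω ∈ G ∧ ¬ ∑ k, ∑ q, (∑ t, P.noise S ω q t * (MT T * P.F) t k) ^ 2 ≤
        L * (M * J * T / N)} ∪
      {ω | ω ∈ G ∧ ¬ ∑ q, (∑ t, P.noise S ω q t * 1) ^ 2 ≤ L * (M * J * T / N)} ∪
      {ω | ω ∈ G ∧ ¬ ∑ k, ∑ t, (∑ q, P.noise S ω q t * P.B q k) ^ 2 ≤ L * (T / N)} ∪
      {ω | ω ∈ G ∧ ¬ ∑ t, (∑ q, P.noise S ω q t * P.a q) ^ 2 ≤ L * (T / N)} := by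
    rintro ω ⟨hω, hn⟩
    by_contra hcon
    simp only [Set.mem_union, Set.mem_ofPred_eq, not_or, not_and, not_not] at hcon
    obtain ⟨⟨⟨⟨q1, q2⟩, q3⟩, q4⟩, q5⟩ := hcon
    exact hn ⟨q1 hω, q2 hω, q3 hω, q4 hω, q5 hω⟩
  refine (measure_mono hsub).trans ?_
  refine (measure_union_le _ _).trans ((add_le_add ((measure_union_le _ _).trans
    (add_le_add ((measure_union_le _ _).trans (add_le_add ((measure_union_le _ _).trans
    (add_le_add k1 k2)) k3)) k4)) k5).trans_eq ?_)
  rw [← ENNReal.ofReal_add (by positivity) (by positivity),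
    ← ENNReal.ofReal_add (by positivity) (by positivity),
    ← ENNReal.ofReal_add (by positivity) (by positivity),
    ← ENNReal.ofReal_add (by positivity) (by positivity)]
  congr 1
  ring

end Panel

/-! ### Frobenius norms and the perturbation bound for a panel -/

section FrobeniusNorm

open scoped Matrix.Norms.Frobenius

theorem frobenius_norm_sq {l m : Type*} [Fintype l] [Fintype m] (A : Matrix l m ℝ) :
    ‖A‖ ^ 2 = ∑ i, ∑ j, A i j ^ 2 := by
  rw [Matrix.frobenius_norm_def, ← Real.rpow_natCast, ← Real.rpow_mul (by positivity)]
  norm_num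

theorem frobenius_norm_le_of_sum_le {l m : Type*} [Fintype l] [Fintype m] {A : Matrix l m ℝ}
    {x : ℝ} (h : ∑ i, ∑ j, A i j ^ 2 ≤ x) : ‖A‖ ≤ Real.sqrt x :=
  Real.le_sqrt_of_sq_le ((frobenius_norm_sq A).trans_le h)

theorem matrix_inv_smul {m : Type*} [Fintype m] [DecidableEq m] {c : ℝ} (hc : c ≠ 0)
    (A : Matrix m m ℝ) : (c • A)⁻¹ = c⁻¹ • A⁻¹ := by
  by_cases h : IsUnit A.det
  · refine Matrix.inv_eq_right_inv ?_
    rw [Matrix.smul_mul, Matrix.mul_smul, smul_smul, mul_inv_cancel₀ hc, one_smul,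
      Matrix.mul_nonsing_inv _ h]
  · have h' : ¬ IsUnit (c • A).det := by
      rw [Matrix.det_smul, isUnit_iff_ne_zero, not_not]
      rw [isUnit_iff_ne_zero, not_not] at h
      rw [h, mul_zero]
    rw [Matrix.nonsing_inv_apply_not_isUnit _ h, Matrix.nonsing_inv_apply_not_isUnit _ h',
      smul_zero]

namespace Panel

variable {Ω : Type*} [MeasurableSpace Ω] {K M N T J : ℕ}
  (P : Panel Ω K M N T J) (S : Model K M)

/-- Scaling everything by `s = T^{-1/2}` brings the panel to the form of
`regressedPCA_perturbation`, with `u` the constant unit vector. Here `e` is the size of the noise,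
`g` that of its time averages, and `h` that of its projections on `B` and `a`. -/
theorem estimation_error_le {b ν c q L ρ : ℝ} {ω : Ω} {C : Matrix (Fin M × Fin J) (Fin K) ℝ}
    (hT : 0 < T) (hN : 0 < N) (hρ : 0 ≤ ρ)
    (hb : 1 ≤ b) (hc : 0 < c) (hν : Real.sqrt K / (c ^ 2 / 4) ≤ ν) (hq : 0 < q)
    (hB : ∀ v, c * (v ⬝ᵥ v) ≤ v ⬝ᵥ (P.Bᵀ * P.B) *ᵥ v)
    (hF : ∀ v, c * (v ⬝ᵥ v) ≤ v ⬝ᵥ ((1 / (T : ℝ)) • (P.Fᵀ * MT T * P.F)) *ᵥ v)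
    (haB : P.a ᵥ* P.B = 0) (hab : vnorm P.a ≤ b) (hBb : ‖P.B‖ ≤ b)
    (hFb : ∀ t, vnorm (P.f t) ≤ b) (hKb : K ≤ b)
    (hlead : IsLeadingEigenvectors (P.pcaMatrix S ω) C)
    (hgram : ω ∈ P.gramEvent S (N * q)) (hnoise : P.NoiseBound S L ω)
    (hsieve : ∀ i t, |P.sieveError S i t ω| ≤ ρ)
    (d e g h : ℝ) (hd : d = ρ / Real.sqrt q) (he : e = Real.sqrt (L * (M * J / N)))
    (hg : g = Real.sqrt (L * (M * J / (N * T)))) (hh : h = Real.sqrt (L / N))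
    (hs1 : d + e ≤ c / 4) (hs2 : d + e ≤ 1) (hs3 : 4 * ν * (d + e) ≤ 1)
    (hs4 : 8 * b ^ 4 * ν * (d + e) ≤ 1) :
    frobNorm (C - P.B * P.H S C ω) ≤ 20 * b ^ 4 * (ν + 1) ^ 2 * (d + g + e * h) ∧
    frobNorm (P.H S C ω) ≤ 4 * b ^ 4 * ν ∧
    vnorm (P.ahat S C ω - P.a) ≤ 5 * b ^ 5 * (frobNorm (C - P.B * P.H S C ω) + d + g) ∧
    1 / (T : ℝ) * frobNorm (P.Fhat S C ω - P.F * (P.H S C ω)ᵀ⁻¹) ^ 2 ≤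
      (100 * b ^ 10 * (ν + 1) ^ 2 * (d + h + h + e * frobNorm (C - P.B * P.H S C ω))) ^ 2 := by
  have hT' : (0 : ℝ) < T := Nat.cast_pos.mpr hT
  have hN' : (0 : ℝ) < N := Nat.cast_pos.mpr hN
  set s : ℝ := (Real.sqrt T)⁻¹ with hs
  have hs0 : 0 < s := inv_pos.mpr (Real.sqrt_pos.mpr hT')
  have hss : s * s = 1 / T := by
    rw [hs, ← mul_inv, Real.mul_self_sqrt hT'.le, one_div]
  have hs2' : s ^ 2 = 1 / T := by rw [sq, hss]
  set u : Matrix (Fin T) Unit ℝ := Matrix.of fun _ _ => s with hu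
  have hnorm_smul : ∀ {l m : Type} [Fintype l] [Fintype m] (A : Matrix l m ℝ) (x : ℝ),
      ∑ i, ∑ j, A i j ^ 2 ≤ T * x → ‖s • A‖ ≤ Real.sqrt x := by
    intro l m _ _ A x hA
    apply frobenius_norm_le_of_sum_le
    simp only [Matrix.smul_apply, smul_eq_mul, mul_pow, ← Finset.mul_sum, hs2']
    rw [one_div, inv_mul_le_iff₀ hT']
    exact hA
  have huu : uᵀ * u = 1 := by
    ext i j
    simp [hu, Matrix.mul_apply, hss, hT'.ne']
  have hunorm : ‖u‖ ≤ 1 := by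
    rw [← Real.sqrt_one]
    apply frobenius_norm_le_of_sum_le
    simp [hu, hs2', hT'.ne']
  have hM : MT T = 1 - u * uᵀ := by
    ext i j
    simp [MT, hu, Matrix.mul_apply, hss]
  have hFhat : s • P.Fhat S C ω = (s • P.Ytilde S ω)ᵀ * C := by
    rw [Fhat, Matrix.transpose_smul, Matrix.smul_mul]
  -- `H` is unchanged when factors and estimated factors are scaled by the same constant.
  have hH : P.H S C ω = ((s • P.F)ᵀ * MT T * (s • P.Fhat S C ω)) *
      ((s • P.Fhat S C ω)ᵀ * MT T * (s • P.Fhat S C ω))⁻¹ := by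
    simp only [Matrix.transpose_smul, Matrix.smul_mul, Matrix.mul_smul, smul_smul]
    rw [matrix_inv_smul (by positivity), Matrix.mul_smul, smul_smul,
      mul_inv_cancel₀ (by positivity), one_smul, H]
  have hpca : P.pcaMatrix S ω = (s • P.Ytilde S ω) * MT T * (s • P.Ytilde S ω)ᵀ := by
    simp only [Matrix.transpose_smul, Matrix.smul_mul, Matrix.mul_smul, smul_smul, hss, pcaMatrix]
  have hY : s • P.Ytilde S ω = replicateCol Unit P.a * uᵀ + P.B * (s • P.F)ᵀ +
      s • P.bias S ω + s • P.noise S ω := by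
    rw [P.Ytilde_eq S (by positivity) hgram, smul_add, smul_add]
    congr 2
    ext p t
    simp only [Matrix.smul_apply, Matrix.of_apply, smul_eq_mul, Matrix.add_apply,
      Matrix.mul_apply, Matrix.replicateCol_apply, Matrix.transpose_apply, hu,
      Finset.univ_unique, Finset.sum_singleton, mulVec, dotProduct, F, mul_add, Finset.mul_sum]
    congr 1
    · ring
    · exact Finset.sum_congr rfl fun k _ => by ring
  have hYu : (1 - C * Cᵀ) * ((s • P.Ytilde S ω) * u) - replicateCol Unit P.a =
      replicateCol Unit (P.ahat S C ω - P.a) := by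
    have h1 : (s • P.Ytilde S ω) * u = replicateCol Unit (P.Ybar S ω) := by
      ext p j
      simp only [Matrix.mul_apply, Matrix.smul_apply, hu, Matrix.of_apply, smul_eq_mul,
        Matrix.replicateCol_apply, Ybar, Finset.sum_div]
      refine Finset.sum_congr rfl fun t _ => ?_
      rw [mul_right_comm, hss]; ring
    rw [h1, ← replicateCol_mulVec]
    rfl
  have hlead' := hlead
  rw [hpca] at hlead'
  have hFs : ∀ v, c * (v ⬝ᵥ v) ≤ v ⬝ᵥ ((s • P.F)ᵀ * MT T * (s • P.F)) *ᵥ v := by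
    simp only [Matrix.transpose_smul, Matrix.smul_mul, Matrix.mul_smul, smul_smul, hss]
    exact hF
  have hb2 : b ≤ b ^ 2 := le_self_pow₀ hb (by norm_num)
  have hb0 : 0 ≤ b := by linarith
  -- Orthonormal columns give `‖C‖² = K`, which is at most `b ≤ b²`.
  have hCb : ‖C‖ ≤ b := by
    rw [← Real.sqrt_sq hb0]
    apply frobenius_norm_le_of_sum_le
    have : ∀ k, ∑ p, C p k ^ 2 = 1 := by
      intro k
      have := congrFun (congrFun hlead.1 k) k
      simpa [Matrix.mul_apply, sq] using this
    rw [Finset.sum_comm]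
    simp only [this]
    simp only [Finset.sum_const, Finset.card_univ, Fintype.card_fin, nsmul_eq_mul, mul_one]
    linarith
  have hFnorm : ‖s • P.F‖ ≤ b := by
    rw [← Real.sqrt_sq hb0]
    apply hnorm_smul
    have : ∀ t, ∑ k, P.F t k ^ 2 ≤ b ^ 2 := by
      intro t
      have h1 := pow_le_pow_left₀ (vnorm_nonneg _) (hFb t) 2
      rw [vnorm_sq_eq_dotProduct] at h1
      simpa [F, dotProduct, sq] using h1
    refine (Finset.sum_le_sum fun t _ => this t).trans ?_
    simp
  have haB' : (replicateCol Unit P.a)ᵀ * P.B = 0 := by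
    ext i k
    have := congrFun haB k
    simpa [Matrix.mul_apply, vecMul, dotProduct] using this
  have hanorm : ‖replicateCol Unit P.a‖ ≤ b := by
    rwa [Matrix.frobenius_norm_replicateCol]
  have hDn : ‖s • P.bias S ω‖ ≤ d := by
    have : d = Real.sqrt (ρ ^ 2 / q) := by
      rw [hd, Real.sqrt_div (sq_nonneg _), Real.sqrt_sq hρ]
    rw [this]
    apply hnorm_smul
    rw [Finset.sum_comm]
    have h1 : ∀ t, ∑ p, P.bias S ω p t ^ 2 ≤ ρ ^ 2 / q := by
      intro t
      refine (P.sum_bias_sq_le S (by positivity) hgram t).trans ?_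
      have h2 : ∑ i, P.sieveError S i t ω ^ 2 ≤ N * ρ ^ 2 := by
        refine (Finset.sum_le_sum fun i _ => sq_le_sq' (abs_le.mp (hsieve i t)).1
          (abs_le.mp (hsieve i t)).2).trans ?_
        simp
      calc (∑ i, P.sieveError S i t ω ^ 2) / (N * q) ≤ (N * ρ ^ 2) / (N * q) := by gcongr
        _ = _ := by field_simp
    refine (Finset.sum_le_sum fun t _ => h1 t).trans ?_
    simp
  have hEn : ‖s • P.noise S ω‖ ≤ e := by
    rw [he]
    apply hnorm_smul
    rw [Finset.sum_comm]
    exact hnoise.total.trans_eq (by ring)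
  have hEF : ‖(s • P.noise S ω) * MT T * (s • P.F)‖ ≤ g := by
    have h1 : (s • P.noise S ω) * MT T * (s • P.F) = s • (s • (P.noise S ω * (MT T * P.F))) := by
      simp only [Matrix.smul_mul, Matrix.mul_smul, Matrix.mul_assoc]
    rw [h1, hg]
    apply hnorm_smul
    simp only [Matrix.smul_apply, smul_eq_mul, mul_pow, ← Finset.mul_sum, hs2']
    have h2 := hnoise.factors
    rw [Finset.sum_comm] at h2
    simp only [Matrix.mul_apply (M := P.noise S ω)]
    rw [one_div, inv_mul_le_iff₀ hT']
    refine h2.trans_eq ?_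
    field_simp
  have hEu : ‖(s • P.noise S ω) * u‖ ≤ g := by
    have h1 : (s • P.noise S ω) * u =
        s • (s • (P.noise S ω * (Matrix.of fun _ _ => 1 : Matrix (Fin T) Unit ℝ))) := by
      ext p j
      simp [hu, Matrix.mul_apply, Finset.mul_sum, mul_comm]
    rw [h1, hg]
    apply hnorm_smul
    simp only [Matrix.smul_apply, smul_eq_mul, mul_pow, ← Finset.mul_sum, hs2']
    simp only [Matrix.mul_apply, Matrix.of_apply, Finset.univ_unique, Finset.sum_singleton]
    rw [one_div, inv_mul_le_iff₀ hT']
    refine hnoise.mean.trans_eq ?_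
    field_simp
  have hEB : ‖(s • P.noise S ω)ᵀ * P.B‖ ≤ h := by
    rw [Matrix.transpose_smul, Matrix.smul_mul, hh]
    apply hnorm_smul
    rw [Finset.sum_comm]
    exact hnoise.loadings.trans_eq (by ring)
  have hEa : ‖(s • P.noise S ω)ᵀ * replicateCol Unit P.a‖ ≤ h := by
    rw [Matrix.transpose_smul, Matrix.smul_mul, hh]
    apply hnorm_smul
    simp only [Finset.univ_unique, Finset.sum_singleton]
    exact hnoise.intercept.trans_eq (by ring)
  obtain ⟨r1, r2, r3, r4⟩ := regressedPCA_perturbation hb hc hν huu hunorm hM hB hFs hY haB'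
    hanorm hBb hFnorm hCb hlead' hFhat hH hDn hEn hEF hEu hEB hEa hs1 hs2 hs3 hs4
  refine ⟨r1, r2, ?_, ?_⟩
  · rw [hYu, Matrix.frobenius_norm_replicateCol] at r3
    exact r3
  · have h1 : s • P.Fhat S C ω - s • P.F * (P.H S C ω)ᵀ⁻¹ =
        s • (P.Fhat S C ω - P.F * (P.H S C ω)ᵀ⁻¹) := by
      rw [smul_sub, Matrix.smul_mul]
    rw [h1, norm_smul, Real.norm_of_nonneg hs0.le] at r4
    rw [← hs2', ← mul_pow]
    exact pow_le_pow_left₀ (mul_nonneg hs0.le (norm_nonneg _)) r4 2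

end Panel

end FrobeniusNorm

/-! ### Size of the basis functions -/

section Basis

variable {K M : ℕ} (S : Model K M)

theorem Model.maxSupSq_le_xi_sq (J : ℕ) : S.maxSupSq J ≤ S.xi J ^ 2 := by
  refine iSup_le fun j => iSup₂_le fun z hz => ?_
  have h1 : |S.φ j z| ≤ vnorm fun j : Fin J => S.φ j z := by
    have := PiLp.norm_apply_le (WithLp.toLp 2 fun j : Fin J => S.φ j z) j
    simpa [vnorm] using this
  rw [ENNReal.ofReal_pow (abs_nonneg _)]
  exact pow_le_pow_left' ((ENNReal.ofReal_le_ofReal h1).trans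
    (le_iSup₂ (f := fun z (_ : z ∈ S.D) => ENNReal.ofReal (vnorm fun j : Fin J => S.φ j z)) z hz)) 2

theorem Model.sq_le_of_maxSupSq_eq {J : ℕ} {x : ℝ} (hx : 0 ≤ x)
    (h : S.maxSupSq J = ENNReal.ofReal x) (j : Fin J) {z : ℝ} (hz : z ∈ S.D) :
    S.φ j z ^ 2 ≤ x := by
  rw [← sq_abs, ← ENNReal.ofReal_le_ofReal_iff hx, ← h]
  exact (le_iSup₂ (f := fun z (_ : z ∈ S.D) => ENNReal.ofReal (|S.φ j z| ^ 2)) z hz).trans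
    (le_iSup (fun j : Fin J => ⨆ z ∈ S.D, ENNReal.ofReal (|S.φ j z| ^ 2)) j)

variable {Ω : Type*} [MeasurableSpace Ω] {μ : Measure Ω} [IsProbabilityMeasure μ] {N T J : ℕ}

/-- A diagonal entry of `Q_{it}` is a mean of `φ_j²`: it exceeds the smallest eigenvalue, and it is
at most the supremum because the covariates lie in the domain almost surely. -/
theorem Panel.ofReal_le_maxSupSq (P : Panel Ω K M N T J) {q : ℝ} {i : Fin N} {t : Fin T}
    (hz : ∀ᵐ ω ∂μ, P.z i t ω ∈ S.dom) (m : Fin M) (j : Fin J)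
    (hφ : Integrable (fun ω => S.φ j (P.z i t ω m) ^ 2) μ)
    (hQ : LtEigMin q (P.Q S μ i t)) : ENNReal.ofReal q ≤ S.maxSupSq J := by
  rcases eq_or_ne (S.maxSupSq J) ⊤ with h | h
  · rw [h]; exact le_top
  have hx : S.maxSupSq J = ENNReal.ofReal (S.maxSupSq J).toReal := (ENNReal.ofReal_toReal h).symm
  rw [hx]
  refine ENNReal.ofReal_le_ofReal ?_
  have hherm : (P.Q S μ i t).IsHermitian := by
    ext p q
    simp [Panel.Q, mul_comm]
  have h1 := hQ.le_dotProduct_mulVec hherm (Pi.single (m, j) 1)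
  simp only [single_one_dotProduct, Pi.single_eq_same, mul_one, mulVec_single_one,
    Matrix.col_apply] at h1
  have h2 : P.Q S μ i t (m, j) (m, j) = ∫ ω, S.φ j (P.z i t ω m) ^ 2 ∂μ := by
    simp [Panel.Q, Model.phi, sq]
  rw [h2] at h1
  refine h1.trans ((integral_mono_ae hφ (integrable_const _) ?_).trans_eq
    (by simp : ∫ _, (S.maxSupSq J).toReal ∂μ = _))
  filter_upwards [hz] with ω hω
  exact S.sq_le_of_maxSupSq_eq ENNReal.toReal_nonneg hx j (hω m)

end Basis

/-! ### Events of high probability and consequences of the rate condition -/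

section Sequences

variable {Ω : Type*} [MeasurableSpace Ω] {μ : Measure Ω} {K M : ℕ} {S : Model K M}
  {N T J : ℕ → ℕ} {P : ∀ n, Panel Ω K M (N n) (T n) (J n)} {κ : ℝ}

/-- The event on which the estimation errors are bounded. -/
structure Panel.RegularEvent {N T J : ℕ} (P : Panel Ω K M N T J) (S : Model K M) (c L : ℝ)
    (ω : Ω) : Prop where
  dom : ∀ i t, P.z i t ω ∈ S.dom
  gram : ω ∈ P.gramEvent S (N * c)
  noise : P.NoiseBound S L ω

theorem Panel.abs_f_apply_le {N T J : ℕ} (P : Panel Ω K M N T J) {d : ℝ}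
    (hf : ∀ t, vnorm (P.f t) ≤ d) (t : Fin T) (k : Fin K) : |P.f t k| ≤ d := by
  have := PiLp.norm_apply_le (WithLp.toLp 2 (P.f t)) k
  exact le_trans (by simpa [vnorm] using this) (hf t)

theorem Panel.abs_MT_mul_F_le {N T J : ℕ} (P : Panel Ω K M N T J) {d : ℝ} (hT : 0 < T)
    (hf : ∀ t, vnorm (P.f t) ≤ d) (t : Fin T) (k : Fin K) : |(MT T * P.F) t k| ≤ 2 * d := by
  have hT' : (0 : ℝ) < T := Nat.cast_pos.mpr hT
  have h1 : (MT T * P.F) t k = P.f t k - (1 / (T : ℝ)) * ∑ s, P.f s k := by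
    rw [MT, Matrix.sub_mul, Matrix.one_mul, Matrix.smul_mul]
    simp [Matrix.mul_apply, Panel.F]
  have h2 : |(1 / (T : ℝ)) * ∑ s, P.f s k| ≤ d := by
    rw [abs_mul, abs_of_pos (by positivity), one_div, inv_mul_le_iff₀ hT']
    refine (Finset.abs_sum_le_sum_abs _ _).trans
      ((Finset.sum_le_sum fun s _ => P.abs_f_apply_le hf s k).trans ?_)
    simp
  rw [h1]
  linarith [abs_sub (P.f t k) ((1 / (T : ℝ)) * ∑ s, P.f s k), P.abs_f_apply_le hf t k]

theorem Panel.vnorm_B_col_sq_le {N T J : ℕ} (P : Panel Ω K M N T J) {d : ℝ}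
    (h : EigMaxLt (P.Bᵀ * P.B) d) (k : Fin K) : vnorm (fun q => P.B q k) ^ 2 ≤ d := by
  have hherm : (P.Bᵀ * P.B).IsHermitian := by
    have := Matrix.isHermitian_conjTranspose_mul_self P.B
    rwa [Matrix.conjTranspose_eq_transpose_of_trivial] at this
  have h1 := h.dotProduct_mulVec_le hherm (Pi.single k 1)
  simp only [single_one_dotProduct, Pi.single_eq_same, mul_one, mulVec_single_one,
    Matrix.col_apply] at h1
  rw [vnorm_sq_eq_dotProduct]
  exact h1

theorem Panel.subset_gramEvent {N T J : ℕ} (P : Panel Ω K M N T J) {c C : ℝ} (hN : 0 < N) :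
    {ω | ∀ t, LtEigMin c (P.Qhat S t ω) ∧ EigMaxLt (P.Qhat S t ω) C} ⊆
      P.gramEvent S (N * c) := by
  intro ω hω t x
  have hN' : (0 : ℝ) < N := Nat.cast_pos.mpr hN
  have hherm : (P.Qhat S t ω).IsHermitian := by
    rw [Matrix.IsHermitian, Matrix.conjTranspose_eq_transpose_of_trivial, Panel.Qhat,
      Matrix.transpose_smul, Matrix.transpose_mul, Matrix.transpose_transpose]
  have h1 := (hω t).1.le_dotProduct_mulVec hherm x
  rw [Panel.Qhat, smul_mulVec, dotProduct_smul, smul_eq_mul, one_div, le_inv_mul_iff₀ hN'] at h1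
  rw [mul_assoc]
  exact h1

variable [IsProbabilityMeasure μ]

theorem eventually_measure_not_regularEvent_le
    (hD : ∀ n i t, ∀ᵐ ω ∂μ, (P n).z i t ω ∈ S.dom)
    {cmin cmax dmax : ℝ} (hcmin : 0 < cmin)
    (hgram : Tendsto (fun n => μ {ω | ∀ t, LtEigMin cmin ((P n).Qhat S t ω) ∧
      EigMaxLt ((P n).Qhat S t ω) cmax}) atTop (𝓝 1))
    (hφ : ∃ C : ℝ, ∀ n i t m (j : Fin (J n)),
      Integrable (fun ω => S.φ j ((P n).z i t ω m) ^ 2) μ ∧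
      ∫ ω, S.φ j ((P n).z i t ω m) ^ 2 ∂μ ≤ C)
    (hB : ∀ n, EigMaxLt ((P n).Bᵀ * (P n).B) dmax) (hf : ∀ n t, vnorm ((P n).f t) < dmax)
    (h3 : DGPAssumption μ P) (h4 : InterceptAssumption P)
    (hN : Tendsto N atTop atTop) (hT : ∀ᶠ n in atTop, 0 < T n) {ε : ℝ} (hε : 0 < ε) :
    ∃ L : ℝ, 0 < L ∧ ∀ᶠ n in atTop,
      μ {ω | ¬ (P n).RegularEvent S cmin L ω} ≤ ENNReal.ofReal ε := by
  obtain ⟨C, hC⟩ := hφ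
  obtain ⟨C₁, hC₁, hw1, hw2⟩ := h3.weak
  obtain ⟨C₀, hC₀, ha⟩ := h4.bound
  set b : ℝ := |dmax| + C₀ ^ 2 with hb
  have hb0 : 0 ≤ b := by positivity
  set A : ℝ := |C| * C₁ / cmin ^ 2 * (2 + K * (2 * |dmax|) ^ 2) + C₁ * b / cmin * (K + 1) with hA
  have hA0 : 0 < A + 1 := by positivity
  -- With this `L`, Markov's bound `A / L` is at most `ε/2`; the other half of `ε` is spent on
  -- ill-conditioned Gram matrices.
  refine ⟨(A + 1) * (2 / ε), by positivity, ?_⟩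
  have hε2 : ENNReal.ofReal (1 - ε / 2) < 1 := by
    rw [← ENNReal.ofReal_one]
    exact (ENNReal.ofReal_lt_ofReal_iff one_pos).mpr (by linarith)
  filter_upwards [hN.eventually_gt_atTop 0, hT, hgram.eventually_const_lt hε2]
    with n hNn hTn hgn
  have k1 : μ {ω | ¬ ∀ i t, (P n).z i t ω ∈ S.dom} = 0 := by
    rw [← ae_iff]
    exact ae_all_iff.mpr fun i => ae_all_iff.mpr fun t => hD n i t
  have k2 : μ ((P n).gramEvent S (N n * cmin))ᶜ ≤ ENNReal.ofReal (ε / 2) := by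
    rw [prob_compl_eq_one_sub ((P n).measurableSet_gramEvent S _)]
    have := hgn.le.trans (measure_mono ((P n).subset_gramEvent (S := S) hNn))
    rw [tsub_le_iff_right]
    calc (1 : ℝ≥0∞) = ENNReal.ofReal (ε / 2 + (1 - ε / 2)) := by norm_num
      _ ≤ ENNReal.ofReal (ε / 2) + ENNReal.ofReal (1 - ε / 2) := ENNReal.ofReal_add_le
      _ ≤ _ := by gcongr
  have hdl := le_abs_self dmax
  have k3 := (P n).measure_not_noiseBound_le S (μ := μ) (C := |C|) (c := cmin) (C₁ := C₁)
    (w := 2 * |dmax|) (b := b) (L := (A + 1) * (2 / ε)) (h3.indep n) (h3.memLp n) hcmin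
    (abs_nonneg _) hC₁.le hb0 (by positivity) hNn hTn
    (fun i t m j => ⟨(hC n i t m j).1, (hC n i t m j).2.trans (le_abs_self _)⟩)
    (fun i t => (hw1 n i t).le) (hw2 n).le
    (fun t k => (P n).abs_MT_mul_F_le hTn (fun t => (hf n t).le.trans hdl) t k)
    (fun k => ((P n).vnorm_B_col_sq_le (hB n) k).trans (by rw [hb]; nlinarith [sq_nonneg C₀]))
    (by
      have := pow_le_pow_left₀ (vnorm_nonneg _) (ha n).le 2
      rw [hb]; linarith [abs_nonneg dmax])
  have k4 : ENNReal.ofReal (A / ((A + 1) * (2 / ε))) ≤ ENNReal.ofReal (ε / 2) := by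
    refine ENNReal.ofReal_le_ofReal ?_
    rw [div_le_iff₀ (by positivity)]
    field_simp
    linarith
  have hsub : {ω | ¬ (P n).RegularEvent S cmin ((A + 1) * (2 / ε)) ω} ⊆
      {ω | ¬ ∀ i t, (P n).z i t ω ∈ S.dom} ∪ ((P n).gramEvent S (N n * cmin))ᶜ ∪
      {ω | ω ∈ (P n).gramEvent S (N n * cmin) ∧
        ¬ (P n).NoiseBound S ((A + 1) * (2 / ε)) ω} := by
    intro ω hω
    by_contra hcon
    simp only [Set.mem_union, Set.mem_ofPred_eq, Set.mem_compl_iff, not_or, not_and,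
      not_not] at hcon
    obtain ⟨⟨q1, q2⟩, q3⟩ := hcon
    exact hω ⟨q1, q2, q3 q2⟩
  calc μ _ ≤ _ := measure_mono hsub
    _ ≤ 0 + ENNReal.ofReal (ε / 2) + ENNReal.ofReal (ε / 2) :=
      (measure_union_le _ _).trans (add_le_add ((measure_union_le _ _).trans
        (add_le_add k1.le k2)) (k3.trans k4))
    _ = ENNReal.ofReal ε := by
      rw [zero_add, ← ENNReal.ofReal_add (by positivity) (by positivity)]
      congr 1; ring

/-- The sieve dimension is of smaller order than `√N`. -/
theorem eventually_sq_dim_le (hD : ∀ n i t, ∀ᵐ ω ∂μ, (P n).z i t ω ∈ S.dom)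
    (hφ : ∃ C : ℝ, ∀ n i t m (j : Fin (J n)),
      Integrable (fun ω => S.φ j ((P n).z i t ω m) ^ 2) μ ∧
      ∫ ω, S.φ j ((P n).z i t ω m) ^ 2 ∂μ ≤ C)
    {q : ℝ} (hq : 0 < q) (hQ : ∀ n i t, LtEigMin q ((P n).Q S μ i t))
    (hN : Tendsto N atTop atTop) (hT : ∀ᶠ n in atTop, 0 < T n) (hJ : Tendsto J atTop atTop)
    (hξ : Tendsto (fun n => (J n : ℝ≥0∞) ^ 2 * S.xi (J n) ^ 2 *
      ENNReal.ofReal (Real.log (J n)) / (N n : ℝ≥0∞)) atTop (𝓝 0)) {η : ℝ} (hη : 0 < η) :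
    ∀ᶠ n in atTop, ((M : ℝ) * J n) ^ 2 ≤ η * N n := by
  obtain ⟨C, hC⟩ := hφ
  rcases Nat.eq_zero_or_pos M with hM | hM
  · refine Eventually.of_forall fun n => ?_
    rw [hM]; simp; positivity
  have hM' : (0 : ℝ) < M := Nat.cast_pos.mpr hM
  have hpos : (0 : ℝ≥0∞) < ENNReal.ofReal (η * q / M ^ 2) := by
    rw [ENNReal.ofReal_pos]; positivity
  have hlog : Tendsto (fun n => Real.log (J n)) atTop atTop :=
    Real.tendsto_log_atTop.comp (tendsto_natCast_atTop_atTop.comp hJ)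
  filter_upwards [hN.eventually_gt_atTop 0, hT, hJ.eventually_gt_atTop 0,
    hlog.eventually_ge_atTop 1, hξ.eventually_lt_const hpos] with n hNn hTn hJn hln hξn
  have hN' : (0 : ℝ) < N n := Nat.cast_pos.mpr hNn
  -- Since `ξ_J²` is bounded below by `q` and `log J ≥ 1` eventually, the rate condition forces
  -- `J²/N → 0`.
  have h1 : ENNReal.ofReal q ≤ S.xi (J n) ^ 2 :=
    ((P n).ofReal_le_maxSupSq S (hD n ⟨0, hNn⟩ ⟨0, hTn⟩) ⟨0, hM⟩ ⟨0, hJn⟩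
      (hC n _ _ _ _).1 (hQ n _ _)).trans (S.maxSupSq_le_xi_sq _)
  have h2 : ENNReal.ofReal ((J n : ℝ) ^ 2 * q * 1 / N n) ≤
      (J n : ℝ≥0∞) ^ 2 * S.xi (J n) ^ 2 * ENNReal.ofReal (Real.log (J n)) / (N n : ℝ≥0∞) := by
    rw [ENNReal.ofReal_div_of_pos hN', ENNReal.ofReal_mul (by positivity),
      ENNReal.ofReal_mul (by positivity), ENNReal.ofReal_pow (by positivity),
      ENNReal.ofReal_natCast, ENNReal.ofReal_natCast]
    gcongr
  have h3 := (ENNReal.ofReal_lt_ofReal_iff (by positivity)).mp (h2.trans_lt hξn)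
  rw [div_lt_div_iff₀ hN' (by positivity)] at h3
  have h4 : (((M : ℝ) * J n) ^ 2) * q ≤ (η * N n) * q := by nlinarith
  exact le_of_mul_le_mul_right h4 hq

end Sequences

/-! ### From deterministic bounds to stochastic rates -/

theorem sq_add_add_le (x y z : ℝ) : (x + y + z) ^ 2 ≤ 3 * (x ^ 2 + y ^ 2 + z ^ 2) := by
  linarith [sq_nonneg (x - y), sq_nonneg (x - z), sq_nonneg (y - z)]

/-- Reduces a stochastic order to deterministic bounds on events of high probability. Monotonicity
of outer measure suffices, so an arbitrary, possibly nonmeasurable, choice of eigenvectors is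
allowed. -/
theorem isBigOp_of_eventually_le {Ω : Type*} [MeasurableSpace Ω] {μ : Measure Ω}
    {X : ℕ → Ω → ℝ≥0∞} {r : ℕ → ℝ≥0∞} {G : ℝ → ℕ → Ω → Prop}
    (hG : ∀ ε : ℝ, 0 < ε → ∃ L : ℝ, 0 < L ∧ ∀ᶠ n in atTop, μ {ω | ¬ G L n ω} ≤ ENNReal.ofReal ε)
    (h : ∀ L : ℝ, 0 < L → ∃ C : ℝ, 0 < C ∧
      ∀ᶠ n in atTop, ∀ ω, G L n ω → X n ω ≤ ENNReal.ofReal C * r n) :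
    IsBigOp μ X r := by
  intro ε hε
  obtain ⟨L, hL, hGL⟩ := hG ε hε
  obtain ⟨C, hC, hCn⟩ := h L hL
  refine ⟨C, hC, ?_⟩
  filter_upwards [hGL, hCn] with n h1 h2
  refine (measure_mono (t := {ω | ¬ G L n ω}) fun ω hω => ?_).trans h1
  rw [Set.mem_ofPred_eq] at hω ⊢
  exact fun hg => absurd (h2 ω hg) (not_le.mpr hω)

namespace Panel

variable {Ω : Type*} [MeasurableSpace Ω] {K M N T J : ℕ}
  (P : Panel Ω K M N T J) (S : Model K M)

theorem vnorm_sub_le {ι : Type*} [Fintype ι] (x y : ι → ℝ) :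
    vnorm (x - y) ≤ vnorm x + vnorm y := by
  rw [vnorm, WithLp.toLp_sub]; exact norm_sub_le _ _

theorem abs_sum_le_mul {ι : Type*} [Fintype ι] {f : ι → ℝ} {x : ℝ} (h : ∀ i, |f i| ≤ x) :
    |∑ i, f i| ≤ Fintype.card ι * x :=
  (Finset.abs_sum_le_sum_abs _ _).trans ((Finset.sum_le_sum fun i _ => h i).trans (by simp))

theorem abs_sieveError_le {η d : ℝ} {ω : Ω} (hη : 0 ≤ η) (hdom : ∀ i t, P.z i t ω ∈ S.dom)
    (hr : ∀ m, ∀ x ∈ S.D, |P.r S m x| ≤ η) (hδ : ∀ m, ∀ x ∈ S.D, ∀ k, |P.δ S k m x| ≤ η)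
    (hf : ∀ t, vnorm (P.f t) ≤ d) (i : Fin N) (t : Fin T) :
    |P.sieveError S i t ω| ≤ M * η + K * (M * η * d) := by
  have h1 := abs_sum_le_mul fun m => hr m _ (hdom i t m)
  have h2 : ∀ k, |(∑ m, P.δ S k m (P.z i t ω m)) * P.f t k| ≤ M * η * d := by
    intro k
    have h3 := abs_sum_le_mul fun m => hδ m _ (hdom i t m) k
    rw [Fintype.card_fin] at h3
    rw [abs_mul]
    exact mul_le_mul h3 (P.abs_f_apply_le hf t k) (abs_nonneg _) (by positivity)
  have h4 := abs_sum_le_mul h2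
  rw [Fintype.card_fin] at h1 h4
  exact (abs_add_le _ _).trans (add_le_add h1 h4)

theorem vnorm_phi_sq_le {b : ℝ} (hb : 0 ≤ b) (h : S.maxSupSq J = ENNReal.ofReal b)
    {z : Fin M → ℝ} (hz : z ∈ S.dom) : vnorm (S.phi J z) ^ 2 ≤ M * J * b := by
  rw [vnorm_sq_eq_dotProduct, dotProduct]
  refine (Finset.sum_le_sum fun q _ => ?_).trans_eq
    (by simp : ∑ _q : Fin M × Fin J, b = M * J * b)
  rw [← sq]
  exact S.sq_le_of_maxSupSq_eq hb h q.2 (hz q.1)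

/-- The error is `(â - a)ᵀφ(z)` minus the sieve error of `α`. Cauchy–Schwarz on the first part costs
the factor `MJb`. -/
theorem sq_αhat_sub_le {b η : ℝ} (hb : 0 ≤ b) (h : S.maxSupSq J = ENNReal.ofReal b)
    (hr : ∀ m, ∀ x ∈ S.D, |P.r S m x| ≤ η) (C : Matrix (Fin M × Fin J) (Fin K) ℝ) (ω : Ω)
    {z : Fin M → ℝ} (hz : z ∈ S.dom) :
    |P.αhat S C ω z - S.α z| ^ 2 ≤
      2 * (vnorm (P.ahat S C ω - P.a) ^ 2 * (M * J * b)) + 2 * (M * η) ^ 2 := by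
  have h1 : P.αhat S C ω z - S.α z =
      (P.ahat S C ω - P.a) ⬝ᵥ S.phi J z - ∑ m, P.r S m (z m) := by
    rw [αhat, P.α_eq_dotProduct_add, sub_dotProduct]; ring
  have h2 : ((P.ahat S C ω - P.a) ⬝ᵥ S.phi J z) ^ 2 ≤
      vnorm (P.ahat S C ω - P.a) ^ 2 * (M * J * b) := by
    have h3 := abs_real_inner_le_norm (WithLp.toLp 2 (S.phi J z))
      (WithLp.toLp 2 (P.ahat S C ω - P.a))
    rw [EuclideanSpace.inner_eq_star_dotProduct, star_trivial] at h3
    rw [← sq_abs]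
    refine (pow_le_pow_left₀ (abs_nonneg _) h3 2).trans ?_
    rw [mul_pow, mul_comm]
    exact mul_le_mul_of_nonneg_left (vnorm_phi_sq_le S hb h hz) (sq_nonneg _)
  have h4 : (∑ m, P.r S m (z m)) ^ 2 ≤ (M * η) ^ 2 := by
    have := abs_sum_le_mul fun m => hr m _ (hz m)
    rw [Fintype.card_fin] at this
    rw [← sq_abs]
    exact pow_le_pow_left₀ (abs_nonneg _) this 2
  rw [sq_abs, h1]
  linarith [sq_nonneg ((P.ahat S C ω - P.a) ⬝ᵥ S.phi J z + ∑ m, P.r S m (z m))]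

/-- The error is `(B̂ - BH)ᵀφ(z)` minus `Hᵀ` applied to the sieve error of `β`, hence the need for a
bound on `H`. -/
theorem sq_βhat_sub_le {b η : ℝ} (hb : 0 ≤ b) (h : S.maxSupSq J = ENNReal.ofReal b)
    (hδ : ∀ m, ∀ x ∈ S.D, ∀ k, |P.δ S k m x| ≤ η)
    (C : Matrix (Fin M × Fin J) (Fin K) ℝ) (ω : Ω)
    {z : Fin M → ℝ} (hz : z ∈ S.dom) :
    vnorm (Cᵀ *ᵥ S.phi J z - (P.H S C ω)ᵀ *ᵥ S.β z) ^ 2 ≤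
      2 * (frobNorm (C - P.B * P.H S C ω) ^ 2 * (M * J * b)) +
      2 * (frobNorm (P.H S C ω) ^ 2 * (K * (M * η) ^ 2)) := by
  set H := P.H S C ω with hH
  set v : Fin K → ℝ := fun k => ∑ m, P.δ S k m (z m) with hv
  have h1 : Cᵀ *ᵥ S.phi J z - Hᵀ *ᵥ S.β z =
      (C - P.B * H)ᵀ *ᵥ S.phi J z - Hᵀ *ᵥ v := by
    rw [P.β_eq_mulVec_add, mulVec_add, mulVec_mulVec, Matrix.transpose_sub, sub_mulVec,
      Matrix.transpose_mul]
    abel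
  have ht : ∀ {l m : Type} [Fintype l] [Fintype m] (A : Matrix l m ℝ) (x : l → ℝ),
      vnorm (Aᵀ *ᵥ x) ≤ frobNorm A * vnorm x := by
    intro l m _ _ A x
    have := vnorm_mulVec_le Aᵀ x
    rwa [Matrix.frobenius_norm_transpose] at this
  have h2 : vnorm ((C - P.B * H)ᵀ *ᵥ S.phi J z) ^ 2 ≤
      frobNorm (C - P.B * H) ^ 2 * (M * J * b) := by
    refine (pow_le_pow_left₀ (vnorm_nonneg _) (ht _ _) 2).trans ?_
    rw [mul_pow]
    exact mul_le_mul_of_nonneg_left (vnorm_phi_sq_le S hb h hz) (sq_nonneg _)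
  have h3 : vnorm (Hᵀ *ᵥ v) ^ 2 ≤ frobNorm H ^ 2 * (K * (M * η) ^ 2) := by
    refine (pow_le_pow_left₀ (vnorm_nonneg _) (ht _ _) 2).trans ?_
    rw [mul_pow]
    refine mul_le_mul_of_nonneg_left ?_ (sq_nonneg _)
    rw [vnorm_sq_eq_dotProduct, dotProduct]
    refine (Finset.sum_le_sum fun k _ => ?_).trans_eq
      (by simp : ∑ _k : Fin K, (M * η) ^ 2 = K * (M * η) ^ 2)
    have := abs_sum_le_mul fun m => hδ m _ (hz m) k
    rw [Fintype.card_fin] at this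
    rw [← sq, ← sq_abs]
    exact pow_le_pow_left₀ (abs_nonneg _) this 2
  rw [h1]
  have h4 := pow_le_pow_left₀ (vnorm_nonneg _)
    (vnorm_sub_le ((C - P.B * H)ᵀ *ᵥ S.phi J z) (Hᵀ *ᵥ v)) 2
  linarith [sq_nonneg (vnorm ((C - P.B * H)ᵀ *ᵥ S.phi J z) - vnorm (Hᵀ *ᵥ v))]

end Panel

/-- Conversion of the bounds for the estimators into rates. -/
theorem rates_of_bounds {d e g h W x y A₁ A₂ A₃ D L u : ℝ} {M N T J : ℕ}
    (hN : 0 < N) (hT : 0 < T) (hL : 0 < L)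
    (hA₁ : 0 ≤ A₁) (hA₂ : 0 ≤ A₂) (hA₃ : 0 ≤ A₃) (hD : 0 ≤ D) (hu : 0 ≤ u)
    (hd : d = D * u) (he : e = Real.sqrt (L * (M * J / N)))
    (hg : g = Real.sqrt (L * (M * J / (N * T)))) (hh : h = Real.sqrt (L / N))
    (he1 : e ≤ 1) (hp : ((M : ℝ) * J) ^ 2 ≤ N)
    (hW0 : 0 ≤ W) (hx0 : 0 ≤ x)
    (hW : W ≤ A₁ * (d + g + e * h)) (hx : x ≤ A₂ * (W + d + g))
    (hy : y ≤ (A₃ * (d + h + h + e * W)) ^ 2) :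
    W ^ 2 ≤ A₁ ^ 2 * (3 * (D ^ 2 + L * M + L ^ 2 * M)) *
      (u ^ 2 + J / (N : ℝ) ^ 2 + J / ((N : ℝ) * T)) ∧
    x ^ 2 ≤ (A₂ * (A₁ + 1)) ^ 2 * (3 * (D ^ 2 + L * M + L ^ 2 * M)) *
      (u ^ 2 + J / (N : ℝ) ^ 2 + J / ((N : ℝ) * T)) ∧
    y ≤ (A₃ * (2 + A₁)) ^ 2 * (3 * (D ^ 2 + L + L ^ 2)) * (u ^ 2 + 1 / (N : ℝ)) := by
  have hN' : (0 : ℝ) < N := Nat.cast_pos.mpr hN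
  have hT' : (0 : ℝ) < T := Nat.cast_pos.mpr hT
  have hT1 : (1 : ℝ) ≤ T := Nat.one_le_cast.mpr hT
  have hd0 : 0 ≤ d := by rw [hd]; positivity
  have he0 : 0 ≤ e := by rw [he]; positivity
  have hg0 : 0 ≤ g := by rw [hg]; positivity
  have hh0 : 0 ≤ h := by rw [hh]; positivity
  have hd2 : d ^ 2 = D ^ 2 * u ^ 2 := by rw [hd, mul_pow]
  have he2 : e ^ 2 = L * (M * J / N) := by rw [he, Real.sq_sqrt (by positivity)]
  have hg2 : g ^ 2 = L * (M * J / (N * T)) := by rw [hg, Real.sq_sqrt (by positivity)]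
  have hh2 : h ^ 2 = L / N := by rw [hh, Real.sq_sqrt (by positivity)]
  have hX0 : 0 ≤ d + g + e * h := by positivity
  have hX : (d + g + e * h) ^ 2 ≤ 3 * (D ^ 2 + L * M + L ^ 2 * M) *
      (u ^ 2 + J / (N : ℝ) ^ 2 + J / ((N : ℝ) * T)) := by
    refine (sq_add_add_le _ _ _).trans ?_
    rw [mul_pow, hd2, he2, hg2, hh2]
    have e1 : L * (M * J / (N * T)) = (L * M) * (J / ((N : ℝ) * T)) := by ring
    have e2 : L * (M * J / N) * (L / N) = (L ^ 2 * M) * (J / (N : ℝ) ^ 2) := by field_simp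
    rw [e1, e2]
    have p1 : (0 : ℝ) ≤ J / (N : ℝ) ^ 2 := by positivity
    have p2 : (0 : ℝ) ≤ J / ((N : ℝ) * T) := by positivity
    set j1 : ℝ := J / (N : ℝ) ^ 2
    set j2 : ℝ := J / ((N : ℝ) * T)
    have q1 : 0 ≤ D ^ 2 := sq_nonneg _
    have q2 : 0 ≤ L * M := by positivity
    have q3 : 0 ≤ L ^ 2 * M := by positivity
    have q4 : 0 ≤ u ^ 2 := sq_nonneg _
    linarith [mul_nonneg q1 p1, mul_nonneg q1 p2, mul_nonneg q2 q4, mul_nonneg q2 p1,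
      mul_nonneg q3 q4, mul_nonneg q3 p2]
  refine ⟨?_, ?_, ?_⟩
  · calc W ^ 2 ≤ (A₁ * (d + g + e * h)) ^ 2 := pow_le_pow_left₀ hW0 hW 2
      _ = A₁ ^ 2 * (d + g + e * h) ^ 2 := by ring
      _ ≤ A₁ ^ 2 * _ := mul_le_mul_of_nonneg_left hX (sq_nonneg _)
      _ = _ := by ring
  · have h1 : x ≤ A₂ * (A₁ + 1) * (d + g + e * h) := by
      refine hx.trans ?_
      rw [mul_assoc]
      refine mul_le_mul_of_nonneg_left ?_ hA₂
      linarith [mul_nonneg he0 hh0]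
    calc x ^ 2 ≤ (A₂ * (A₁ + 1) * (d + g + e * h)) ^ 2 := pow_le_pow_left₀ hx0 h1 2
      _ = (A₂ * (A₁ + 1)) ^ 2 * (d + g + e * h) ^ 2 := by ring
      _ ≤ (A₂ * (A₁ + 1)) ^ 2 * _ := mul_le_mul_of_nonneg_left hX (sq_nonneg _)
      _ = _ := by ring
  · have h1 : e * W ≤ A₁ * (d + h + e * g) := by
      have k1 : e * d ≤ d := mul_le_of_le_one_left hd0 he1
      have k2 : e * (e * h) ≤ h := by
        have : e * h ≤ h := mul_le_of_le_one_left hh0 he1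
        exact (mul_le_of_le_one_left (by positivity) he1).trans this
      calc e * W ≤ e * (A₁ * (d + g + e * h)) := by gcongr
        _ = A₁ * (e * d + e * (e * h) + e * g) := by ring
        _ ≤ _ := by gcongr
    have h2 : A₃ * (d + h + h + e * W) ≤ A₃ * (2 + A₁) * (d + h + e * g) := by
      rw [mul_assoc]
      refine mul_le_mul_of_nonneg_left ?_ hA₃
      linarith [mul_nonneg he0 hg0]
    have h3 : 0 ≤ A₃ * (d + h + h + e * W) := by positivity
    have h4 : (d + h + e * g) ^ 2 ≤ 3 * (D ^ 2 + L + L ^ 2) * (u ^ 2 + 1 / (N : ℝ)) := by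
      refine (sq_add_add_le _ _ _).trans ?_
      rw [mul_pow, hd2, he2, hg2, hh2]
      -- The product `e g` has squared order `J²/(N²T)`; it drops to `1/N` because `(MJ)² ≤ N`.
      have e1 : L * (M * J / N) * (L * (M * J / (N * T))) ≤ L ^ 2 * (1 / N) := by
        have : L * (M * J / N) * (L * (M * J / (N * T))) =
            L ^ 2 * (((M : ℝ) * J) ^ 2 / (N ^ 2 * T)) := by field_simp
        rw [this]
        refine mul_le_mul_of_nonneg_left ?_ (sq_nonneg _)
        rw [div_le_div_iff₀ (by positivity) hN']
        calc ((M : ℝ) * J) ^ 2 * N ≤ N * N := by gcongr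
          _ = N ^ 2 * 1 := by ring
          _ ≤ N ^ 2 * T := by gcongr
          _ = 1 * (N ^ 2 * T) := by ring
      have e2 : L / N = L * (1 / N) := by ring
      rw [e2]
      have p1 : (0 : ℝ) ≤ 1 / (N : ℝ) := by positivity
      set j1 : ℝ := 1 / (N : ℝ)
      have q1 : 0 ≤ D ^ 2 := sq_nonneg _
      have q3 : 0 ≤ L ^ 2 := sq_nonneg _
      have q4 : 0 ≤ u ^ 2 := sq_nonneg _
      linarith [mul_nonneg q1 p1, mul_nonneg hL.le q4, mul_nonneg q3 q4]
    calc y ≤ _ := hy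
      _ ≤ (A₃ * (2 + A₁) * (d + h + e * g)) ^ 2 := pow_le_pow_left₀ h3 h2 2
      _ = (A₃ * (2 + A₁)) ^ 2 * (d + h + e * g) ^ 2 := by ring
      _ ≤ (A₃ * (2 + A₁)) ^ 2 * _ := mul_le_mul_of_nonneg_left h4 (sq_nonneg _)
      _ = _ := by ring

open scoped Matrix.Norms.Frobenius in
theorem frobNorm_nonneg {l m : Type*} [Fintype l] [Fintype m] (A : Matrix l m ℝ) :
    0 ≤ frobNorm A := by
  rw [frobNorm]; positivity

/-! ### Estimation errors along the sequence of panels -/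

section Rates

variable {Ω : Type*} [MeasurableSpace Ω] {μ : Measure Ω} [IsProbabilityMeasure μ]
  {K M : ℕ} {S : Model K M} {N T J : ℕ → ℕ} {P : ∀ n, Panel Ω K M (N n) (T n) (J n)} {κ : ℝ}

set_option maxHeartbeats 400000 in
/-- The estimation errors on the regular event. -/
theorem exists_eventually_error_le
    (hD : ∀ n i t, ∀ᵐ ω ∂μ, (P n).z i t ω ∈ S.dom)
    (hφ : ∃ C : ℝ, ∀ n i t m (j : Fin (J n)),
      Integrable (fun ω => S.φ j ((P n).z i t ω m) ^ 2) μ ∧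
      ∫ ω, S.φ j ((P n).z i t ω m) ^ 2 ∂μ ≤ C)
    {q : ℝ} (hq : 0 < q) (hQ : ∀ n i t, LtEigMin q ((P n).Q S μ i t))
    (hN : Tendsto N atTop atTop) (hT : ∀ᶠ n in atTop, 0 < T n) (hJ : Tendsto J atTop atTop)
    (hξ : Tendsto (fun n => (J n : ℝ≥0∞) ^ 2 * S.xi (J n) ^ 2 *
      ENNReal.ofReal (Real.log (J n)) / (N n : ℝ≥0∞)) atTop (𝓝 0))
    (h4 : InterceptAssumption P) {dmin dmax Ca cmin : ℝ} (hdmin : 0 < dmin) (hcmin : 0 < cmin)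
    (hκ : 1 / 2 < κ) (hCa : 0 ≤ Ca)
    (hB : ∀ n, LtEigMin dmin ((P n).Bᵀ * (P n).B) ∧ EigMaxLt ((P n).Bᵀ * (P n).B) dmax)
    (hf : ∀ n t, vnorm ((P n).f t) < dmax)
    (hF : ∀ n, LtEigMin dmin ((1 / (T n : ℝ)) • ((P n).Fᵀ * MT (T n) * (P n).F)))
    (happ : ∀ᶠ n in atTop, ∀ m, ∀ x ∈ S.D,
      (∀ k, |(P n).δ S k m x| ≤ Ca * (J n : ℝ) ^ (-κ)) ∧ |(P n).r S m x| ≤ Ca * (J n : ℝ) ^ (-κ))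
    (Bhat : ∀ n, Ω → Matrix (Fin M × Fin (J n)) (Fin K) ℝ)
    (hBhat : ∀ n ω, IsLeadingEigenvectors ((P n).pcaMatrix S ω) (Bhat n ω))
    {L : ℝ} (hL : 0 < L) :
    ∃ A : ℝ, 0 < A ∧ ∀ᶠ n in atTop, ∀ ω, (P n).RegularEvent S cmin L ω →
      vnorm ((P n).ahat S (Bhat n ω) ω - (P n).a) ^ 2 ≤
        A * (1 / (J n : ℝ) ^ (2 * κ) + (J n : ℝ) / (N n : ℝ) ^ 2 +
          (J n : ℝ) / ((N n : ℝ) * T n)) ∧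
      frobNorm (Bhat n ω - (P n).B * (P n).H S (Bhat n ω) ω) ^ 2 ≤
        A * (1 / (J n : ℝ) ^ (2 * κ) + (J n : ℝ) / (N n : ℝ) ^ 2 +
          (J n : ℝ) / ((N n : ℝ) * T n)) ∧
      (1 / (T n : ℝ)) *
        frobNorm ((P n).Fhat S (Bhat n ω) ω - (P n).F * ((P n).H S (Bhat n ω) ω)ᵀ⁻¹) ^ 2 ≤
        A * (1 / (J n : ℝ) ^ (2 * κ) + 1 / (N n : ℝ)) ∧
      frobNorm ((P n).H S (Bhat n ω) ω) ^ 2 ≤ A := by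
  obtain ⟨C₀, hC₀, ha⟩ := h4.bound
  -- One constant for all size bounds: `|dmax|` serves the factors, `C₀` the intercept, `K` the
  -- eigenvectors, and `K |dmax|` the squared Frobenius norm of `B`.
  obtain ⟨b, hb⟩ : ∃ x : ℝ, x = 1 + |dmax| + C₀ + K + K * |dmax| := ⟨_, rfl⟩
  have hK0 : (0 : ℝ) ≤ K := Nat.cast_nonneg K
  have hdm0 := abs_nonneg dmax
  have hKd : 0 ≤ K * |dmax| := by positivity
  have hb1 : 1 ≤ b := by linarith
  have hb0 : 0 < b := by linarith
  -- The bound on the inverse eigenvalue matrix, increased by 1 so that it stays positive when `K =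
  -- 0`.
  obtain ⟨ν, hν⟩ : ∃ x : ℝ, x = Real.sqrt K / (dmin ^ 2 / 4) + 1 := ⟨_, rfl⟩
  have hν0 : 0 < ν := by rw [hν]; positivity
  obtain ⟨D, hDdef⟩ : ∃ x : ℝ, x = (M * Ca + K * (M * Ca * |dmax|)) / Real.sqrt cmin := ⟨_, rfl⟩
  have hD0 : 0 ≤ D := by rw [hDdef]; positivity
  obtain ⟨A₁, hA₁⟩ : ∃ x : ℝ, x = 20 * b ^ 4 * (ν + 1) ^ 2 := ⟨_, rfl⟩
  obtain ⟨A₂, hA₂⟩ : ∃ x : ℝ, x = 5 * b ^ 5 := ⟨_, rfl⟩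
  obtain ⟨A₃, hA₃⟩ : ∃ x : ℝ, x = 100 * b ^ 10 * (ν + 1) ^ 2 := ⟨_, rfl⟩
  have hA₁0 : 0 ≤ A₁ := by rw [hA₁]; positivity
  have hA₂0 : 0 ≤ A₂ := by rw [hA₂]; positivity
  have hA₃0 : 0 ≤ A₃ := by rw [hA₃]; positivity
  obtain ⟨E₁, hE₁⟩ : ∃ x : ℝ, x = A₁ ^ 2 * (3 * (D ^ 2 + L * M + L ^ 2 * M)) := ⟨_, rfl⟩
  obtain ⟨E₂, hE₂⟩ : ∃ x : ℝ, x = (A₂ * (A₁ + 1)) ^ 2 * (3 * (D ^ 2 + L * M + L ^ 2 * M)) := ⟨_, rfl⟩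
  obtain ⟨E₃, hE₃⟩ : ∃ x : ℝ, x = (A₃ * (2 + A₁)) ^ 2 * (3 * (D ^ 2 + L + L ^ 2)) := ⟨_, rfl⟩
  have hE₁0 : 0 ≤ E₁ := by rw [hE₁]; positivity
  have hE₂0 : 0 ≤ E₂ := by rw [hE₂]; positivity
  have hE₃0 : 0 ≤ E₃ := by rw [hE₃]; positivity
  refine ⟨E₁ + E₂ + E₃ + (4 * b ^ 4 * ν) ^ 2 + 1, by positivity, ?_⟩
  -- `τ` is the level of bias plus noise below which all four smallness conditions of the
  -- perturbation bound hold; each of the two gets `τ/2`.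
  obtain ⟨τ, hτ, hτ1, hτ2, hτ3, hτ4⟩ : ∃ τ : ℝ, 0 < τ ∧ τ ≤ dmin / 4 ∧ τ ≤ 1 ∧
      4 * ν * τ ≤ 1 ∧ 8 * b ^ 4 * ν * τ ≤ 1 := by
    refine ⟨min (min (dmin / 4) 1) (min (4 * ν)⁻¹ (8 * b ^ 4 * ν)⁻¹), by positivity, ?_, ?_, ?_, ?_⟩
    · exact (min_le_left _ _).trans (min_le_left _ _)
    · exact (min_le_left _ _).trans (min_le_right _ _)
    · exact (mul_le_mul_of_nonneg_left ((min_le_right _ _).trans (min_le_left _ _))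
        (by positivity)).trans_eq (mul_inv_cancel₀ (by positivity))
    · exact (mul_le_mul_of_nonneg_left ((min_le_right _ _).trans (min_le_right _ _))
        (by positivity)).trans_eq (mul_inv_cancel₀ (by positivity))
  have hulim : Tendsto (fun n => D * (J n : ℝ) ^ (-κ)) atTop (𝓝 0) := by
    have := (tendsto_rpow_neg_atTop (by linarith : 0 < κ)).comp
      (tendsto_natCast_atTop_atTop.comp hJ)
    simpa using this.const_mul D
  filter_upwards [hN.eventually_gt_atTop 0, hT, hJ.eventually_gt_atTop 0, happ,
    hulim.eventually_le_const (by positivity : 0 < τ / 2),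
    eventually_sq_dim_le hD hφ hq hQ hN hT hJ hξ one_pos,
    eventually_sq_dim_le hD hφ hq hQ hN hT hJ hξ (by positivity : 0 < (τ / 2) ^ 2 / L)]
    with n hNn hTn hJn happn hun hp1 hp2 ω hω
  have hN' : (0 : ℝ) < N n := Nat.cast_pos.mpr hNn
  have hJ' : (0 : ℝ) < J n := Nat.cast_pos.mpr hJn
  rw [one_mul] at hp1
  set u : ℝ := (J n : ℝ) ^ (-κ) with hu
  have hu0 : 0 ≤ u := by positivity
  have hu2 : 1 / (J n : ℝ) ^ (2 * κ) = u ^ 2 := by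
    rw [hu, ← Real.rpow_natCast, ← Real.rpow_mul hJ'.le, one_div, ← Real.rpow_neg hJ'.le]
    congr 1; push_cast; ring
  rw [hu2]
  set e : ℝ := Real.sqrt (L * (M * J n / N n)) with he
  have heτ : e ≤ τ / 2 := by
    rw [he]
    refine Real.sqrt_le_iff.mpr ⟨by positivity, ?_⟩
    -- Being a natural number, `MJ` is at most its square, so the bound on `(MJ)²/N` also controls
    -- `MJ/N`.
    have h1 : (M : ℝ) * J n ≤ ((M : ℝ) * J n) ^ 2 := by
      have : M * J n ≤ (M * J n) ^ 2 := Nat.le_self_pow (by norm_num) _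
      exact_mod_cast this
    have h2 : (M : ℝ) * J n / N n ≤ (τ / 2) ^ 2 / L := by
      rw [div_le_iff₀ hN']; exact h1.trans hp2
    calc L * (M * J n / N n) ≤ L * ((τ / 2) ^ 2 / L) := by gcongr
      _ = _ := by field_simp
  have hde : D * u + e ≤ τ := by linarith
  have hηn : 0 ≤ Ca * u := by positivity
  have hf' : ∀ t, vnorm ((P n).f t) ≤ |dmax| := fun t => (hf n t).le.trans (le_abs_self _)
  have hsieve := (P n).abs_sieveError_le S hηn hω.dom (fun m x hx => (happn m x hx).2)
    (fun m x hx => (happn m x hx).1) hf'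
  have hhermB : ((P n).Bᵀ * (P n).B).IsHermitian := by
    have := Matrix.isHermitian_conjTranspose_mul_self (P n).B
    rwa [Matrix.conjTranspose_eq_transpose_of_trivial] at this
  have hMTt : (MT (T n))ᵀ = MT (T n) := by
    ext i j; simp [MT, Matrix.one_apply, eq_comm]
  have hhermF : ((1 / (T n : ℝ)) • ((P n).Fᵀ * MT (T n) * (P n).F)).IsHermitian := by
    rw [Matrix.IsHermitian, Matrix.conjTranspose_eq_transpose_of_trivial, Matrix.transpose_smul,
      Matrix.transpose_mul, Matrix.transpose_mul, Matrix.transpose_transpose, hMTt,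
      Matrix.mul_assoc]
  have hBnorm : frobNorm (P n).B ≤ b := by
    have h1 := frobenius_norm_sq (P n).B
    have h2 : ∑ i, ∑ k, (P n).B i k ^ 2 ≤ K * |dmax| := by
      rw [Finset.sum_comm]
      refine (Finset.sum_le_sum fun k _ => ?_).trans_eq
        (by simp : ∑ _k : Fin K, |dmax| = K * |dmax|)
      have := ((P n).vnorm_B_col_sq_le (hB n).2 k).trans (le_abs_self _)
      rw [vnorm_sq_eq_dotProduct] at this
      simpa [dotProduct, sq] using this
    have h3 : frobNorm (P n).B ^ 2 ≤ b ^ 2 := by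
      refine (h1.trans_le h2).trans ?_
      have : b ≤ b ^ 2 := le_self_pow₀ hb1 (by norm_num)
      linarith
    exact le_of_sq_le_sq h3 hb0.le
  have hρ : D * u = (M * (Ca * u) + K * (M * (Ca * u) * |dmax|)) / Real.sqrt cmin := by
    rw [hDdef]; ring
  obtain ⟨r1, r2, r3, r4⟩ := (P n).estimation_error_le S (ω := ω) (C := Bhat n ω) hTn hNn
    (by positivity) hb1 hdmin (by linarith) hcmin
    (fun v => (hB n).1.le_dotProduct_mulVec hhermB v)
    (fun v => (hF n).le_dotProduct_mulVec hhermF v) (h4.orth n)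
    ((ha n).le.trans (by linarith)) hBnorm (fun t => (hf' t).trans (by linarith))
    (by linarith) (hBhat n ω) hω.gram hω.noise hsieve
    (D * u) e (Real.sqrt (L * (M * J n / (N n * T n)))) (Real.sqrt (L / N n)) hρ he rfl rfl
    (hde.trans hτ1) (hde.trans hτ2)
    ((mul_le_mul_of_nonneg_left hde (by positivity)).trans hτ3)
    ((mul_le_mul_of_nonneg_left hde (by positivity)).trans hτ4)
  rw [← hA₁] at r1
  rw [← hA₂] at r3
  rw [← hA₃] at r4
  obtain ⟨s1, s2, s3⟩ := rates_of_bounds hNn hTn hL hA₁0 hA₂0 hA₃0 hD0 hu0 rfl he rfl rfl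
    (by linarith) hp1 (frobNorm_nonneg _) (vnorm_nonneg _) r1 r3 r4
  rw [← hE₁] at s1
  rw [← hE₂] at s2
  rw [← hE₃] at s3
  have hR1 : (0 : ℝ) ≤ u ^ 2 + J n / (N n : ℝ) ^ 2 + J n / ((N n : ℝ) * T n) := by positivity
  have hR3 : (0 : ℝ) ≤ u ^ 2 + 1 / (N n : ℝ) := by positivity
  have hH2 : 0 ≤ (4 * b ^ 4 * ν) ^ 2 := sq_nonneg _
  refine ⟨s2.trans (mul_le_mul_of_nonneg_right (by linarith) hR1),
    s1.trans (mul_le_mul_of_nonneg_right (by linarith) hR1),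
    s3.trans (mul_le_mul_of_nonneg_right (by linarith) hR3), ?_⟩
  have := pow_le_pow_left₀ (frobNorm_nonneg _) r2 2
  exact this.trans (by linarith)

end Rates

/-- The basis functions may be unbounded on the domain. Then the right side is infinite, thanks to
positivity of `C` and `R`, and only finite `m` needs an argument. -/
theorem le_ofReal_mul_of_forall_eq {X m : ℝ≥0∞} {C R : ℝ} (hC : 0 < C) (hR : 0 < R)
    (h : ∀ b : ℝ, 0 ≤ b → m = ENNReal.ofReal b → X ≤ ENNReal.ofReal (C * (R * b))) :
    X ≤ ENNReal.ofReal C * (ENNReal.ofReal R * m) := by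
  rcases eq_or_ne m ⊤ with hm | hm
  · rw [hm, ENNReal.mul_top (by simpa using hR), ENNReal.mul_top (by simpa using hC)]
    exact le_top
  · have hx : m = ENNReal.ofReal m.toReal := (ENNReal.ofReal_toReal hm).symm
    have := h _ ENNReal.toReal_nonneg hx
    rwa [ENNReal.ofReal_mul hC.le, ENNReal.ofReal_mul hR.le, ← hx] at this

/-- Conversion of a bound for coefficients into a bound uniform over the covariates. -/
theorem uniform_rate_le {x R₁ R₂ A B u b q : ℝ} {M J : ℕ} (hJ : 0 < J) (hB : 0 ≤ B)
    (hb : 0 ≤ b) (hq : 0 < q) (hx : x ≤ A * R₁) (hR : R₂ = J * R₁) (hu : u ^ 2 ≤ R₁)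
    (hM : 0 < M → q ≤ b) :
    2 * (x * (M * J * b)) + 2 * (B * (M * u) ^ 2) ≤
      (2 * A * M + 2 * B * M ^ 2 / q + 1) * (R₂ * b) := by
  have hJ1 : (1 : ℝ) ≤ J := Nat.one_le_cast.mpr hJ
  have hR0 : 0 ≤ R₁ := (sq_nonneg u).trans hu
  have h1 : 2 * (x * (M * J * b)) ≤ 2 * (A * R₁ * (M * J * b)) := by gcongr
  -- The sieve error lacks the factor `b` of the claimed rate; `q ≤ b` supplies it. For `M = 0` that
  -- bound is unavailable, but the left side is zero.
  have h2 : (M * u) ^ 2 ≤ M ^ 2 / q * (J * R₁ * b) := by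
    rcases Nat.eq_zero_or_pos M with h0 | h0
    · rw [h0]; simp
    · have hqb := hM h0
      calc (M * u) ^ 2 = M ^ 2 / q * (1 * u ^ 2 * q) := by field_simp
        _ ≤ M ^ 2 / q * (J * R₁ * b) := by gcongr
  have h3 : 2 * (B * (M * u) ^ 2) ≤ 2 * (B * (M ^ 2 / q * (J * R₁ * b))) := by gcongr
  have h4 : 0 ≤ J * R₁ * b := by positivity
  rw [hR]
  calc _ ≤ 2 * (A * R₁ * (M * J * b)) + 2 * (B * (M ^ 2 / q * (J * R₁ * b))) := add_le_add h1 h3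
    _ = (2 * A * M + 2 * B * M ^ 2 / q) * (J * R₁ * b) := by ring
    _ ≤ _ := mul_le_mul_of_nonneg_right (by linarith) h4

end RegressedPCA

/-! ### Assembly of the five rates -/

theorem mainTheorem1 {Ω : Type*} [MeasurableSpace Ω] (μ : Measure Ω) [IsProbabilityMeasure μ]
    {K M : ℕ} (S : Model K M) (N T J : ℕ → ℕ)
    (P : ∀ n, Panel Ω K M (N n) (T n) (J n)) (κ : ℝ)
    (hD : ∀ n i t, ∀ᵐ ω ∂μ, (P n).z i t ω ∈ S.dom)
    (h1 : BasisAssumption μ S P)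
    (h2 : LoadingsFactorsAssumption S P κ)
    (h3 : DGPAssumption μ P)
    (h4 : InterceptAssumption P)
    (h5 : RateAssumption μ S P)
    (hN : Tendsto N atTop atTop)
    (hT : Tendsto T atTop atTop ∨ ∃ T₀, K + 1 ≤ T₀ ∧ ∀ n, T n = T₀)
    (hJ : Tendsto J atTop atTop)
    (hξ : Tendsto (fun n => (J n : ℝ≥0∞) ^ 2 * S.xi (J n) ^ 2 *
      ENNReal.ofReal (Real.log (J n)) / (N n : ℝ≥0∞)) atTop (𝓝 0))
    (Bhat : ∀ n, Ω → Matrix (Fin M × Fin (J n)) (Fin K) ℝ)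
    (hBhat : ∀ n ω, IsLeadingEigenvectors ((P n).pcaMatrix S ω) (Bhat n ω)) :
    IsBigOp μ (fun n ω => ENNReal.ofReal (vnorm ((P n).ahat S (Bhat n ω) ω - (P n).a) ^ 2))
      (fun n => ENNReal.ofReal (1 / (J n : ℝ) ^ (2 * κ) + (J n : ℝ) / (N n : ℝ) ^ 2 +
        (J n : ℝ) / ((N n : ℝ) * T n))) ∧
    IsBigOp μ (fun n ω => ENNReal.ofReal
        (frobNorm (Bhat n ω - (P n).B * (P n).H S (Bhat n ω) ω) ^ 2))
      (fun n => ENNReal.ofReal (1 / (J n : ℝ) ^ (2 * κ) + (J n : ℝ) / (N n : ℝ) ^ 2 +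
        (J n : ℝ) / ((N n : ℝ) * T n))) ∧
    IsBigOp μ (fun n ω => ENNReal.ofReal ((1 / (T n : ℝ)) *
        frobNorm ((P n).Fhat S (Bhat n ω) ω - (P n).F * ((P n).H S (Bhat n ω) ω)ᵀ⁻¹) ^ 2))
      (fun n => ENNReal.ofReal (1 / (J n : ℝ) ^ (2 * κ) + 1 / (N n : ℝ))) ∧
    IsBigOp μ (fun n ω => (P n).supErrα S (Bhat n ω) ω)
      (fun n => ENNReal.ofReal (1 / (J n : ℝ) ^ (2 * κ - 1) + (J n : ℝ) ^ 2 / (N n : ℝ) ^ 2 +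
        (J n : ℝ) ^ 2 / ((N n : ℝ) * T n)) * S.maxSupSq (J n)) ∧
    IsBigOp μ (fun n ω => (P n).supErrβ S (Bhat n ω) ω)
      (fun n => ENNReal.ofReal (1 / (J n : ℝ) ^ (2 * κ - 1) + (J n : ℝ) ^ 2 / (N n : ℝ) ^ 2 +
        (J n : ℝ) ^ 2 / ((N n : ℝ) * T n)) * S.maxSupSq (J n)) := by
  obtain ⟨cmin, cmax, hcmin, _, hgram⟩ := h1.gram
  obtain ⟨dmin, dmax, hdmin, _, hB, hf, hF⟩ := h2.bounds
  obtain ⟨Ca, happ⟩ := h2.approx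
  obtain ⟨q, qmax, hq, hQ⟩ := h5.eig
  have hQ' := fun n i t => (hQ n i t).1
  have hκ := h2.kappa
  have hT' : ∀ᶠ n in atTop, 0 < T n := by
    rcases hT with h | ⟨T₀, hT₀, h⟩
    · exact h.eventually_gt_atTop 0
    · exact Eventually.of_forall fun n => by rw [h n]; omega
  have happ' : ∀ᶠ n in atTop, ∀ m, ∀ x ∈ S.D,
      (∀ k, |(P n).δ S k m x| ≤ |Ca| * (J n : ℝ) ^ (-κ)) ∧
        |(P n).r S m x| ≤ |Ca| * (J n : ℝ) ^ (-κ) := by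
    filter_upwards [happ] with n hn m x hx
    have hle : Ca * (J n : ℝ) ^ (-κ) ≤ |Ca| * (J n : ℝ) ^ (-κ) :=
      mul_le_mul_of_nonneg_right (le_abs_self _) (by positivity)
    exact ⟨fun k => ((hn m x hx).1 k).trans hle, (hn m x hx).2.trans hle⟩
  have hreg := fun (ε : ℝ) (hε : 0 < ε) =>
    eventually_measure_not_regularEvent_le hD hcmin hgram h1.moment2 (fun n => (hB n).2) hf h3 h4
      hN hT' hε
  have herr := fun (L : ℝ) (hL : 0 < L) =>
    exists_eventually_error_le hD h1.moment2 hq hQ' hN hT' hJ hξ h4 hdmin hcmin hκ (abs_nonneg Ca)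
      hB hf hF happ' Bhat hBhat hL
  have hmax : ∀ᶠ n in atTop, 0 < M → ENNReal.ofReal q ≤ S.maxSupSq (J n) := by
    obtain ⟨C, hC⟩ := h1.moment2
    filter_upwards [hN.eventually_gt_atTop 0, hT', hJ.eventually_gt_atTop 0] with n hNn hTn hJn hM
    exact (P n).ofReal_le_maxSupSq S (hD n ⟨0, hNn⟩ ⟨0, hTn⟩) ⟨0, hM⟩ ⟨0, hJn⟩
      (hC n _ _ _ _).1 (hQ' n _ _)
  -- The uniform rate is `J` times the coefficient rate, it is positive even where division by zero
  -- could occur, and the coefficient rate dominates the squared sieve error.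
  have hR : ∀ n, 0 < J n →
      (1 / (J n : ℝ) ^ (2 * κ - 1) + (J n : ℝ) ^ 2 / (N n : ℝ) ^ 2 +
        (J n : ℝ) ^ 2 / ((N n : ℝ) * T n)) =
      J n * (1 / (J n : ℝ) ^ (2 * κ) + (J n : ℝ) / (N n : ℝ) ^ 2 +
        (J n : ℝ) / ((N n : ℝ) * T n)) ∧
      (0 : ℝ) < 1 / (J n : ℝ) ^ (2 * κ - 1) + (J n : ℝ) ^ 2 / (N n : ℝ) ^ 2 +
        (J n : ℝ) ^ 2 / ((N n : ℝ) * T n) ∧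
      ((J n : ℝ) ^ (-κ)) ^ 2 ≤ 1 / (J n : ℝ) ^ (2 * κ) + (J n : ℝ) / (N n : ℝ) ^ 2 +
        (J n : ℝ) / ((N n : ℝ) * T n) := by
    intro n hJn
    have hJ' : (0 : ℝ) < J n := Nat.cast_pos.mpr hJn
    refine ⟨?_, by positivity, ?_⟩
    · rw [Real.rpow_sub_one hJ'.ne', one_div_div]
      ring
    · have : ((J n : ℝ) ^ (-κ)) ^ 2 = 1 / (J n : ℝ) ^ (2 * κ) := by
        rw [← Real.rpow_natCast, ← Real.rpow_mul hJ'.le, one_div, ← Real.rpow_neg hJ'.le]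
        congr 1; push_cast; ring
      rw [this, add_assoc]
      exact le_add_of_nonneg_right (by positivity)
  refine ⟨isBigOp_of_eventually_le hreg fun L hL => ?_,
    isBigOp_of_eventually_le hreg fun L hL => ?_, isBigOp_of_eventually_le hreg fun L hL => ?_,
    isBigOp_of_eventually_le hreg fun L hL => ?_, isBigOp_of_eventually_le hreg fun L hL => ?_⟩
  · obtain ⟨A, hA, h⟩ := herr L hL
    refine ⟨A, hA, h.mono fun n hn ω hω => ?_⟩
    rw [← ENNReal.ofReal_mul hA.le]
    exact ENNReal.ofReal_le_ofReal (hn ω hω).1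
  · obtain ⟨A, hA, h⟩ := herr L hL
    refine ⟨A, hA, h.mono fun n hn ω hω => ?_⟩
    rw [← ENNReal.ofReal_mul hA.le]
    exact ENNReal.ofReal_le_ofReal (hn ω hω).2.1
  · obtain ⟨A, hA, h⟩ := herr L hL
    refine ⟨A, hA, h.mono fun n hn ω hω => ?_⟩
    rw [← ENNReal.ofReal_mul hA.le]
    exact ENNReal.ofReal_le_ofReal (hn ω hω).2.2.1
  · obtain ⟨A, hA, h⟩ := herr L hL
    have hC : 0 < 2 * A * M + 2 * Ca ^ 2 * M ^ 2 / q + 1 := by positivity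
    refine ⟨_, hC, ?_⟩
    filter_upwards [h, happ', hmax, hJ.eventually_gt_atTop 0] with n hn happn hmn hJn ω hω
    obtain ⟨hR1, hR2, hR3⟩ := hR n hJn
    refine le_ofReal_mul_of_forall_eq hC hR2 fun b hb hmb => ?_
    refine iSup₂_le fun z hz => ENNReal.ofReal_le_ofReal ?_
    refine ((P n).sq_αhat_sub_le S hb hmb (fun m x hx => (happn m x hx).2) (Bhat n ω) ω hz).trans ?_
    refine le_trans (le_of_eq ?_) (uniform_rate_le hJn (sq_nonneg Ca) hb hq (hn ω hω).1 hR1 hR3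
      fun hM => (ENNReal.ofReal_le_ofReal_iff hb).mp (hmb ▸ hmn hM))
    rw [← sq_abs Ca]; ring
  · obtain ⟨A, hA, h⟩ := herr L hL
    -- The factor `A K` comes from `‖H‖² ≤ A` and from summing the sieve errors of the `K` loading
    -- functions.
    have hC : 0 < 2 * A * M + 2 * (A * K * Ca ^ 2) * M ^ 2 / q + 1 := by positivity
    refine ⟨_, hC, ?_⟩
    filter_upwards [h, happ', hmax, hJ.eventually_gt_atTop 0] with n hn happn hmn hJn ω hω
    obtain ⟨hR1, hR2, hR3⟩ := hR n hJn
    refine le_ofReal_mul_of_forall_eq hC hR2 fun b hb hmb => ?_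
    refine iSup₂_le fun z hz => ENNReal.ofReal_le_ofReal ?_
    refine ((P n).sq_βhat_sub_le S hb hmb (fun m x hx => (happn m x hx).1) (Bhat n ω) ω hz).trans ?_
    refine le_trans ?_ (uniform_rate_le hJn (B := A * K * Ca ^ 2) (by positivity) hb hq
      (hn ω hω).2.1 hR1 hR3 fun hM => (ENNReal.ofReal_le_ofReal_iff hb).mp (hmb ▸ hmn hM))
    refine add_le_add le_rfl (mul_le_mul_of_nonneg_left ?_ (by norm_num))
    refine (mul_le_mul_of_nonneg_right (hn ω hω).2.2.2 (by positivity)).trans_eq ?_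
    rw [← sq_abs Ca]; ring
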